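/- Let $d\ge 2$ and let $\Omega\subset\mathbb R^d$ be a bounded open set with Lipschitz boundary $\Gamma$. Let $g_0(s)=\sum_{i=0}^N a_is^{\alpha_i}$, where $N\ge 1$, $0=\alpha_0<\alpha_1<\dots<\alpha_N$ are real, $a_i\ge 0$, and $a_0,a_N>0$. For $\xi\ge 0$ put $K(\xi)=1/g_0(s(\xi))$, where $s(\xi)$ is the unique $s\ge 0$ with $s\,g_0(s)=\xi$. Put $$a=\frac{\alpha_N}{\alpha_N+1},\qquad \beta=2-a,\qquad \lambda=\frac{\beta}{\beta-1},$$ and assume the degree condition $a\le \frac4{d+2}$ (that is, $\alpha_N\le\frac 4{d-2}$ if $d\ge 3$, and no condition if $d=2$). Write $(\cdot,\cdot)$ and $\|\cdot\|$ for the inner product and norm of $L^2(\Omega)$ (scalar or vector valued), and $\|u\|_1=(\|u\|^2+\|\nabla u\|^2)^{1/2}$ for the norm of $H^1(\Omega)$. Let $r\ge 0$ be an integer and $\sigma>0$. Let $\mathcal T_h$ be a finite conforming simplicial triangulation of $\overline\Omega$ with maximal element diameter $h$, quasi-uniform with constant $\sigma$: every element contains a ball of radius $\sigma h$. Let $W_h$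 be the space of continuous functions on $\overline\Omega$ that are polynomials of degree at most $r$ on each element, let $W_h^0=\{v\in W_h: v=0\text{ on }\Gamma\}$, and let $\pi$ be the $L^2(\Omega)$-orthogonal projection onto $W_h$. Let $\tilde\rho^0\in L^2(\Omega)$ and, for each $t\ge 0$, let $\tilde f(t)\in L^2(\Omega)$ and $\phi(t)\in H^1(\Omega)$. Let $\tilde\rho_h=\rho_h-\pi\phi:[0,\infty)\to W_h^0$ be a solution of the semidiscrete problem $$(\tilde\rho_{h,t},w_h)+(K(|\nabla\rho_h|)\nabla\rho_h,\nabla w_h)=(\tilde f,w_h)\qquad\text{for all } w_h\in W_h^0,\ t>0,$$ continuous at $t=0$ and differentiable for $t>0$, whose initial value $\tilde\rho_h(0)$ is the $L^2(\Omega)$-orthogonal projection of $\tilde\rho^0$ onto $W_h^0$. Put $$g(t)=\|\tilde f(t)\|^\lambda+\|\phi(t)\|_1^2 .$$ Then there is a constant $C>0$, depending only on $d$, $\Omega$, $g_0$, $r$ and $\sigma$ (and not on the triangulation, its mesh size, $\tilde\rho^0$, $\tilde f$, $\phi$ or the solution), such that the following hold. 1. For every continuous nondecreasing function $\mathrm{Env}\,g$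 on $[0,\infty)$ with $\mathrm{Env}\,g\ge g$ and all $t>0$, $$\|\tilde\rho_h(t)\|\le C\Big(1+\|\tilde\rho^0\|+\big(\mathrm{Env}\,g(t)\big)^{1/\beta}\Big).$$ 2. In $[0,\infty]$, $$\limsup_{t\to\infty}\|\tilde\rho_h(t)\|^2\le C\Big(1+\limsup_{t\to\infty}g(t)\Big)^{2/\beta}.$$ 3. If $\limsup_{t\to\infty}\|\tilde f(t)\|=\limsup_{t\to\infty}\|\phi(t)\|_1=0$, then $\limsup_{t\to\infty}\|\tilde\rho_h(t)\|^2=0$. -/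

import Mathlib

open MeasureTheory Filter Topology Set
open scoped ContDiff

noncomputable section

namespace Forchheimer

/-- A generalized polynomial `g(s) = a₀ s^α₀ + a₁ s^α₁ + ⋯ + a_N s^α_N` with `N ≥ 1`, real exponents
`0 = α₀ < α₁ < ⋯ < α_N` and nonnegative coefficients such that `a₀ > 0` and `a_N > 0`. -/
structure GenPoly where
  N : ℕ
  one_le_N : 1 ≤ N
  exponent : Fin (N + 1) → ℝ
  coeff : Fin (N + 1) → ℝ
  exponent_zero : exponent 0 = 0
  exponent_strictMono : StrictMono exponent
  coeff_nonneg : ∀ i, 0 ≤ coeff i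
  coeff_zero_pos : 0 < coeff 0
  coeff_last_pos : 0 < coeff (Fin.last N)

namespace GenPoly

variable (P : GenPoly)

/-- The value `g(s)`, for `s ≥ 0`. -/
def g (s : ℝ) : ℝ := ∑ i, P.coeff i * s ^ P.exponent i

/-- The degree `α_N` of `g`. -/
def deg : ℝ := P.exponent (Fin.last P.N)

/-- The exponent `a = α_N / (α_N + 1)`. -/
def a : ℝ := P.deg / (P.deg + 1)

/-- The exponent `β = 2 - a`. -/
def β : ℝ := 2 - P.a

/-- The exponent `λ = β / (β - 1) = (2 - a) / (1 - a)`. -/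
def lam : ℝ := P.β / (P.β - 1)

/-- The unique `s ≥ 0` with `s g(s) = ξ`, for `ξ ≥ 0`. -/
def root (ξ : ℝ) : ℝ := Classical.epsilon fun s : ℝ => 0 ≤ s ∧ s * P.g s = ξ

/-- The function `K(ξ) = 1 / g(s(ξ))`, for `ξ ≥ 0`. -/
def K (ξ : ℝ) : ℝ := 1 / P.g (P.root ξ)

/-- The Degree Condition `a ≤ 4 / (d + 2)`; it says `deg g ≤ 4 / (d - 2)` for `d ≥ 3` and
nothing for `d = 2`. -/
def DegreeCondition (d : ℕ) : Prop := P.a ≤ 4 / ((d : ℝ) + 2)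

lemma exponent_nonneg (i : Fin (P.N + 1)) : 0 ≤ P.exponent i := by
  rw [← P.exponent_zero]
  exact P.exponent_strictMono.monotone (Fin.zero_le i)

lemma coeff_zero_le_g {s : ℝ} (hs : 0 ≤ s) : P.coeff 0 ≤ P.g s := by
  have h := Finset.single_le_sum (f := fun i => P.coeff i * s ^ P.exponent i)
    (fun i _ => mul_nonneg (P.coeff_nonneg i) (Real.rpow_nonneg hs _)) (Finset.mem_univ 0)
  simpa [g, P.exponent_zero] using h

/-- The equation that defines `s(ξ)` has exactly one nonnegative solution. -/
lemma existsUnique_root {ξ : ℝ} (hξ : 0 ≤ ξ) : ∃! s : ℝ, 0 ≤ s ∧ s * P.g s = ξ := by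
  have hcont : Continuous fun s : ℝ => s * P.g s :=
    continuous_id.mul (continuous_finsetSum _ fun i _ =>
      continuous_const.mul (Real.continuous_rpow_const (P.exponent_nonneg i)))
  have hmono : ∀ s t : ℝ, 0 ≤ s → s < t → s * P.g s < t * P.g t := by
    intro s t hs hst
    have hg : P.g s ≤ P.g t := Finset.sum_le_sum fun i _ =>
      mul_le_mul_of_nonneg_left (Real.rpow_le_rpow hs hst.le (P.exponent_nonneg i))
        (P.coeff_nonneg i)
    have hpos : 0 < P.g t := P.coeff_zero_pos.trans_le (P.coeff_zero_le_g (hs.trans hst.le))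
    calc s * P.g s ≤ s * P.g t := mul_le_mul_of_nonneg_left hg hs
      _ < t * P.g t := mul_lt_mul_of_pos_right hst hpos
  have h0 := P.coeff_zero_pos
  have hb : 0 ≤ ξ / P.coeff 0 := div_nonneg hξ h0.le
  have htop : ξ ≤ ξ / P.coeff 0 * P.g (ξ / P.coeff 0) := by
    calc ξ = ξ / P.coeff 0 * P.coeff 0 := by field_simp
      _ ≤ _ := mul_le_mul_of_nonneg_left (P.coeff_zero_le_g hb) hb
  obtain ⟨s, hs, hsξ⟩ := intermediate_value_Icc hb hcont.continuousOn
    (show ξ ∈ Icc ((0 : ℝ) * P.g 0) _ from ⟨by simpa using hξ, htop⟩)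
  refine ⟨s, ⟨hs.1, hsξ⟩, ?_⟩
  rintro t ⟨ht, htξ⟩
  rcases lt_trichotomy t s with h | h | h
  · exact absurd (hmono t s ht h) (by simp only [htξ] at *; simp [hsξ])
  · exact h
  · exact absurd (hmono s t hs.1 h) (by simp only [htξ] at *; simp [hsξ])

lemma root_spec {ξ : ℝ} (hξ : 0 ≤ ξ) : 0 ≤ P.root ξ ∧ P.root ξ * P.g (P.root ξ) = ξ :=
  Classical.epsilon_spec (P.existsUnique_root hξ).exists

end GenPoly

/-! ### Domains and function spaces -/

/-- `ℝ^d` with the Euclidean norm. -/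
abbrev Space (d : ℕ) : Type := EuclideanSpace ℝ (Fin d)

variable {d : ℕ}

/-- The boundary of `Ω` is locally the graph of a Lipschitz function, with `Ω` on one side of it:
`ν` is the vertical direction and `ψ` a Lipschitz function of the horizontal component. -/
def HasLipschitzBoundary (Ω : Set (Space d)) : Prop :=
  ∀ x ∈ frontier Ω, ∃ U ∈ 𝓝 x, ∃ ν : Space d, ‖ν‖ = 1 ∧
    ∃ (L : NNReal) (ψ : Space d → ℝ), LipschitzWith L ψ ∧
      ∀ y ∈ U, (y ∈ Ω ↔ inner ℝ ν y < ψ (y - (inner ℝ ν y : ℝ) • ν))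

/-- The norm of `L²(Ω)`, for scalar and for vector functions. -/
def l2Norm {F : Type*} [NormedAddCommGroup F] (Ω : Set (Space d)) (u : Space d → F) : ℝ :=
  (eLpNorm u 2 (volume.restrict Ω)).toReal

/-- `G` is a square integrable weak gradient of `u` on `Ω`. -/
def IsWeakGradient (Ω : Set (Space d)) (u : Space d → ℝ) (G : Space d → Space d) : Prop :=
  MemLp G 2 (volume.restrict Ω) ∧
    ∀ η : Space d → ℝ, ContDiff ℝ ∞ η → HasCompactSupport η → tsupport η ⊆ Ω →
      ∫ x in Ω, u x • gradient η x = - ∫ x in Ω, η x • G x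

/-- Membership in `H¹(Ω)`. -/
def MemH1 (Ω : Set (Space d)) (u : Space d → ℝ) : Prop :=
  MemLp u 2 (volume.restrict Ω) ∧ ∃ G, IsWeakGradient Ω u G

/-- The weak gradient of `u ∈ H¹(Ω)`; it is determined up to a null set. -/
def weakGradient (Ω : Set (Space d)) (u : Space d → ℝ) : Space d → Space d :=
  Classical.epsilon fun G => IsWeakGradient Ω u G

/-- The norm `‖u‖₁ = (‖u‖² + ‖∇u‖²)^{1/2}` of `H¹(Ω)`. -/
def h1Norm (Ω : Set (Space d)) (u : Space d → ℝ) : ℝ :=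
  Real.sqrt (l2Norm Ω u ^ 2 + l2Norm Ω (weakGradient Ω u) ^ 2)

/-! ### Triangulations and finite element spaces -/

/-- A triangulation of `Ω`: a finite simplicial complex (so any two simplices meet in a common
face or not at all), all of whose simplices are faces of `d`-dimensional ones, and whose union is
the closure of `Ω`. -/
structure Triangulation (Ω : Set (Space d)) where
  complex : Geometry.SimplicialComplex ℝ (Space d)
  finite : complex.faces.Finite
  pure : ∀ s ∈ complex.faces, ∃ t ∈ complex.faces, s ⊆ t ∧ t.card = d + 1
  space_eq : complex.space = closure Ω

namespace Triangulation

variable {Ω : Set (Space d)} (T : Triangulation Ω)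

/-- The elements of the triangulation, i.e. its `d`-dimensional simplices, as vertex sets. -/
def cells : Set (Finset (Space d)) := {s | s ∈ T.complex.faces ∧ s.card = d + 1}

/-- The mesh size `h`: the maximum diameter of an element. -/
def meshSize : ℝ :=
  sSup ((fun s : Finset (Space d) => Metric.diam (convexHull ℝ (s : Set (Space d)))) '' T.cells)

/-- Global quasi-uniformity with constant `σ`: each element contains a ball of radius `σ h`. -/
def QuasiUniform (σ : ℝ) : Prop :=
  ∀ s ∈ T.cells, ∃ x,
    Metric.closedBall x (σ * T.meshSize) ⊆ convexHull ℝ (s : Set (Space d))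

/-- The finite element space `W_h` of the continuous functions on the closure of `Ω` that are
polynomials of degree at most `r` on each element. -/
def W (r : ℕ) : Set (Space d → ℝ) :=
  {v | ContinuousOn v (closure Ω) ∧ ∀ s ∈ T.cells, ∃ p : MvPolynomial (Fin d) ℝ,
    p.totalDegree ≤ r ∧
      ∀ x ∈ convexHull ℝ (s : Set (Space d)), v x = MvPolynomial.eval (fun i => x i) p}

/-- The subspace of the functions in `W_h` that vanish on the boundary of `Ω`, that is,
`W_h ∩ H₀¹(Ω)`. -/
def W₀ (r : ℕ) : Set (Space d → ℝ) := {v | v ∈ T.W r ∧ ∀ x ∈ frontier Ω, v x = 0}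

end Triangulation

/-- `v` is the `L²(Ω)`-projection of `w` to the linear space `V`. -/
def IsL2Projection (Ω : Set (Space d)) (V : Set (Space d → ℝ)) (w v : Space d → ℝ) : Prop :=
  v ∈ V ∧ ∀ z ∈ V, ∫ x in Ω, v x * z x = ∫ x in Ω, w x * z x

/-! ### The semidiscrete problem -/

/-- `ρt = ρ - πφ`, a function of time with values in `W_h ∩ H₀¹(Ω)`, is a solution of
`(∂ₜρt, w) + (K(|∇ρ|) ∇ρ, ∇w) = (f, w)` for all `w ∈ W_h ∩ H₀¹(Ω)` and all `t > 0`, the initial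
value being the projection of `ρt0`. Gradients of piecewise polynomials are taken pointwise, which
makes sense in the interior of each element, hence almost everywhere. -/
structure IsSemidiscreteSolution (P : GenPoly) {Ω : Set (Space d)} (T : Triangulation Ω) (r : ℕ)
    (ρt0 : Space d → ℝ) (f φ ρ ρt : ℝ → Space d → ℝ) : Prop where
  mem : ∀ t, 0 ≤ t → ρt t ∈ T.W₀ r
  proj : ∀ t, 0 ≤ t → IsL2Projection Ω (T.W r) (φ t) (fun x => ρ t x - ρt t x)
  init : IsL2Projection Ω (T.W₀ r) ρt0 (ρt 0)
  cont_zero : ∀ x ∈ closure Ω, ContinuousWithinAt (fun s => ρt s x) (Ici 0) 0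
  diff : ∀ t, 0 < t → ∀ x ∈ closure Ω, DifferentiableAt ℝ (fun s => ρt s x) t
  eqn : ∀ t, 0 < t → ∀ w ∈ T.W₀ r,
    (∫ x in Ω, deriv (fun s => ρt s x) t * w x) +
      (∫ x in Ω, inner ℝ (P.K ‖gradient (ρ t) x‖ • gradient (ρ t) x) (gradient w x)) =
        ∫ x in Ω, f t x * w x

/-- `F` is a continuous, increasing envelope of `u` on `I`. -/
def IsEnvelope (I : Set ℝ) (u F : ℝ → ℝ) : Prop :=
  ContinuousOn F I ∧ MonotoneOn F I ∧ ∀ t ∈ I, u t ≤ F t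

/-- The function `g(t) = ‖f(t)‖^λ + ‖φ(t)‖₁²` of the data. -/
def dataSize (P : GenPoly) (Ω : Set (Space d)) (f φ : ℝ → Space d → ℝ) (t : ℝ) : ℝ :=
  l2Norm Ω (f t) ^ P.lam + h1Norm Ω (φ t) ^ 2

/-- The upper limit as `t → ∞`, with values in `[0, ∞]`, of a nonnegative real function. -/
def limsupTop (u : ℝ → ℝ) : ENNReal := limsup (fun t => ENNReal.ofReal (u t)) atTop

end Forchheimer

end

open Forchheimer

noncomputable section
namespace Forchheimer

/-! ### The nonlinearity -/

namespace GenPoly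

variable (P : GenPoly)

/-! The proof is an energy argument. Let `y = ‖ρ̃_h‖²`, `F = ‖f̃‖`, `Φ = ‖φ‖₁`. Testing the equation
with `ρ̃_h` itself gives `y'/2 + (K(|∇ρ_h|)∇ρ_h, ∇ρ̃_h) = (f̃, ρ̃_h)`, and everything rests on a
lower bound for the flux term. Pointwise, with `A = ∇ρ̃_h` and `B = ∇πφ`, it is at least `c δ^a
|A|^β - C δ² - C |B|²` for every `δ ∈ (0, 1]` (`GenPoly.exists_flux_bound`), because `K(ξ)` decays
no faster than `(1 + ξ)^(-a)`. Two facts about finite elements, uniform in the mesh, turn this into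
a scalar inequality. The Sobolev inequality bounds `‖v‖^β` by a multiple of `∫ |∇v|^β` on `W_h^0`
(`Triangulation.exists_l2Norm_rpow_le`); this is where the degree condition enters. Stability of `π`
in `H¹` bounds `‖∇πφ‖` by a multiple of `‖φ‖₁` (`Triangulation.exists_projection_stable`); this is
where quasi-uniformity enters. The result is `EnergyInequality`: `y' ≤ -c δ^a y^(β/2) + C δ² + C Φ²
+ 2 F √y`.

Young's inequality with exponents `β` and `λ` absorbs `F √y` into the dissipation at the price of
`F^λ`. With `δ = 1`, `y` decreases at a definite rate whenever it exceeds a multiple of `(1 +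
g)^(2/β)`, which yields the first two conclusions by comparison. With `δ` small and vanishing data,
the threshold is a multiple of `δ²`, since `a + β = 2`; hence `y → 0`. The free `δ` exists only for
this last conclusion (`EnergyInequality.bounds`).

Stability of `π` compares `πu` with a quasi-interpolant whose nodal values are means of `u` over
balls in `Ω`. By a uniform cone property (`exists_seesBall`) a cell and such a ball lie in a convex
open subset of `Ω` of comparable size, on which the Poincaré inequality (`poincare_convex`) holds
with an explicit constant. Best approximation gives `‖u - πu‖ ≤ C h ‖∇u‖`, and the inverse
inequality converts this into a gradient bound.

The Sobolev inequality for `C¹` functions passes to `W_h^0` by mollification: extended by zero, an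
element of `W_h^0` is Lipschitz and strictly differentiable almost everywhere
(`exists_sobolev_lipschitz`). Finally, `W_h^0` is determined by finitely many point values
(`Triangulation.exists_nodes`), so `y` is a quadratic form in finitely many scalar functions of time
and can be differentiated (`energy_regularity`). -/

lemma deg_pos : 0 < P.deg := by
  have h : (0 : Fin (P.N + 1)) < Fin.last P.N := by
    have := P.one_le_N
    rw [Fin.lt_def]; simpa using Nat.pos_of_ne_zero (by omega)
  have := P.exponent_strictMono h
  rwa [P.exponent_zero] at this

lemma a_pos : 0 < P.a := div_pos P.deg_pos (by linarith [P.deg_pos])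

lemma a_lt_one : P.a < 1 := by
  unfold a; rw [div_lt_one (by linarith [P.deg_pos])]; linarith

lemma one_lt_β : 1 < P.β := by unfold β; linarith [P.a_lt_one]

lemma β_lt_two : P.β < 2 := by unfold β; linarith [P.a_pos]

lemma β_pos : 0 < P.β := one_pos.trans P.one_lt_β

lemma holderConjugate : P.β.HolderConjugate P.lam :=
  Real.HolderConjugate.conjExponent P.one_lt_β

lemma g_pos {s : ℝ} (hs : 0 ≤ s) : 0 < P.g s := P.coeff_zero_pos.trans_le (P.coeff_zero_le_g hs)

lemma g_mono {s t : ℝ} (hs : 0 ≤ s) (hst : s ≤ t) : P.g s ≤ P.g t :=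
  Finset.sum_le_sum fun i _ => mul_le_mul_of_nonneg_left
    (Real.rpow_le_rpow hs hst (P.exponent_nonneg i)) (P.coeff_nonneg i)

lemma K_nonneg {ξ : ℝ} (hξ : 0 ≤ ξ) : 0 ≤ P.K ξ :=
  div_nonneg zero_le_one (P.g_pos (P.root_spec hξ).1).le

lemma K_le {ξ : ℝ} (hξ : 0 ≤ ξ) : P.K ξ ≤ 1 / P.coeff 0 :=
  one_div_le_one_div_of_le P.coeff_zero_pos (P.coeff_zero_le_g (P.root_spec hξ).1)

lemma root_mono {ξ η : ℝ} (hξ : 0 ≤ ξ) (h : ξ ≤ η) : P.root ξ ≤ P.root η := by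
  have h1 := P.root_spec hξ
  have h2 := P.root_spec (hξ.trans h)
  by_contra! hlt
  have h3 : P.root η * P.g (P.root η) ≤ P.root η * P.g (P.root ξ) :=
    mul_le_mul_of_nonneg_left (P.g_mono h2.1 hlt.le) h2.1
  have h4 : P.root η * P.g (P.root ξ) < P.root ξ * P.g (P.root ξ) :=
    mul_lt_mul_of_pos_right hlt (P.g_pos h1.1)
  linarith [h1.2, h2.2]

lemma K_antitoneOn : AntitoneOn P.K (Ici 0) := fun _ hξ _ _ h =>
  one_div_le_one_div_of_le (P.g_pos (P.root_spec hξ).1)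
    (P.g_mono (P.root_spec hξ).1 (P.root_mono hξ h))

lemma measurable_K_norm {X F : Type*} [MeasurableSpace X] [NormedAddCommGroup F]
    [MeasurableSpace F] [OpensMeasurableSpace F] {u : X → F} (hu : Measurable u) :
    Measurable fun x => P.K ‖u x‖ := by
  have h : Antitone fun ξ => P.K (max 0 ξ) := fun ξ η h =>
    P.K_antitoneOn (mem_Ici.2 (le_max_left _ _)) (mem_Ici.2 (le_max_left _ _))
      (max_le_max le_rfl h)
  have h2 : (fun x => P.K ‖u x‖) = fun x => (fun ξ => P.K (max 0 ξ)) ‖u x‖ := by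
    funext x; simp
  rw [h2]
  exact h.measurable.comp hu.norm

/-- With `s = s(ξ)`, the top term of `s g(s) = ξ` forces `s^(α_N + 1)` to be at most a multiple of
`ξ`, while `g(s)` is at most a multiple of `(1 + s)^(α_N)`. The exponent `a = α_N / (α_N + 1)`
converts one power into the other. -/
lemma exists_g_root_le : ∃ C : ℝ, 0 < C ∧ ∀ ξ, 0 ≤ ξ → P.g (P.root ξ) ≤ C * (1 + ξ) ^ P.a := by
  set A : ℝ := ∑ i, P.coeff i with hA
  have hα := P.deg_pos
  have haN := P.coeff_last_pos
  have hApos : 0 < A := Finset.sum_pos' (fun i _ => P.coeff_nonneg i)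
    ⟨0, Finset.mem_univ _, P.coeff_zero_pos⟩
  set B : ℝ := 2 ^ (P.deg + 1) * (1 + 1 / P.coeff (Fin.last P.N)) with hB
  have hBpos : 0 < B := by positivity
  refine ⟨A * B ^ P.a, by positivity, fun ξ hξ => ?_⟩
  obtain ⟨hs, hsξ⟩ := P.root_spec hξ
  set s := P.root ξ
  have h1 : P.g s ≤ A * (1 + s) ^ P.deg := by
    rw [hA, Finset.sum_mul]
    refine Finset.sum_le_sum fun i _ => mul_le_mul_of_nonneg_left ?_ (P.coeff_nonneg i)
    calc s ^ P.exponent i ≤ (1 + s) ^ P.exponent i :=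
          Real.rpow_le_rpow hs (by linarith) (P.exponent_nonneg i)
      _ ≤ (1 + s) ^ P.deg := Real.rpow_le_rpow_of_exponent_le (by linarith)
          (P.exponent_strictMono.monotone (Fin.le_last i))
  have h2 : P.coeff (Fin.last P.N) * s ^ (P.deg + 1) ≤ ξ := by
    have h3 : P.coeff (Fin.last P.N) * s ^ P.deg ≤ P.g s :=
      Finset.single_le_sum (f := fun i => P.coeff i * s ^ P.exponent i)
        (fun i _ => mul_nonneg (P.coeff_nonneg i) (Real.rpow_nonneg hs _)) (Finset.mem_univ _)
    rw [Real.rpow_add_one' hs (by positivity), ← hsξ]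
    nlinarith
  have h3 : (1 + s) ^ (P.deg + 1) ≤ B * (1 + ξ) := by
    have h4 : (1 + s) ^ (P.deg + 1) ≤ 2 ^ (P.deg + 1) * (1 + s ^ (P.deg + 1)) := by
      rcases le_total s 1 with h | h
      · calc (1 + s) ^ (P.deg + 1) ≤ 2 ^ (P.deg + 1) :=
              Real.rpow_le_rpow (by linarith) (by linarith) (by linarith)
          _ ≤ _ := le_mul_of_one_le_right (by positivity)
              (by linarith [Real.rpow_nonneg hs (P.deg + 1)])
      · calc (1 + s) ^ (P.deg + 1) ≤ (2 * s) ^ (P.deg + 1) :=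
              Real.rpow_le_rpow (by linarith) (by linarith) (by linarith)
          _ = 2 ^ (P.deg + 1) * s ^ (P.deg + 1) := Real.mul_rpow (by norm_num) hs
          _ ≤ _ := mul_le_mul_of_nonneg_left (by linarith) (by positivity)
    refine h4.trans ?_
    rw [hB, mul_assoc]
    refine mul_le_mul_of_nonneg_left ?_ (by positivity)
    have h5 : s ^ (P.deg + 1) ≤ ξ / P.coeff (Fin.last P.N) := by
      rw [le_div_iff₀ haN]; linarith
    have h6 : (1 + 1 / P.coeff (Fin.last P.N)) * (1 + ξ) =
      1 + ξ / P.coeff (Fin.last P.N) + (ξ + 1 / P.coeff (Fin.last P.N)) := by ring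
    have : 0 < 1 / P.coeff (Fin.last P.N) := by positivity
    linarith
  calc P.g s ≤ A * (1 + s) ^ P.deg := h1
    _ = A * ((1 + s) ^ (P.deg + 1)) ^ P.a := by
        rw [← Real.rpow_mul (by linarith)]
        congr 2; unfold a; field_simp
    _ ≤ A * (B * (1 + ξ)) ^ P.a := by
        gcongr
        exact P.a_pos.le
    _ = A * B ^ P.a * (1 + ξ) ^ P.a := by
        rw [Real.mul_rpow hBpos.le (by linarith)]; ring

/-- Coercivity of the flux, with a free threshold `δ`. -/
lemma exists_rpow_le_K : ∃ C : ℝ, 0 < C ∧ ∀ δ, 0 < δ → δ ≤ 1 → ∀ ξ, 0 ≤ ξ →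
    ξ ^ P.β ≤ δ ^ P.β + C * δ ^ (-P.a) * (P.K ξ * ξ ^ 2) := by
  obtain ⟨C, hC, hg⟩ := P.exists_g_root_le
  refine ⟨C * 2 ^ P.a, by positivity, fun δ hδ hδ1 ξ hξ => ?_⟩
  have hK := P.K_nonneg hξ
  rcases le_total ξ δ with h | h
  · have := Real.rpow_le_rpow hξ h P.β_pos.le
    have : 0 ≤ C * 2 ^ P.a * δ ^ (-P.a) * (P.K ξ * ξ ^ 2) := by positivity
    linarith
  · have hξ0 : 0 < ξ := hδ.trans_le h
    -- Both `δ ≤ ξ` and `δ ≤ 1` are used. This trades `1 + ξ` for a pure power of `ξ`, at the cost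
    -- of the factor `δ^(-a)`.
    have h1 : 1 + ξ ≤ 2 * ξ / δ := by
      rw [le_div_iff₀ hδ]; nlinarith
    have h2 : P.g (P.root ξ) ≤ C * (2 ^ P.a * ξ ^ P.a * δ ^ (-P.a)) := by
      refine (hg ξ hξ).trans (mul_le_mul_of_nonneg_left ?_ hC.le)
      calc (1 + ξ) ^ P.a ≤ (2 * ξ / δ) ^ P.a :=
            Real.rpow_le_rpow (by linarith) h1 P.a_pos.le
        _ = _ := by
            rw [Real.div_rpow (by positivity) hδ.le, Real.mul_rpow (by norm_num) hξ,
              Real.rpow_neg hδ.le]; rfl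
    have hgp := P.g_pos (P.root_spec hξ).1
    have h3 : 1 ≤ C * (2 ^ P.a * ξ ^ P.a * δ ^ (-P.a)) * P.K ξ := by
      unfold K; rw [mul_one_div, le_div_iff₀ hgp]; linarith
    have h4 : ξ ^ P.β * ξ ^ P.a = ξ ^ 2 := by
      rw [← Real.rpow_add hξ0]; unfold β; norm_num
    have h5 : ξ ^ P.β ≤ C * 2 ^ P.a * δ ^ (-P.a) * (P.K ξ * ξ ^ 2) := by
      calc ξ ^ P.β ≤ ξ ^ P.β * (C * (2 ^ P.a * ξ ^ P.a * δ ^ (-P.a)) * P.K ξ) :=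
            le_mul_of_one_le_right (by positivity) h3
        _ = C * 2 ^ P.a * δ ^ (-P.a) * (P.K ξ * (ξ ^ P.β * ξ ^ P.a)) := by ring
        _ = _ := by rw [h4]
    have : 0 < δ ^ P.β := by positivity
    linarith

/-- Since `β = 2 - a < 2`, the power `ξ^β` is dominated by `ξ²` beyond the threshold `δ`, with the
same loss `δ^(-a)` as in the coercivity of the flux. -/
lemma rpow_β_le {δ : ℝ} (hδ : 0 < δ) {ξ : ℝ} (hξ : 0 ≤ ξ) :
    ξ ^ P.β ≤ δ ^ P.β + δ ^ (-P.a) * ξ ^ 2 := by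
  rcases le_total ξ δ with h | h
  · have := Real.rpow_le_rpow hξ h P.β_pos.le
    have : 0 ≤ δ ^ (-P.a) * ξ ^ 2 := by positivity
    linarith
  · have hξ0 : 0 < ξ := hδ.trans_le h
    have h1 : ξ ^ P.β = ξ ^ (-P.a) * ξ ^ 2 := by
      rw [← Real.rpow_two, ← Real.rpow_add hξ0]; congr 1; unfold β; ring
    have h2 : ξ ^ (-P.a) ≤ δ ^ (-P.a) :=
      Real.rpow_le_rpow_of_nonpos hδ h (by linarith [P.a_pos])
    have : 0 < δ ^ P.β := by positivity
    nlinarith [sq_nonneg ξ]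

lemma exists_young {k : ℝ} (hk : 0 < k) : ∃ D : ℝ, 0 < D ∧ ∀ F z : ℝ, 0 ≤ F → 0 ≤ z →
    2 * F * z ≤ k * z ^ P.β + D * F ^ P.lam := by
  have hβ := P.β_pos
  have hl : 1 < P.lam := P.holderConjugate.symm.lt
  set e : ℝ := k ^ (1 / P.β) with he
  have hep : 0 < e := by positivity
  refine ⟨(2 / e) ^ P.lam, by positivity, fun F z hF hz => ?_⟩
  have h := Real.young_inequality_of_nonneg (a := e * z) (b := 2 / e * F) (by positivity)
    (by positivity) P.holderConjugate
  have h1 : e * z * (2 / e * F) = 2 * F * z := by field_simp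
  have h2 : (e * z) ^ P.β = k * z ^ P.β := by
    rw [Real.mul_rpow hep.le hz, he, ← Real.rpow_mul hk.le]
    simp [hβ.ne']
  rw [h1, h2, Real.mul_rpow (by positivity) hF] at h
  refine h.trans (add_le_add (div_le_self (by positivity) P.one_lt_β.le)
    (div_le_self (by positivity) hl.le))

end GenPoly

/-! ### Differential inequalities -/

/-- At the last time `t` with `y t ≤ m`, everything afterwards lies above `m`, so `y` is
nonincreasing on `[t, b]` and cannot end above `m`. -/
lemma le_of_deriv_nonpos_above {y : ℝ → ℝ} {a b m : ℝ} (hab : a ≤ b)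
    (hc : ContinuousOn y (Icc a b)) (hd : ∀ t ∈ Ioo a b, DifferentiableAt ℝ y t)
    (ha : y a ≤ m) (h : ∀ t ∈ Ioo a b, m < y t → deriv y t ≤ 0) : y b ≤ m := by
  by_contra! hb
  have hcl : IsClosed (Icc a b ∩ y ⁻¹' Iic m) :=
    hc.preimage_isClosed_of_isClosed isClosed_Icc isClosed_Iic
  have hcpt : IsCompact (Icc a b ∩ y ⁻¹' Iic m) :=
    isCompact_Icc.of_isClosed_subset hcl inter_subset_left
  obtain ⟨t, ⟨ht, hyt⟩, hmax⟩ := hcpt.exists_isGreatest ⟨a, ⟨le_rfl, hab⟩, ha⟩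
  have hsub : Icc t b ⊆ Icc a b := Icc_subset_Icc_left ht.1
  have hsub' : Ioo t b ⊆ Ioo a b := Ioo_subset_Ioo_left ht.1
  have hanti : AntitoneOn y (Icc t b) := by
    refine antitoneOn_of_deriv_nonpos (convex_Icc t b) (hc.mono hsub) ?_ ?_
    · rw [interior_Icc]
      exact fun s hs => (hd s (hsub' hs)).differentiableWithinAt
    · rw [interior_Icc]
      intro s hs
      refine h s (hsub' hs) ?_
      by_contra! hle
      exact absurd (hmax ⟨hsub ⟨hs.1.le, hs.2.le⟩, hle⟩) (not_le.2 hs.1)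
  have := hanti ⟨le_rfl, ht.2⟩ ⟨ht.2, le_rfl⟩ ht.2
  exact absurd (this.trans hyt) (not_le.2 hb)

/-- Once `y` is at most `m` it stays there. If it never got there, it would decrease at rate `k`
forever and become negative by time `T + (y T + 1) / k`. -/
lemma eventually_le_of_deriv_le {y : ℝ → ℝ} {T m k : ℝ} (hk : 0 < k)
    (hd : ∀ t, T ≤ t → DifferentiableAt ℝ y t) (h0 : ∀ t, T ≤ t → 0 ≤ y t)
    (h : ∀ t, T ≤ t → m < y t → deriv y t ≤ -k) : ∀ᶠ t in atTop, y t ≤ m := by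
  have hcont : ∀ a b, T ≤ a → ContinuousOn y (Icc a b) := fun a b ha s hs =>
    (hd s (ha.trans hs.1)).continuousAt.continuousWithinAt
  by_cases hex : ∃ t, T ≤ t ∧ y t ≤ m
  · obtain ⟨t, ht, hyt⟩ := hex
    filter_upwards [eventually_ge_atTop t] with s hs
    refine le_of_deriv_nonpos_above hs (hcont t s ht) (fun x hx => hd x (ht.trans hx.1.le)) hyt
      fun x hx hmx => ?_
    linarith [h x (ht.trans hx.1.le) hmx]
  · push Not at hex
    exfalso
    set b := T + (y T + 1) / k with hb
    have hTb : T ≤ b := by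
      have := h0 T le_rfl
      have : 0 ≤ (y T + 1) / k := by positivity
      linarith
    have := (convex_Icc T b).image_sub_le_mul_sub_of_deriv_le (C := -k) (hcont T b le_rfl)
      (by rw [interior_Icc]; exact fun s hs => (hd s hs.1.le).differentiableWithinAt)
      (by rw [interior_Icc]; exact fun s hs => h s hs.1.le (hex s hs.1.le))
      T ⟨le_rfl, hTb⟩ b ⟨hTb, le_rfl⟩ hTb
    have h1 : -k * (b - T) = -(y T + 1) := by rw [hb]; field_simp; ring
    have := h0 b hTb
    linarith

/-- The energy inequality satisfied by `y = ‖u‖²`, with `F = ‖f‖` and `Φ = ‖φ‖₁`. -/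
def EnergyInequality (P : GenPoly) (c C : ℝ) (y F Φ : ℝ → ℝ) : Prop :=
  ∀ t, 0 < t → ∀ δ, 0 < δ → δ ≤ 1 → deriv y t ≤
    -(c * δ ^ P.a * y t ^ (P.β / 2)) + C * δ ^ 2 + C * Φ t ^ 2 + 2 * F t * √(y t)

/-- Half of the dissipation pays for `2 F √y` through Young's inequality, using `(√y)^β = y^(β/2)`.
The constant `D` depends on `δ`. This is harmless: `δ` is either `1` or fixed before the limit in
which `F` tends to zero. -/
lemma EnergyInequality.absorb {P : GenPoly} {c C : ℝ} (hc : 0 < c) {δ : ℝ} (hδ : 0 < δ)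
    (hδ1 : δ ≤ 1) : ∃ D : ℝ, 0 < D ∧ ∀ y F Φ : ℝ → ℝ, (∀ t, 0 ≤ t → 0 ≤ y t) → (∀ t, 0 ≤ F t) →
      EnergyInequality P c C y F Φ → ∀ t, 0 < t → deriv y t ≤
        -(c / 2 * δ ^ P.a * y t ^ (P.β / 2)) + C * δ ^ 2 + C * Φ t ^ 2 + D * F t ^ P.lam := by
  obtain ⟨D, hD, h⟩ := P.exists_young (k := c / 2 * δ ^ P.a) (by positivity)
  refine ⟨D, hD, fun y F Φ hy hF hE t ht => ?_⟩
  have h1 := hE t ht δ hδ hδ1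
  have h2 := h (F t) (√(y t)) (hF t) (Real.sqrt_nonneg _)
  have h3 : √(y t) ^ P.β = y t ^ (P.β / 2) := by
    rw [Real.sqrt_eq_rpow, ← Real.rpow_mul (hy t ht.le)]; congr 1; ring
  rw [h3] at h2
  linarith

lemma lt_rpow_of_rpow_inv_lt {x y p : ℝ} (hx : 0 ≤ x) (hp : 0 < p) (h : x ^ (1 / p) < y) :
    x < y ^ p := by
  have := Real.rpow_lt_rpow (Real.rpow_nonneg hx _) h hp
  rwa [← Real.rpow_mul hx, one_div_mul_cancel hp.ne', Real.rpow_one] at this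

theorem EnergyInequality.bounds (P : GenPoly) {c C : ℝ} (hc : 0 < c) (hC : 0 < C) :
    ∃ C' : ℝ, 0 < C' ∧ ∀ y F Φ : ℝ → ℝ, (∀ t, 0 ≤ t → 0 ≤ y t) → (∀ t, 0 ≤ F t) →
      ContinuousWithinAt y (Ici 0) 0 → (∀ t, 0 < t → DifferentiableAt ℝ y t) →
      EnergyInequality P c C y F Φ →
      (∀ t, 0 < t → ∀ E, (∀ s ∈ Icc 0 t, F s ^ P.lam + Φ s ^ 2 ≤ E) →
        √(y t) ≤ √(y 0) + C' * (1 + E ^ (1 / P.β))) ∧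
      (∀ G, 0 ≤ G → (∀ᶠ t in atTop, F t ^ P.lam + Φ t ^ 2 ≤ G) →
        ∀ᶠ t in atTop, y t ≤ C' * (1 + G) ^ (2 / P.β)) ∧
      (Tendsto F atTop (𝓝 0) → Tendsto Φ atTop (𝓝 0) → ∀ ε, 0 < ε → ∀ᶠ t in atTop, y t ≤ ε) := by
  obtain ⟨D, hD, habs⟩ := EnergyInequality.absorb (P := P) (C := C) hc one_pos le_rfl
  have hβ := P.β_pos
  set B := C + D with hB
  have hBp : 0 < B := by positivity
  -- Above the level where `y^(β/2) = A (1 + G)`, the dissipation exceeds `2 B (1 + G)`, while the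
  -- remaining terms add up to at most `B (1 + G)`. So `y' ≤ -B` there.
  set A := 4 * B / c with hA
  have hAp : 0 < A := by positivity
  have hβ2 : 1 / (P.β / 2) = 2 / P.β := by field_simp
  -- The first entry serves the bound on `√y`, the second the bound on `y`.
  refine ⟨max (A ^ (1 / P.β)) (A ^ (2 / P.β)), lt_max_of_lt_left (by positivity), ?_⟩
  intro y F Φ hy hF hc0 hd hE
  have key : ∀ t, 0 < t → ∀ G, 0 ≤ G → F t ^ P.lam + Φ t ^ 2 ≤ G →
      (A * (1 + G)) ^ (2 / P.β) < y t → deriv y t ≤ -B := by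
    intro t ht G hG hg hlt
    have h1 := habs y F Φ hy hF hE t ht
    rw [← hβ2] at hlt
    have h2 := lt_rpow_of_rpow_inv_lt (by positivity) (by positivity) hlt
    have h3 : c / 2 * (A * (1 + G)) = 2 * B * (1 + G) := by rw [hA]; field_simp; ring
    have hF' : 0 ≤ F t ^ P.lam := Real.rpow_nonneg (hF t) _
    simp only [Real.one_rpow, one_pow, mul_one] at h1
    nlinarith [sq_nonneg (Φ t)]
  refine ⟨?_, ?_, ?_⟩
  · intro t ht E hEn
    have hE0 : 0 ≤ E := le_trans (add_nonneg (Real.rpow_nonneg (hF 0) _) (sq_nonneg _))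
      (hEn 0 ⟨le_rfl, ht.le⟩)
    have hcont : ContinuousOn y (Icc 0 t) := by
      intro s hs
      rcases hs.1.eq_or_lt with rfl | h
      · exact hc0.mono Icc_subset_Ici_self
      · exact (hd s h).continuousAt.continuousWithinAt
    have h1 : y t ≤ max (y 0) ((A * (1 + E)) ^ (2 / P.β)) := by
      refine le_of_deriv_nonpos_above ht.le hcont (fun s hs => hd s hs.1) (le_max_left _ _) ?_
      intro s hs hlt
      have := key s hs.1 E hE0 (hEn s ⟨hs.1.le, hs.2.le⟩) ((le_max_right _ _).trans_lt hlt)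
      linarith
    have h2 : √((A * (1 + E)) ^ (2 / P.β)) ≤ A ^ (1 / P.β) * (1 + E ^ (1 / P.β)) := by
      rw [Real.sqrt_eq_rpow, ← Real.rpow_mul (by positivity),
        show 2 / P.β * (1 / 2) = 1 / P.β by ring, Real.mul_rpow hAp.le (by positivity)]
      refine mul_le_mul_of_nonneg_left ?_ (by positivity)
      have := Real.rpow_add_le_add_rpow (p := 1 / P.β) zero_le_one hE0 (by positivity)
        ((div_le_one hβ).2 P.one_lt_β.le)
      simpa using this
    have h3 : A ^ (1 / P.β) * (1 + E ^ (1 / P.β)) ≤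
        max (A ^ (1 / P.β)) (A ^ (2 / P.β)) * (1 + E ^ (1 / P.β)) :=
      mul_le_mul_of_nonneg_right (le_max_left _ _) (by positivity)
    have h4 := Real.sqrt_le_sqrt h1
    rcases max_cases (y 0) ((A * (1 + E)) ^ (2 / P.β)) with ⟨h, -⟩ | ⟨h, -⟩ <;> rw [h] at h4
    · have : 0 ≤ A ^ (1 / P.β) * (1 + E ^ (1 / P.β)) := by positivity
      linarith
    · linarith [Real.sqrt_nonneg (y 0)]
  · intro G hG hev
    obtain ⟨T, hT⟩ := eventually_atTop.1 (hev.and (eventually_gt_atTop 0))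
    have := eventually_le_of_deriv_le (T := T) (m := (A * (1 + G)) ^ (2 / P.β)) hBp
      (fun t ht => hd t (hT t ht).2) (fun t ht => hy t (hT t ht).2.le)
      (fun t ht => key t (hT t ht).2 G hG (hT t ht).1)
    filter_upwards [this] with t ht
    refine ht.trans ?_
    rw [Real.mul_rpow hAp.le (by positivity)]
    exact mul_le_mul_of_nonneg_right (le_max_right _ _) (by positivity)
  · intro hF0 hΦ0 ε hε
    -- At `y = M δ²` the dissipation `(c/2) δ^a y^(β/2)` equals `4 C δ²`. The constant term costs `C
    -- δ²` and the data eventually at most another `C δ²`, which leaves a decay rate of `2 C δ²`.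
    set M : ℝ := (8 * C / c) ^ (2 / P.β) with hM
    have hMp : 0 < M := by positivity
    obtain ⟨δ, hδ, hδ1, hδε⟩ : ∃ δ : ℝ, 0 < δ ∧ δ ≤ 1 ∧ M * δ ^ 2 ≤ ε := by
      refine ⟨min 1 √(ε / M), by positivity, min_le_left _ _, ?_⟩
      have : min 1 √(ε / M) ^ 2 ≤ √(ε / M) ^ 2 := by gcongr; exact min_le_right _ _
      rw [Real.sq_sqrt (by positivity)] at this
      calc M * _ ≤ M * (ε / M) := by gcongr
        _ = ε := by field_simp
    obtain ⟨D', hD', habs'⟩ := EnergyInequality.absorb (P := P) (C := C) hc hδ hδ1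
    have hlam : 0 < P.lam := by linarith [P.holderConjugate.symm.lt]
    have hlim : Tendsto (fun t => C * Φ t ^ 2 + D' * F t ^ P.lam) atTop (𝓝 0) := by
      have h1 := (hF0.rpow_const (p := P.lam) (Or.inr hlam.le)).const_mul D'
      have h2 := (hΦ0.pow 2).const_mul C
      simpa [Real.zero_rpow hlam.ne'] using h2.add h1
    have hev := hlim.eventually_le_const (show (0 : ℝ) < C * δ ^ 2 by positivity)
    obtain ⟨T, hT⟩ := eventually_atTop.1 (hev.and (eventually_gt_atTop 0))
    have := eventually_le_of_deriv_le (T := T) (m := M * δ ^ 2) (k := 2 * C * δ ^ 2) (y := y)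
      (by positivity) (fun t ht => hd t (hT t ht).2) (fun t ht => hy t (hT t ht).2.le) ?_
    · filter_upwards [this] with t ht using ht.trans hδε
    · intro t ht hlt
      have h1 := habs' y F Φ hy hF hE t (hT t ht).2
      have h2 : M * δ ^ 2 = (8 * C / c * δ ^ P.β) ^ (1 / (P.β / 2)) := by
        rw [hβ2, Real.mul_rpow (by positivity) (by positivity), ← Real.rpow_mul hδ.le,
          mul_div_cancel₀ _ hβ.ne', Real.rpow_two]
      rw [h2] at hlt
      have h3 := lt_rpow_of_rpow_inv_lt (by positivity) (by positivity) hlt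
      have h4 : c / 2 * δ ^ P.a * (8 * C / c * δ ^ P.β) = 4 * C * δ ^ 2 := by
        have : δ ^ P.a * δ ^ P.β = δ ^ 2 := by
          rw [← Real.rpow_add hδ, ← Real.rpow_two]; congr 1; unfold GenPoly.β; ring
        calc _ = 4 * C * (δ ^ P.a * δ ^ P.β) := by field_simp; ring
          _ = _ := by rw [this]
      have h5 : c / 2 * δ ^ P.a * (8 * C / c * δ ^ P.β) <
          c / 2 * δ ^ P.a * y t ^ (P.β / 2) := mul_lt_mul_of_pos_left h3 (by positivity)
      linarith [(hT t ht).1]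

variable {d : ℕ}

/-! ### The Poincaré inequality on convex sets -/

/-- Cauchy–Schwarz after splitting `w f = w^(1/2) · w^(1/2) f`. For a weight of mass one it is
Jensen's inequality for the square. -/
lemma sq_lintegral_mul_le {X : Type*} [MeasurableSpace X] {μ : Measure X} {w f : X → ENNReal}
    (hw : AEMeasurable w μ) (hf : AEMeasurable f μ) :
    (∫⁻ x, w x * f x ∂μ) ^ 2 ≤ (∫⁻ x, w x ∂μ) * ∫⁻ x, w x * f x ^ 2 ∂μ := by
  have h := ENNReal.lintegral_mul_le_Lp_mul_Lq μ Real.HolderConjugate.two_two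
    (f := fun x => w x ^ (1 / 2 : ℝ)) (g := fun x => w x ^ (1 / 2 : ℝ) * f x)
    (hw.pow_const _) ((hw.pow_const _).mul hf)
  have e1 : ∀ a : ENNReal, (a ^ (1 / 2 : ℝ)) ^ (2 : ℝ) = a := fun a => by
    rw [← ENNReal.rpow_mul]; norm_num
  have e2 : ∀ a : ENNReal, a ^ (1 / 2 : ℝ) * a ^ (1 / 2 : ℝ) = a := fun a => by
    rw [← ENNReal.rpow_add_of_nonneg _ _ (by norm_num) (by norm_num)]; norm_num
  simp only [Pi.mul_apply, ← mul_assoc, e1, e2,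
    ENNReal.mul_rpow_of_nonneg _ _ (show (0 : ℝ) ≤ 2 by norm_num)] at h
  calc _ ≤ ((∫⁻ x, w x ∂μ) ^ (1 / 2 : ℝ) * (∫⁻ x, w x * f x ^ (2 : ℝ) ∂μ) ^ (1 / 2 : ℝ)) ^ 2 := by
        gcongr
    _ = _ := by
        rw [mul_pow, ← ENNReal.rpow_two, ← ENNReal.rpow_two, e1, e1]
        simp

lemma sq_lintegral_le {X : Type*} [MeasurableSpace X] {μ : Measure X} {f : X → ENNReal}
    (hf : AEMeasurable f μ) : (∫⁻ x, f x ∂μ) ^ 2 ≤ μ univ * ∫⁻ x, f x ^ 2 ∂μ := by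
  simpa using sq_lintegral_mul_le (w := fun _ => 1) aemeasurable_const hf

lemma lintegral_comp_add_smul (H : Space d → ENNReal) (hH : Measurable H) {t : ℝ} (ht : 0 < t)
    (v : Space d) : ∫⁻ y, H (v + t • y) = ENNReal.ofReal ((t ^ d)⁻¹) * ∫⁻ y, H y := by
  have h1 : ∫⁻ y, H (v + t • y) = ∫⁻ z, H (v + z) ∂(Measure.map (fun y : Space d => t • y) volume) :=
    (lintegral_map (f := fun z => H (v + z)) (hH.comp (measurable_const_add v))
      (measurable_const_smul t)).symm
  rw [h1, Measure.map_addHaar_smul _ ht.ne', lintegral_smul_measure, finrank_euclideanSpace,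
    Fintype.card_fin, abs_of_pos (by positivity), smul_eq_mul, lintegral_add_left_eq_self]

/-- For fixed `x`, the map `y ↦ (1 - t) x + t y` sends `D` into itself by convexity and has Jacobian
`t^d ≥ 2^(-d)`. -/
lemma lintegral_segment_le {D : Set (Space d)} (hD : MeasurableSet D) (hconv : Convex ℝ D)
    {H : Space d → ENNReal} (hH : Measurable H) {t : ℝ} (ht : 1 / 2 ≤ t) (ht1 : t ≤ 1)
    {x : Space d} (hx : x ∈ D) :
    ∫⁻ y in D, H (x + t • (y - x)) ≤ 2 ^ d * ∫⁻ y in D, H y := by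
  have ht0 : 0 < t := by linarith
  calc ∫⁻ y in D, H (x + t • (y - x))
      = ∫⁻ y, D.indicator (fun y => H (x + t • (y - x))) y := (lintegral_indicator hD _).symm
    _ ≤ ∫⁻ y, D.indicator H ((1 - t) • x + t • y) := by
        refine lintegral_mono fun y => ?_
        by_cases hy : y ∈ D
        · have e : x + t • (y - x) = (1 - t) • x + t • y := by module
          rw [indicator_of_mem hy, e, indicator_of_mem (hconv hx hy (by linarith) ht0.le (by ring))]
        · rw [indicator_of_notMem hy]; exact zero_le
    _ = ENNReal.ofReal ((t ^ d)⁻¹) * ∫⁻ y in D, H y := by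
        rw [lintegral_comp_add_smul _ (hH.indicator hD) ht0, lintegral_indicator hD]
    _ ≤ _ := by
        gcongr
        rw [← inv_pow]
        have : t⁻¹ ≤ 2 := by rw [inv_le_comm₀ ht0 two_pos]; linarith
        calc ENNReal.ofReal (t⁻¹ ^ d) ≤ ENNReal.ofReal (2 ^ d) := by gcongr
          _ = 2 ^ d := by rw [ENNReal.ofReal_pow (by norm_num)]; simp

/-- The fundamental theorem of calculus along the segment, then Cauchy–Schwarz on `[0, 1]`. The
measurable majorant `H` replaces the squared derivative because, for mollified functions, what is
available is an average of `|G|²`. -/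
lemma enorm_sub_sq_le_of_segment {D : Set (Space d)} (hconv : Convex ℝ D) {u : Space d → ℝ}
    (hu : ContDiff ℝ 1 u) {H : Space d → ENNReal} (hH : Measurable H)
    (hle : ∀ z ∈ D, ‖fderiv ℝ u z‖ₑ ^ 2 ≤ H z) {R : ℝ} (hR : ∀ x ∈ D, ∀ y ∈ D, ‖y - x‖ ≤ R)
    {x y : Space d} (hx : x ∈ D) (hy : y ∈ D) :
    ‖u x - u y‖ₑ ^ 2 ≤ ENNReal.ofReal (R ^ 2) * ∫⁻ t in Icc (0 : ℝ) 1, H (x + t • (y - x)) := by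
  have hR0 : 0 ≤ R := (norm_nonneg _).trans (hR x hx y hy)
  have hder : ∀ t : ℝ, HasDerivAt (fun t : ℝ => u (x + t • (y - x)))
      (fderiv ℝ u (x + t • (y - x)) (y - x)) t := by
    intro t
    have h1 : HasDerivAt (fun t : ℝ => x + t • (y - x)) (y - x) t := by
      simpa using ((hasDerivAt_id t).smul_const (y - x)).const_add x
    exact ((hu.differentiable one_ne_zero _).hasFDerivAt.comp_hasDerivAt t h1)
  have hcont : Continuous fun t : ℝ => fderiv ℝ u (x + t • (y - x)) (y - x) :=
    ((hu.continuous_fderiv one_ne_zero).comp (by fun_prop)).clm_apply continuous_const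
  have hftc := intervalIntegral.integral_eq_sub_of_hasDerivAt (a := 0) (b := 1)
    (fun t _ => hder t) (hcont.intervalIntegrable _ _)
  rw [intervalIntegral.integral_of_le zero_le_one, ← integral_Icc_eq_integral_Ioc] at hftc
  simp only [one_smul, add_sub_cancel, zero_smul, add_zero] at hftc
  have h1 : ‖u x - u y‖ₑ ≤ ∫⁻ t in Icc (0 : ℝ) 1, ‖fderiv ℝ u (x + t • (y - x)) (y - x)‖ₑ := by
    rw [← enorm_neg, neg_sub, ← hftc]
    exact enorm_integral_le_lintegral_enorm _
  calc ‖u x - u y‖ₑ ^ 2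
      ≤ (∫⁻ t in Icc (0 : ℝ) 1, ‖fderiv ℝ u (x + t • (y - x)) (y - x)‖ₑ) ^ 2 := by gcongr
    _ ≤ ∫⁻ t in Icc (0 : ℝ) 1, ‖fderiv ℝ u (x + t • (y - x)) (y - x)‖ₑ ^ 2 := by
        refine (sq_lintegral_le hcont.enorm.aemeasurable).trans ?_
        simp
    _ ≤ ∫⁻ t in Icc (0 : ℝ) 1, ENNReal.ofReal (R ^ 2) * H (x + t • (y - x)) := by
        refine setLIntegral_mono' measurableSet_Icc fun t ht => ?_
        have hz : x + t • (y - x) ∈ D := by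
          have e : x + t • (y - x) = (1 - t) • x + t • y := by module
          rw [e]; exact hconv hx hy (by linarith [ht.2]) ht.1 (by ring)
        calc ‖fderiv ℝ u (x + t • (y - x)) (y - x)‖ₑ ^ 2
            ≤ (‖fderiv ℝ u (x + t • (y - x))‖ₑ * ‖y - x‖ₑ) ^ 2 := by
              gcongr; exact ContinuousLinearMap.le_opENorm _ _
          _ = ‖y - x‖ₑ ^ 2 * ‖fderiv ℝ u (x + t • (y - x))‖ₑ ^ 2 := by ring
          _ ≤ ENNReal.ofReal (R ^ 2) * H (x + t • (y - x)) := by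
              rw [ENNReal.ofReal_pow hR0]
              gcongr
              · rw [← ofReal_norm]
                exact ENNReal.ofReal_le_ofReal (hR x hx y hy)
              · exact hle _ hz
    _ = _ := lintegral_const_mul _ (hH.comp (by fun_prop))

/-- By Tonelli it suffices to bound the double integral of `H (x + t (y - x))` for each `t`. If `t ≥
1/2`, the integration in `y` does it with loss `2^d`; if `t ≤ 1/2`, the roles of `x` and `y` are
exchanged. -/
theorem poincare_convex_contDiff {D : Set (Space d)} (hD : MeasurableSet D) (hconv : Convex ℝ D)
    {u : Space d → ℝ} (hu : ContDiff ℝ 1 u) {H : Space d → ENNReal} (hH : Measurable H)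
    (hle : ∀ z ∈ D, ‖fderiv ℝ u z‖ₑ ^ 2 ≤ H z) {R : ℝ} (hR : ∀ x ∈ D, ∀ y ∈ D, ‖y - x‖ ≤ R) :
    ∫⁻ x in D, ∫⁻ y in D, ‖u x - u y‖ₑ ^ 2 ≤
      ENNReal.ofReal (R ^ 2) * (2 ^ d * volume D * ∫⁻ z in D, H z) := by
  have hseg : ∀ t ∈ Icc (0 : ℝ) 1, ∫⁻ x in D, ∫⁻ y in D, H (x + t • (y - x)) ≤
      2 ^ d * volume D * ∫⁻ z in D, H z := by
    have hone : ∀ t : ℝ, 1 / 2 ≤ t → t ≤ 1 → ∫⁻ x in D, ∫⁻ y in D, H (x + t • (y - x)) ≤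
        2 ^ d * volume D * ∫⁻ z in D, H z := by
      intro t h1 h2
      calc ∫⁻ x in D, ∫⁻ y in D, H (x + t • (y - x))
          ≤ ∫⁻ x in D, 2 ^ d * ∫⁻ y in D, H y :=
            setLIntegral_mono' hD fun x hx => lintegral_segment_le hD hconv hH h1 h2 hx
        _ = _ := by rw [setLIntegral_const]; ring
    intro t ht
    rcases le_total (1 / 2) t with h | h
    · exact hone t h ht.2
    · have e : ∀ x y : Space d, x + t • (y - x) = y + (1 - t) • (x - y) := fun x y => by module
      rw [lintegral_lintegral_swap]
      · simp only [e]
        exact hone (1 - t) (by linarith) (by linarith [ht.1])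
      · exact (hH.comp (by fun_prop : Measurable fun p : Space d × Space d =>
          p.1 + t • (p.2 - p.1))).aemeasurable
  have hm : Measurable fun p : (Space d × Space d) × ℝ => H (p.1.1 + p.2 • (p.1.2 - p.1.1)) :=
    hH.comp (by fun_prop)
  calc ∫⁻ x in D, ∫⁻ y in D, ‖u x - u y‖ₑ ^ 2
      ≤ ∫⁻ x in D, ∫⁻ y in D, ENNReal.ofReal (R ^ 2) *
          ∫⁻ t in Icc (0 : ℝ) 1, H (x + t • (y - x)) :=
        setLIntegral_mono' hD fun x hx => setLIntegral_mono' hD fun y hy =>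
          enorm_sub_sq_le_of_segment hconv hu hH hle hR hx hy
    _ = ENNReal.ofReal (R ^ 2) * ∫⁻ x in D, ∫⁻ y in D, ∫⁻ t in Icc (0 : ℝ) 1,
          H (x + t • (y - x)) := by
        rw [← lintegral_const_mul' _ _ ENNReal.ofReal_ne_top]
        congr 1; funext x
        rw [← lintegral_const_mul' _ _ ENNReal.ofReal_ne_top]
    _ = ENNReal.ofReal (R ^ 2) * ∫⁻ t in Icc (0 : ℝ) 1, ∫⁻ x in D, ∫⁻ y in D,
          H (x + t • (y - x)) := by
        have e : ∀ x, ∫⁻ y in D, ∫⁻ t in Icc (0 : ℝ) 1, H (x + t • (y - x)) =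
            ∫⁻ t in Icc (0 : ℝ) 1, ∫⁻ y in D, H (x + t • (y - x)) := fun x =>
          lintegral_lintegral_swap (hm.comp (by fun_prop : Measurable fun p : Space d × ℝ =>
            ((x, p.1), p.2))).aemeasurable
        simp_rw [e]
        rw [lintegral_lintegral_swap]
        exact (Measurable.lintegral_prod_right' (f := fun q : (Space d × ℝ) × Space d =>
            H (q.1.1 + q.1.2 • (q.2 - q.1.1))) (hH.comp (by fun_prop))).aemeasurable
    _ ≤ ENNReal.ofReal (R ^ 2) * ∫⁻ t in Icc (0 : ℝ) 1, 2 ^ d * volume D * ∫⁻ z in D, H z := by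
        gcongr ENNReal.ofReal (R ^ 2) * ?_
        exact setLIntegral_mono' measurableSet_Icc hseg
    _ = _ := by rw [setLIntegral_const]; simp

/-! ### Mollification and weak gradients -/

/-- A standard mollifier of radius `1 / (n + 1)`. -/
def mollifier (d n : ℕ) : ContDiffBump (0 : Space d) where
  rIn := 1 / (2 * ((n : ℝ) + 1))
  rOut := 1 / ((n : ℝ) + 1)
  rIn_pos := by positivity
  rIn_lt_rOut := by
    apply one_div_lt_one_div_of_lt <;> nlinarith [n.cast_nonneg (α := ℝ)]

lemma tendsto_mollifier_rOut : Tendsto (fun n => (mollifier d n).rOut) atTop (𝓝 0) :=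
  tendsto_one_div_add_atTop_nhds_zero_nat

lemma mollifier_rOut_le (n : ℕ) : (mollifier d n).rOut ≤ 2 * (mollifier d n).rIn := by
  change 1 / ((n : ℝ) + 1) ≤ 2 * (1 / (2 * ((n : ℝ) + 1)))
  apply le_of_eq; field_simp

open scoped Convolution in
/-- The mollification of a function. -/
def mollify (n : ℕ) (u : Space d → ℝ) : Space d → ℝ :=
  (mollifier d n).normed volume ⋆[ContinuousLinearMap.lsmul ℝ ℝ, volume] u

lemma mollify_apply (n : ℕ) (u : Space d → ℝ) (x : Space d) :
    mollify n u x = ∫ y, (mollifier d n).normed volume y * u (x - y) := by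
  simp [mollify, convolution_def]

lemma contDiff_mollify (n : ℕ) {u : Space d → ℝ} (hu : LocallyIntegrable u) :
    ContDiff ℝ 1 (mollify n u) := by
  have := HasCompactSupport.contDiff_convolution_left (n := 1) (ContinuousLinearMap.lsmul ℝ ℝ)
    ((mollifier d n).hasCompactSupport_normed (μ := volume)) (μ := volume)
    (ContDiffBump.contDiff_normed (mollifier d n)) hu
  exact_mod_cast this

lemma ae_tendsto_mollify {u : Space d → ℝ} (hu : LocallyIntegrable u) :
    ∀ᵐ x, Tendsto (fun n => mollify n u x) atTop (𝓝 (u x)) :=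
  ContDiffBump.ae_convolution_tendsto_right_of_locallyIntegrable tendsto_mollifier_rOut
    (Eventually.of_forall mollifier_rOut_le) hu

lemma lintegral_mollifier (n : ℕ) :
    ∫⁻ y, ENNReal.ofReal ((mollifier d n).normed volume y) = 1 := by
  rw [← ofReal_integral_eq_lintegral_ofReal (ContDiffBump.integrable_normed _)
    (Eventually.of_forall (ContDiffBump.nonneg_normed _)), ContDiffBump.integral_normed]
  simp

lemma gradient_comp_sub_left {ψ : Space d → ℝ} (hψ : Differentiable ℝ ψ) (x y : Space d) :
    gradient (fun y => ψ (x - y)) y = -gradient ψ (x - y) := by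
  have h1 : HasFDerivAt (fun y => ψ (x - y)) (-(fderiv ℝ ψ (x - y))) y := by
    have := (hψ (x - y)).hasFDerivAt.comp y ((hasFDerivAt_id y).const_sub x)
    rw [ContinuousLinearMap.comp_neg, ContinuousLinearMap.comp_id] at this
    exact this
  rw [gradient, gradient, h1.fderiv, map_neg]

/-- Differentiation falls on the kernel, and the weak gradient is then tested with `η y = ψ (x -
y)`. This `η` is admissible because its support lies in the closed ball about `x`, hence in `Ω`. -/
lemma fderiv_mollify_apply {Ω : Set (Space d)} (hΩ : MeasurableSet Ω) {u : Space d → ℝ}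
    {G : Space d → Space d} (hu : MemLp u 2 (volume.restrict Ω)) (hG : IsWeakGradient Ω u G)
    {n : ℕ} {x : Space d} (hx : Metric.closedBall x (mollifier d n).rOut ⊆ Ω) (v : Space d) :
    fderiv ℝ (mollify n (Ω.indicator u)) x v =
      inner ℝ v (∫ y in Ω, (mollifier d n).normed volume (x - y) • G y) := by
  set ψ := (mollifier d n).normed (volume : Measure (Space d)) with hψ
  have hψs : ContDiff ℝ ∞ ψ := ContDiffBump.contDiff_normed _ (n := ⊤)
  have hψc : HasCompactSupport ψ := ContDiffBump.hasCompactSupport_normed _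
  have hψd : Differentiable ℝ ψ := hψs.differentiable (by simp)
  have hloc : LocallyIntegrable (Ω.indicator u) :=
    ((memLp_indicator_iff_restrict hΩ).2 hu).locallyIntegrable (by norm_num)
  have hlocr : LocallyIntegrable u (volume.restrict Ω) := hu.locallyIntegrable (by norm_num)
  have h1 := HasCompactSupport.hasFDerivAt_convolution_left (ContinuousLinearMap.lsmul ℝ ℝ)
    (μ := volume) hψc (hψs.of_le (by simp)) hloc x
  set η : Space d → ℝ := fun y => ψ (x - y) with hη
  have hηs : ContDiff ℝ ∞ η := hψs.comp (contDiff_const.sub contDiff_id)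
  have hts : tsupport η ⊆ Metric.closedBall x (mollifier d n).rOut := by
    refine closure_minimal (fun y hy => ?_) Metric.isClosed_closedBall
    have h2 : x - y ∈ Function.support ψ := hy
    rw [hψ, ContDiffBump.support_normed_eq, mem_ball_zero_iff] at h2
    rw [mem_closedBall_iff_norm']
    exact h2.le
  have hηc : HasCompactSupport η :=
    (isCompact_closedBall x _).of_isClosed_subset (isClosed_tsupport η) hts
  have hw := hG.2 η hηs hηc (hts.trans hx)
  have hgrad : ∀ y, inner ℝ v (gradient η y) = -(fderiv ℝ ψ (x - y) v) := by
    intro y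
    rw [hη, gradient_comp_sub_left hψd, inner_neg_right, real_inner_comm,
      ← InnerProductSpace.toDual_apply_apply (𝕜 := ℝ), gradient, LinearIsometryEquiv.apply_symm_apply]
  have hgc : Continuous (gradient η) :=
    (InnerProductSpace.toDual ℝ (Space d)).symm.continuous.comp (hηs.continuous_fderiv (by simp))
  have hgs : HasCompactSupport (gradient η) :=
    (hηc.fderiv (𝕜 := ℝ)).comp_left (map_zero _)
  have hint : Integrable (fun y => u y • gradient η y) (volume.restrict Ω) :=
    hlocr.integrable_smul_right_of_hasCompactSupport hgc hgs
  unfold mollify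
  rw [h1.fderiv, convolution_eq_swap]
  have hfc : Continuous (fderiv ℝ ψ) := hψs.continuous_fderiv (by simp)
  have hcomp : HasCompactSupport fun y => fderiv ℝ ψ (x - y) :=
    (hψc.fderiv (𝕜 := ℝ)).comp_homeomorph (Homeomorph.subLeft x)
  have hint2 : Integrable fun t => ((ContinuousLinearMap.precompL (Space d)
      (ContinuousLinearMap.lsmul ℝ ℝ)) (fderiv ℝ ψ (x - t))) (Ω.indicator u t) := by
    have h3 : (fun t => ((ContinuousLinearMap.precompL (Space d)
      (ContinuousLinearMap.lsmul ℝ ℝ)) (fderiv ℝ ψ (x - t))) (Ω.indicator u t)) =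
        fun t => Ω.indicator u t • fderiv ℝ ψ (x - t) := by
      funext t; ext w; simp [mul_comm]
    rw [h3]
    exact hloc.integrable_smul_right_of_hasCompactSupport (hfc.comp (by fun_prop)) hcomp
  rw [ContinuousLinearMap.integral_apply hint2]
  have h4 : ∀ t, (((ContinuousLinearMap.precompL (Space d)
      (ContinuousLinearMap.lsmul ℝ ℝ)) (fderiv ℝ ψ (x - t))) (Ω.indicator u t)) v =
      Ω.indicator (fun t => -(inner ℝ v (u t • gradient η t))) t := by
    intro t
    by_cases ht : t ∈ Ω
    · simp only [indicator_of_mem ht, inner_smul_right, hgrad]; simp [mul_comm]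
    · simp [ht]
  simp_rw [h4]
  rw [integral_indicator hΩ, integral_neg, integral_inner hint, hw, inner_neg_right, neg_neg]

/-- The derivative of the mollification is the average of `G` against a kernel of mass one supported
in `D`, so Jensen's inequality applies. -/
lemma enorm_fderiv_mollify_sq_le {Ω D : Set (Space d)} (hΩ : MeasurableSet Ω)
    (hD : D ⊆ Ω)
    {u : Space d → ℝ} {G : Space d → Space d} (hu : MemLp u 2 (volume.restrict Ω))
    (hG : IsWeakGradient Ω u G) {n : ℕ} {x : Space d}
    (hx : Metric.closedBall x (mollifier d n).rOut ⊆ D) :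
    ‖fderiv ℝ (mollify n (Ω.indicator u)) x‖ₑ ^ 2 ≤
      ∫⁻ y in D, ENNReal.ofReal ((mollifier d n).normed volume (x - y)) * ‖G y‖ₑ ^ 2 := by
  set ψ := (mollifier d n).normed (volume : Measure (Space d)) with hψ
  have h1 : ‖fderiv ℝ (mollify n (Ω.indicator u)) x‖ₑ ≤ ‖∫ y in Ω, ψ (x - y) • G y‖ₑ := by
    rw [← ofReal_norm, ← ofReal_norm]
    refine ENNReal.ofReal_le_ofReal (ContinuousLinearMap.opNorm_le_bound _ (norm_nonneg _) ?_)
    intro v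
    rw [fderiv_mollify_apply hΩ hu hG (hx.trans hD), mul_comm]
    exact norm_inner_le_norm _ _
  have hψ0 : ∀ y, y ∉ D → ψ (x - y) = 0 := by
    intro y hy
    by_contra h
    have h2 : x - y ∈ Function.support ψ := h
    rw [hψ, ContDiffBump.support_normed_eq, mem_ball_zero_iff] at h2
    exact hy (hx (mem_closedBall_iff_norm'.2 h2.le))
  have h2 : ∫ y in Ω, ψ (x - y) • G y = ∫ y in D, ψ (x - y) • G y := by
    have h0 : ∀ y ∈ Ω \ D, ψ (x - y) • G y = 0 := fun y hy => by rw [hψ0 y hy.2, zero_smul]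
    exact setIntegral_eq_of_subset_of_forall_sdiff_eq_zero hΩ hD h0
  have hψm : Measurable fun y => ENNReal.ofReal (ψ (x - y)) :=
    ENNReal.measurable_ofReal.comp ((ContDiffBump.continuous_normed _).measurable.comp
      (measurable_const.sub measurable_id))
  have hGm : AEMeasurable (fun y => ‖G y‖ₑ) (volume.restrict D) :=
    (hG.1.1.mono_measure (Measure.restrict_mono hD le_rfl)).enorm
  have h3 : ‖∫ y in D, ψ (x - y) • G y‖ₑ ≤
      ∫⁻ y in D, ENNReal.ofReal (ψ (x - y)) * ‖G y‖ₑ := by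
    refine (enorm_integral_le_lintegral_enorm _).trans (le_of_eq ?_)
    congr 1; funext y
    rw [enorm_smul, Real.enorm_eq_ofReal (ContDiffBump.nonneg_normed _ _)]
  calc _ ≤ (∫⁻ y in D, ENNReal.ofReal (ψ (x - y)) * ‖G y‖ₑ) ^ 2 := by
        gcongr; exact h1.trans (h2 ▸ h3)
    _ ≤ _ := sq_lintegral_mul_le hψm.aemeasurable hGm
    _ ≤ 1 * ∫⁻ y in D, ENNReal.ofReal (ψ (x - y)) * ‖G y‖ₑ ^ 2 := by
        gcongr
        calc _ ≤ ∫⁻ y, ENNReal.ofReal (ψ (x - y)) := setLIntegral_le_lintegral _ _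
          _ = ∫⁻ y, ENNReal.ofReal (ψ y) :=
              lintegral_sub_left_eq_self (fun y => ENNReal.ofReal (ψ y)) x
          _ = 1 := lintegral_mollifier n
          _ ≤ 1 := le_rfl
    _ = _ := one_mul _

/-! ### Eroded convex sets and passage to the limit in the Poincaré inequality -/

/-- The points of `D` whose distance to the complement of `D` exceeds `r`. -/
def erosion (D : Set (Space d)) (r : ℝ) : Set (Space d) := (Metric.cthickening r Dᶜ)ᶜ

lemma closedBall_subset_of_mem_erosion {D : Set (Space d)} {r : ℝ} {x : Space d}
    (hx : x ∈ erosion D r) : Metric.closedBall x r ⊆ D := by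
  intro y hy
  by_contra h
  exact hx (Metric.mem_cthickening_of_dist_le x y r Dᶜ h (by rwa [dist_comm]))

lemma mem_erosion_iff {D : Set (Space d)} (hD : IsOpen D) {r : ℝ} (hr : 0 ≤ r) {x : Space d} :
    x ∈ erosion D r ↔ Metric.closedBall x r ⊆ D := by
  refine ⟨closedBall_subset_of_mem_erosion, fun h hx => ?_⟩
  rw [hD.isClosed_compl.cthickening_eq_biUnion_closedBall hr] at hx
  simp only [mem_iUnion, exists_prop] at hx
  obtain ⟨y, hy, hxy⟩ := hx
  exact hy (h (by rwa [Metric.mem_closedBall_comm] at hxy))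

/-- A displacement of a convex combination by `w - z` is the same combination of the two endpoints
displaced by `w - z`, and both displaced endpoints lie in `D`. -/
lemma convex_erosion {D : Set (Space d)} (hD : IsOpen D) (hc : Convex ℝ D) {r : ℝ} (hr : 0 ≤ r) :
    Convex ℝ (erosion D r) := by
  intro x hx y hy a b ha hb hab
  rw [mem_erosion_iff hD hr] at *
  intro w hw
  set z := a • x + b • y
  have h1 : x + (w - z) ∈ D := hx (by
    rw [mem_closedBall_iff_norm] at *; simpa using hw)
  have h2 : y + (w - z) ∈ D := hy (by
    rw [mem_closedBall_iff_norm] at *; simpa using hw)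
  have h3 := hc h1 h2 ha hb hab
  have h4 : a • (x + (w - z)) + b • (y + (w - z)) = z + (a + b) • (w - z) := by
    simp only [z]; module
  rw [h4, hab, one_smul, add_sub_cancel] at h3
  exact h3

lemma eventually_mem_erosion {D : Set (Space d)} (hD : IsOpen D) {x : Space d} (hx : x ∈ D) :
    ∀ᶠ n in atTop, x ∈ erosion D (mollifier d n).rOut := by
  obtain ⟨ε, hε, hb⟩ := Metric.isOpen_iff.1 hD x hx
  filter_upwards [tendsto_mollifier_rOut.eventually_lt_const hε] with n hn
  rw [mem_erosion_iff hD (mollifier d n).rOut_pos.le]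
  exact (Metric.closedBall_subset_ball hn).trans hb

lemma measurableSet_erosion (D : Set (Space d)) (r : ℝ) : MeasurableSet (erosion D r) :=
  (Metric.isClosed_cthickening.isOpen_compl).measurableSet

lemma erosion_subset (D : Set (Space d)) {r : ℝ} (hr : 0 ≤ r) : erosion D r ⊆ D :=
  fun _ hx => closedBall_subset_of_mem_erosion hx (Metric.mem_closedBall_self hr)

/-- On the eroded set the mollification is controlled by values of `G` inside `D` only. The majorant
`H` is the convolution of the kernel with `|G|²` on `D`, whose total integral is that of `|G|²` over
`D`. -/
lemma poincare_mollify {Ω D : Set (Space d)} (hΩ : MeasurableSet Ω) (hDo : IsOpen D) (hD : D ⊆ Ω)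
    (hconv : Convex ℝ D) {u : Space d → ℝ} {G : Space d → Space d}
    (hu : MemLp u 2 (volume.restrict Ω)) (hG : IsWeakGradient Ω u G) {R : ℝ}
    (hR : ∀ x ∈ D, ∀ y ∈ D, ‖y - x‖ ≤ R) (n : ℕ) :
    ∫⁻ x in erosion D (mollifier d n).rOut, ∫⁻ y in erosion D (mollifier d n).rOut,
        ‖mollify n (Ω.indicator u) x - mollify n (Ω.indicator u) y‖ₑ ^ 2 ≤
      ENNReal.ofReal (R ^ 2) * (2 ^ d * volume D * ∫⁻ z in D, ‖G z‖ₑ ^ 2) := by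
  have hloc : LocallyIntegrable (Ω.indicator u) :=
    ((memLp_indicator_iff_restrict hΩ).2 hu).locallyIntegrable (by norm_num)
  have hED : erosion D (mollifier d n).rOut ⊆ D := erosion_subset D (mollifier d n).rOut_pos.le
  set H : Space d → ENNReal := fun x =>
    ∫⁻ y in D, ENNReal.ofReal ((mollifier d n).normed volume (x - y)) * ‖G y‖ₑ ^ 2
  have hGm : AEMeasurable (fun y => ‖G y‖ₑ ^ 2) (volume.restrict D) :=
    (hG.1.1.mono_measure (Measure.restrict_mono hD le_rfl)).enorm.pow_const 2
  -- `|G|²` is only almost everywhere measurable; a measurable representative makes the majorant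
  -- jointly measurable, as Tonelli requires.
  obtain ⟨G', hG'm, hG'⟩ := hGm
  have hHe : H = fun x => ∫⁻ y in D,
      ENNReal.ofReal ((mollifier d n).normed volume (x - y)) * G' y := by
    funext x
    exact lintegral_congr_ae (hG'.mono fun y hy => by simp only [hy])
  have hjm : Measurable fun p : Space d × Space d =>
      ENNReal.ofReal ((mollifier d n).normed volume (p.1 - p.2)) * G' p.2 :=
    (ENNReal.measurable_ofReal.comp ((ContDiffBump.continuous_normed _).measurable.comp
      (measurable_fst.sub measurable_snd))).mul (hG'm.comp measurable_snd)
  have hHm : Measurable H := by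
    rw [hHe]; exact hjm.lintegral_prod_right'
  have hHint : ∫⁻ x in erosion D (mollifier d n).rOut, H x ≤ ∫⁻ z in D, ‖G z‖ₑ ^ 2 := by
    calc ∫⁻ x in erosion D (mollifier d n).rOut, H x ≤ ∫⁻ x, H x := setLIntegral_le_lintegral _ _
      _ = ∫⁻ y in D, ∫⁻ x, ENNReal.ofReal ((mollifier d n).normed volume (x - y)) * G' y := by
          rw [hHe, lintegral_lintegral_swap hjm.aemeasurable]
      _ = ∫⁻ y in D, G' y := by
          congr 1; funext y
          rw [lintegral_mul_const _ (by
            exact ENNReal.measurable_ofReal.comp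
              ((ContDiffBump.continuous_normed _).measurable.comp (measurable_id.sub_const y))),
            lintegral_sub_right_eq_self (fun x => ENNReal.ofReal
              ((mollifier d n).normed volume x)) y, lintegral_mollifier, one_mul]
      _ = _ := (lintegral_congr_ae hG').symm
  refine (poincare_convex_contDiff (measurableSet_erosion D _) (convex_erosion hDo hconv
    (mollifier d n).rOut_pos.le) (contDiff_mollify n hloc) hHm (fun z hz => enorm_fderiv_mollify_sq_le hΩ hD hu hG (closedBall_subset_of_mem_erosion hz))
    (fun x hx y hy => hR x (hED hx) y (hED hy))).trans ?_
  gcongr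

lemma lintegral_lintegral_le_of_tendsto {X : Type*} [MeasurableSpace X] {μ : Measure X} [SFinite μ]
    {F : ℕ → X → X → ENNReal} (hF : ∀ n, Measurable (Function.uncurry (F n)))
    {f : X → X → ENNReal} {B : ENNReal} (hB : ∀ n, ∫⁻ x, ∫⁻ y, F n x y ∂μ ∂μ ≤ B)
    (h : ∀ᵐ x ∂μ, ∀ᵐ y ∂μ, Tendsto (fun n => F n x y) atTop (𝓝 (f x y))) :
    ∫⁻ x, ∫⁻ y, f x y ∂μ ∂μ ≤ B := by
  calc ∫⁻ x, ∫⁻ y, f x y ∂μ ∂μ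
      ≤ ∫⁻ x, ∫⁻ y, liminf (fun n => F n x y) atTop ∂μ ∂μ := by
        refine lintegral_mono_ae ?_
        filter_upwards [h] with x hx
        refine lintegral_mono_ae ?_
        filter_upwards [hx] with y hy
        exact hy.liminf_eq.ge
    _ ≤ ∫⁻ x, liminf (fun n => ∫⁻ y, F n x y ∂μ) atTop ∂μ :=
        lintegral_mono fun x => lintegral_liminf_le fun n =>
          (hF n).comp (measurable_const.prodMk measurable_id)
    _ ≤ liminf (fun n => ∫⁻ x, ∫⁻ y, F n x y ∂μ ∂μ) atTop :=
        lintegral_liminf_le fun n => (hF n).lintegral_prod_right'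
    _ ≤ B := liminf_le_of_le (by isBoundedDefault) fun b hb => by
        obtain ⟨n, hn⟩ := hb.exists
        exact hn.trans (hB n)

/-- The Poincaré inequality on convex subsets, for functions of class `H¹`. -/
theorem poincare_convex {Ω D : Set (Space d)} (hΩ : MeasurableSet Ω) (hDo : IsOpen D) (hD : D ⊆ Ω)
    (hconv : Convex ℝ D) {u : Space d → ℝ} {G : Space d → Space d}
    (hu : MemLp u 2 (volume.restrict Ω)) (hG : IsWeakGradient Ω u G) {R : ℝ}
    (hR : ∀ x ∈ D, ∀ y ∈ D, ‖y - x‖ ≤ R) :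
    ∫⁻ x in D, ∫⁻ y in D, ‖u x - u y‖ₑ ^ 2 ≤
      ENNReal.ofReal (R ^ 2) * (2 ^ d * volume D * ∫⁻ z in D, ‖G z‖ₑ ^ 2) := by
  set U : ℕ → Space d → ℝ := fun n => mollify n (Ω.indicator u)
  set E : ℕ → Set (Space d) := fun n => erosion D (mollifier d n).rOut
  have hloc : LocallyIntegrable (Ω.indicator u) :=
    ((memLp_indicator_iff_restrict hΩ).2 hu).locallyIntegrable (by norm_num)
  have hEo : ∀ n, MeasurableSet (E n) := fun n => measurableSet_erosion D _
  have hED : ∀ n, E n ⊆ D := fun n => erosion_subset D (mollifier d n).rOut_pos.le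
  have hUs : ∀ n, ContDiff ℝ 1 (U n) := fun n => contDiff_mollify n hloc
  -- The indicators restrict to the eroded sets while the domain of integration stays `D`; at each
  -- point of `D` they are eventually equal to one, so Fatou's lemma applies on `D` itself.
  set F : ℕ → Space d → Space d → ENNReal := fun n x y =>
    (E n).indicator 1 x * ((E n).indicator 1 y * ‖U n x - U n y‖ₑ ^ 2) with hF
  have hFm : ∀ n, Measurable (Function.uncurry (F n)) := by
    intro n
    have h1 : Measurable ((E n).indicator (1 : Space d → ENNReal)) :=
      measurable_one.indicator (hEo n)
    have h2 : Measurable fun p : Space d × Space d => ‖U n p.1 - U n p.2‖ₑ ^ 2 :=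
      ((((hUs n).continuous.comp continuous_fst).sub
        ((hUs n).continuous.comp continuous_snd)).enorm.measurable).pow_const 2
    exact (h1.comp measurable_fst).mul ((h1.comp measurable_snd).mul h2)
  set B := ENNReal.ofReal (R ^ 2) * (2 ^ d * volume D * ∫⁻ z in D, ‖G z‖ₑ ^ 2)
  have hbound : ∀ n, ∫⁻ x in D, ∫⁻ y in D, F n x y ≤ B := by
    intro n
    calc ∫⁻ x in D, ∫⁻ y in D, F n x y
        = ∫⁻ x in E n, ∫⁻ y in E n, ‖U n x - U n y‖ₑ ^ 2 := by
          have e1 : ∀ x, ∫⁻ y in D, F n x y =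
              (E n).indicator (fun x => ∫⁻ y in E n, ‖U n x - U n y‖ₑ ^ 2) x := by
            intro x
            simp only [hF]
            by_cases hx : x ∈ E n
            · simp only [indicator_of_mem hx, Pi.one_apply, one_mul]
              have : ∀ y, (E n).indicator (1 : Space d → ENNReal) y * ‖U n x - U n y‖ₑ ^ 2 =
                  (E n).indicator (fun y => ‖U n x - U n y‖ₑ ^ 2) y := by
                intro y; by_cases hy : y ∈ E n <;> simp [hy]
              simp_rw [this]
              rw [lintegral_indicator (hEo n), Measure.restrict_restrict (hEo n),
                inter_eq_left.2 (hED n)]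
            · simp [hx]
          simp_rw [e1]
          rw [lintegral_indicator (hEo n), Measure.restrict_restrict (hEo n),
            inter_eq_left.2 (hED n)]
      _ ≤ B := poincare_mollify hΩ hDo hD hconv hu hG hR n
  have hae : ∀ᵐ x ∂(volume.restrict D), Tendsto (fun n => U n x) atTop (𝓝 (u x)) ∧ x ∈ D := by
    filter_upwards [ae_restrict_of_ae (ae_tendsto_mollify hloc),
      ae_restrict_mem hDo.measurableSet] with x hx hxD
    rw [indicator_of_mem (hD hxD)] at hx
    exact ⟨hx, hxD⟩
  refine lintegral_lintegral_le_of_tendsto hFm hbound ?_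
  filter_upwards [hae] with x hx
  filter_upwards [hae] with y hy
  have h1 : Tendsto (fun n => ‖U n x - U n y‖ₑ ^ 2) atTop (𝓝 (‖u x - u y‖ₑ ^ 2)) :=
    (((ENNReal.continuous_pow 2).comp continuous_enorm).tendsto _).comp (hx.1.sub hy.1)
  refine h1.congr' ?_
  filter_upwards [eventually_mem_erosion hDo hx.2, eventually_mem_erosion hDo hy.2]
    with n hnx hny
  simp [hF, E, hnx, hny]

/-- The distance in `L²(S)` to the mean over `A`, when `S` and `A` lie in a convex set. -/
theorem lintegral_sub_average_le {Ω D S A : Set (Space d)} (hΩ : MeasurableSet Ω) (hDo : IsOpen D)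
    (hD : D ⊆ Ω) (hconv : Convex ℝ D) {u : Space d → ℝ} {G : Space d → Space d}
    (hu : MemLp u 2 (volume.restrict Ω)) (hG : IsWeakGradient Ω u G) {R : ℝ}
    (hR : ∀ x ∈ D, ∀ y ∈ D, ‖y - x‖ ≤ R) (hSD : S ⊆ D) (hAD : A ⊆ D)
    (hA0 : volume A ≠ 0) (hA1 : volume A ≠ ⊤) :
    ∫⁻ x in S, ‖u x - ⨍ y in A, u y‖ₑ ^ 2 ≤ (volume A)⁻¹ *
      (ENNReal.ofReal (R ^ 2) * (2 ^ d * volume D * ∫⁻ z in D, ‖G z‖ₑ ^ 2)) := by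
  have hfin : IsFiniteMeasure (volume.restrict A) := ⟨by simpa using hA1.lt_top⟩
  have huA : MemLp u 2 (volume.restrict A) :=
    hu.mono_measure (Measure.restrict_mono (hAD.trans hD) le_rfl)
  have hint : Integrable u (volume.restrict A) := huA.integrable (by norm_num)
  -- The deviation from the mean is the mean of the deviations, so Cauchy–Schwarz over `A` reduces
  -- the claim to the double integral in `poincare_convex`.
  have hpt : ∀ x, ‖u x - ⨍ y in A, u y‖ₑ ^ 2 ≤
      (volume A)⁻¹ * ∫⁻ y in A, ‖u x - u y‖ₑ ^ 2 := by
    intro x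
    have hreal : volume.real A ≠ 0 := by
      simp [Measure.real, ENNReal.toReal_eq_zero_iff, hA0, hA1]
    have h1 : u x - ⨍ y in A, u y = (volume.real A)⁻¹ • ∫ y in A, (u x - u y) := by
      rw [integral_sub (integrable_const _) hint, setAverage_eq, smul_sub]
      simp only [setIntegral_const, smul_eq_mul]
      field_simp
    have h2 : ‖(volume.real A)⁻¹‖ₑ = (volume A)⁻¹ := by
      rw [Real.enorm_eq_ofReal (by positivity), ENNReal.ofReal_inv_of_pos
        (lt_of_le_of_ne measureReal_nonneg hreal.symm), Measure.real, ENNReal.ofReal_toReal hA1]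
    rw [h1, enorm_smul, mul_pow, h2]
    calc (volume A)⁻¹ ^ 2 * ‖∫ y in A, (u x - u y)‖ₑ ^ 2
        ≤ (volume A)⁻¹ ^ 2 * (∫⁻ y in A, ‖u x - u y‖ₑ) ^ 2 := by
          gcongr; exact enorm_integral_le_lintegral_enorm _
      _ ≤ (volume A)⁻¹ ^ 2 * (volume A * ∫⁻ y in A, ‖u x - u y‖ₑ ^ 2) := by
          gcongr
          simpa using sq_lintegral_le (μ := volume.restrict A) (f := fun y => ‖u x - u y‖ₑ)
            (aestronglyMeasurable_const.sub huA.1).enorm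
      _ = _ := by
          rw [sq, ← mul_assoc, mul_assoc _ _ (volume A), ENNReal.inv_mul_cancel hA0 hA1, mul_one]
  calc ∫⁻ x in S, ‖u x - ⨍ y in A, u y‖ₑ ^ 2
      ≤ ∫⁻ x in S, (volume A)⁻¹ * ∫⁻ y in A, ‖u x - u y‖ₑ ^ 2 := lintegral_mono hpt
    _ ≤ ∫⁻ x in D, (volume A)⁻¹ * ∫⁻ y in D, ‖u x - u y‖ₑ ^ 2 := by
        refine lintegral_mono' (Measure.restrict_mono hSD le_rfl) fun x => ?_
        gcongr
    _ = (volume A)⁻¹ * ∫⁻ x in D, ∫⁻ y in D, ‖u x - u y‖ₑ ^ 2 :=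
        lintegral_const_mul' _ _ (ENNReal.inv_ne_top.2 hA0)
    _ ≤ _ := by
        gcongr
        exact poincare_convex hΩ hDo hD hconv hu hG hR

/-! ### Domains with Lipschitz boundary -/

/-- `Ω` is, near the point `z`, the region below the graph of `ψ` in the direction `ν`. -/
structure IsGraphChart (Ω : Set (Space d)) (z : Space d) (r : ℝ) (L : NNReal) (ν : Space d)
    (ψ : Space d → ℝ) : Prop where
  norm_eq : ‖ν‖ = 1
  lipschitz : LipschitzWith L ψ
  mem_iff : ∀ y ∈ Metric.ball z r, (y ∈ Ω ↔ inner ℝ ν y < ψ (y - (inner ℝ ν y : ℝ) • ν))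

/-- Compactness of the boundary: a chart on a ball of radius `ε` about `x` is also a chart on the
ball of radius `ε / 2` about any boundary point within `ε / 2` of `x`. Finitely many of these
suffice. -/
lemma exists_uniform_charts {Ω : Set (Space d)} (hb : Bornology.IsBounded Ω)
    (hL : HasLipschitzBoundary Ω) :
    ∃ r : ℝ, 0 < r ∧ ∃ L : NNReal, ∀ z ∈ frontier Ω, ∃ ν ψ, IsGraphChart Ω z r L ν ψ := by
  have hK : IsCompact (frontier Ω) :=
    Metric.isCompact_of_isClosed_isBounded isClosed_frontier (hb.closure.subset frontier_subset_closure)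
  refine hK.induction_on (p := fun S => ∃ r : ℝ, 0 < r ∧ ∃ L : NNReal,
    ∀ z ∈ S, ∃ ν ψ, IsGraphChart Ω z r L ν ψ) ⟨1, one_pos, 0, by simp⟩ ?_ ?_ ?_
  · rintro S S' hS ⟨r, hr, L, h⟩
    exact ⟨r, hr, L, fun z hz => h z (hS hz)⟩
  · rintro S S' ⟨r, hr, L, h⟩ ⟨r', hr', L', h'⟩
    refine ⟨min r r', lt_min hr hr', max L L', fun z hz => ?_⟩
    rcases hz with hz | hz
    · obtain ⟨ν, ψ, hc⟩ := h z hz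
      exact ⟨ν, ψ, hc.1, hc.2.weaken (le_max_left _ _), fun y hy =>
        hc.3 y (Metric.ball_subset_ball (min_le_left _ _) hy)⟩
    · obtain ⟨ν, ψ, hc⟩ := h' z hz
      exact ⟨ν, ψ, hc.1, hc.2.weaken (le_max_right _ _), fun y hy =>
        hc.3 y (Metric.ball_subset_ball (min_le_right _ _) hy)⟩
  · intro x hx
    obtain ⟨U, hU, ν, hν, L, ψ, hψ, h⟩ := hL x hx
    obtain ⟨ε, hε, hεU⟩ := Metric.mem_nhds_iff.1 hU
    refine ⟨Metric.ball x (ε / 2), mem_nhdsWithin_of_mem_nhds (Metric.ball_mem_nhds _ (by positivity)),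
      ε / 2, by positivity, L, fun z hz => ⟨ν, ψ, hν, hψ, fun y hy => h y (hεU ?_)⟩⟩
    rw [Metric.mem_ball] at *
    linarith [dist_triangle y z x]

namespace IsGraphChart

variable {Ω : Set (Space d)} {z ν : Space d} {r : ℝ} {L : NNReal} {ψ : Space d → ℝ}

lemma continuous_height (h : IsGraphChart Ω z r L ν ψ) :
    Continuous fun y : Space d => ψ (y - (inner ℝ ν y : ℝ) • ν) :=
  h.lipschitz.continuous.comp (by fun_prop)

lemma inner_le_of_mem_closure (h : IsGraphChart Ω z r L ν ψ) {y : Space d}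
    (hy : y ∈ Metric.ball z r) (hyc : y ∈ closure Ω) :
    inner ℝ ν y ≤ ψ (y - (inner ℝ ν y : ℝ) • ν) := by
  by_contra! hlt
  have hopen : IsOpen (Metric.ball z r ∩
      {y : Space d | ψ (y - (inner ℝ ν y : ℝ) • ν) < inner ℝ ν y}) :=
    Metric.isOpen_ball.inter (isOpen_lt h.continuous_height (by fun_prop))
  obtain ⟨w, ⟨hw1, hw2⟩, hw⟩ := mem_closure_iff.1 hyc _ hopen ⟨hy, hlt⟩
  exact absurd ((h.mem_iff w hw1).1 hw) (not_lt.2 (le_of_lt hw2))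

lemma inner_eq_of_mem_frontier (h : IsGraphChart Ω z r L ν ψ) (hΩ : IsOpen Ω) {y : Space d}
    (hy : y ∈ Metric.ball z r) (hyf : y ∈ frontier Ω) :
    inner ℝ ν y = ψ (y - (inner ℝ ν y : ℝ) • ν) := by
  refine le_antisymm (h.inner_le_of_mem_closure hy (frontier_subset_closure hyf)) ?_
  by_contra! hlt
  rw [hΩ.frontier_eq] at hyf
  exact hyf.2 ((h.mem_iff y hy).2 hlt)

end IsGraphChart

/-- The translates of the graph by `ν / (n + 1)` are pairwise disjoint, since each vertical line
meets the graph at most once. A bounded measurable set with infinitely many disjoint translates by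
bounded vectors is null. -/
lemma volume_graph_inter_ball (ν : Space d) (hν : ‖ν‖ = 1) {ψ : Space d → ℝ} (hψ : Continuous ψ)
    (z : Space d) (r : ℝ) :
    volume ({y : Space d | inner ℝ ν y = ψ (y - (inner ℝ ν y : ℝ) • ν)} ∩ Metric.ball z r) = 0 := by
  have hνν : inner ℝ ν ν = (1 : ℝ) := by rw [real_inner_self_eq_norm_sq, hν]; norm_num
  refine Measure.addHaar_eq_zero_of_disjoint_translates volume
    (fun n : ℕ => (1 / ((n : ℝ) + 1)) • ν) ?_ ?_ ?_
  · refine (Metric.isBounded_closedBall (x := (0 : Space d)) (r := 1)).subset ?_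
    rintro _ ⟨n, rfl⟩
    rw [mem_closedBall_zero_iff, norm_smul, hν, mul_one, Real.norm_of_nonneg (by positivity)]
    rw [div_le_one (by positivity)]
    linarith [n.cast_nonneg (α := ℝ)]
  · intro m n hmn
    rw [Function.onFun, Set.disjoint_left]
    rintro p hp hq
    simp only [Set.singleton_add, mem_image, mem_inter_iff, mem_ofPred_eq] at hp hq
    obtain ⟨y, ⟨hy, -⟩, rfl⟩ := hp
    obtain ⟨w, ⟨hw, -⟩, hyw⟩ := hq
    have hwy : w = y + ((1 / ((m : ℝ) + 1)) - (1 / ((n : ℝ) + 1))) • ν := by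
      rw [sub_smul, ← add_sub_assoc, add_comm y, ← hyw]; abel
    set c := (1 / ((m : ℝ) + 1)) - (1 / ((n : ℝ) + 1))
    have h1 : inner ℝ ν w = inner ℝ ν y + c := by
      rw [hwy, inner_add_right, inner_smul_right, hνν, mul_one]
    have h2 : w - (inner ℝ ν w : ℝ) • ν = y - (inner ℝ ν y : ℝ) • ν := by
      rw [h1, hwy]; module
    rw [h2, h1, ← hy] at hw
    have hc : (1 / ((m : ℝ) + 1)) = (1 / ((n : ℝ) + 1)) := by
      simp only [c] at hw; linarith
    rw [one_div, one_div, inv_inj, add_left_inj, Nat.cast_inj] at hc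
    exact hmn hc
  · refine (isClosed_eq (by fun_prop) (hψ.comp (by fun_prop))).measurableSet.inter
      measurableSet_ball

lemma volume_frontier_eq_zero {Ω : Set (Space d)} (hΩ : IsOpen Ω) (hb : Bornology.IsBounded Ω)
    (hL : HasLipschitzBoundary Ω) : volume (frontier Ω) = 0 := by
  obtain ⟨r, hr, L, h⟩ := exists_uniform_charts hb hL
  refine measure_null_of_locally_null _ fun z hz => ?_
  obtain ⟨ν, ψ, hc⟩ := h z hz
  refine ⟨frontier Ω ∩ Metric.ball z r,
    inter_mem_nhdsWithin _ (Metric.ball_mem_nhds z hr), ?_⟩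
  refine measure_mono_null ?_ (volume_graph_inter_ball ν hc.norm_eq hc.lipschitz.continuous z r)
  exact fun y hy => ⟨hc.inner_eq_of_mem_frontier hΩ hy.2 hy.1, hy.2⟩

/-- A direction that descends more steeply than the Lipschitz constant allows the graph to descend
leads from the closed region below the graph strictly into it. -/
lemma IsGraphChart.segment_mem {Ω : Set (Space d)} {w ν : Space d} {r : ℝ} {L : NNReal}
    {ψ : Space d → ℝ} (hc : IsGraphChart Ω w r L ν ψ) {x v : Space d} (hx : x ∈ Metric.ball w r)
    (hxc : x ∈ closure Ω) {t : ℝ} (ht : 0 < t) (hxt : x + t • v ∈ Metric.ball w r)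
    (hv : inner ℝ ν v < -(L * ‖v - (inner ℝ ν v : ℝ) • ν‖)) : x + t • v ∈ Ω := by
  rw [hc.mem_iff _ hxt]
  have h1 := hc.inner_le_of_mem_closure hx hxc
  have h2 : x + t • v - (inner ℝ ν (x + t • v) : ℝ) • ν =
      (x - (inner ℝ ν x : ℝ) • ν) + t • (v - (inner ℝ ν v : ℝ) • ν) := by
    rw [inner_add_right, inner_smul_right]; module
  have h3 := hc.lipschitz.dist_le_mul (x - (inner ℝ ν x : ℝ) • ν)
    ((x - (inner ℝ ν x : ℝ) • ν) + t • (v - (inner ℝ ν v : ℝ) • ν))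
  rw [dist_eq_norm, dist_eq_norm, sub_add_cancel_left, norm_neg, norm_smul,
    Real.norm_of_nonneg ht.le, Real.norm_eq_abs] at h3
  have h4 := le_of_abs_le h3
  rw [h2, inner_add_right, inner_smul_right]
  have h5 : t * inner ℝ ν v < t * -(L * ‖v - (inner ℝ ν v : ℝ) • ν‖) :=
    mul_lt_mul_of_pos_left hv ht
  nlinarith

lemma norm_sub_inner_smul_le {ν : Space d} (hν : ‖ν‖ = 1) (v : Space d) :
    ‖v - (inner ℝ ν v : ℝ) • ν‖ ≤ ‖v‖ := by
  have h : ‖v - (inner ℝ ν v : ℝ) • ν‖ ^ 2 = ‖v‖ ^ 2 - (inner ℝ ν v : ℝ) ^ 2 := by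
    rw [norm_sub_sq_real, inner_smul_right, norm_smul, hν, real_inner_comm, mul_one,
      Real.norm_eq_abs, sq_abs]
    ring
  nlinarith [norm_nonneg v, norm_nonneg (v - (inner ℝ ν v : ℝ) • ν),
    sq_nonneg (inner ℝ ν v : ℝ)]

/-- The ball of radius `h` about `c` is seen, inside `Ω`, from all points of the closure of `Ω` at
distance at most `h` from `z`. -/
def SeesBall (Ω : Set (Space d)) (z c : Space d) (h : ℝ) : Prop :=
  ∀ x ∈ closure Ω, ‖x - z‖ ≤ h → ∀ y, ‖y - c‖ ≤ h → ∀ t : ℝ, 0 < t → t ≤ 1 → x + t • (y - x) ∈ Ω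

/-- A uniform cone property. -/
theorem exists_seesBall {Ω : Set (Space d)} (hΩ : IsOpen Ω) (hb : Bornology.IsBounded Ω)
    (hL : HasLipschitzBoundary Ω) :
    ∃ h₀ : ℝ, 0 < h₀ ∧ ∃ k : ℝ, 1 ≤ k ∧ ∀ z ∈ closure Ω, ∀ h, 0 < h → h ≤ h₀ →
      ∃ c, ‖c - z‖ ≤ k * h ∧ SeesBall Ω z c h := by
  obtain ⟨r, hr, L, hch⟩ := exists_uniform_charts hb hL
  -- Near the boundary `y - x = b - k h ν` with `‖b‖ ≤ 2 h`. Its slope beats the Lipschitz cone as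
  -- soon as `2 h - k h < -2 L h`, that is, `k > 2 L + 2`.
  set k : ℝ := 2 * L + 3 with hk
  have hL0 : (0 : ℝ) ≤ L := L.2
  have hk3 : 3 ≤ k := by linarith
  refine ⟨r / (4 * k), by positivity, k, by linarith, fun z hz h hh hh0 => ?_⟩
  rw [le_div_iff₀ (by positivity)] at hh0
  have hpt : ∀ (c x y : Space d), ‖c - z‖ ≤ k * h → ‖x - z‖ ≤ h → ‖y - c‖ ≤ h → ∀ t : ℝ, 0 ≤ t →
      t ≤ 1 → ‖x + t • (y - x) - z‖ < r / 2 := by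
    intro c x y hc hx hy t ht ht1
    have e : x + t • (y - x) - z = (1 - t) • (x - z) + t • ((y - c) + (c - z)) := by module
    have h1 : ‖(y - c) + (c - z)‖ ≤ (k + 1) * h := by
      linarith [norm_add_le (y - c) (c - z)]
    have h2 : ‖x - z‖ ≤ (k + 1) * h := by nlinarith
    rw [e]
    calc _ ≤ ‖(1 - t) • (x - z)‖ + ‖t • ((y - c) + (c - z))‖ := norm_add_le _ _
      _ = (1 - t) * ‖x - z‖ + t * ‖(y - c) + (c - z)‖ := by
          rw [norm_smul, norm_smul, Real.norm_of_nonneg (by linarith), Real.norm_of_nonneg ht]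
      _ ≤ (1 - t) * ((k + 1) * h) + t * ((k + 1) * h) :=
          add_le_add (mul_le_mul_of_nonneg_left h2 (by linarith)) (mul_le_mul_of_nonneg_left h1 ht)
      _ < r / 2 := by nlinarith
  -- Near a boundary point the ball is placed at depth `k h` below `z` in the chart. Otherwise the
  -- ball of radius `r / 2` about `z` lies in `Ω` by connectedness, and `c = z` works.
  by_cases hnear : ∃ w ∈ frontier Ω, ‖z - w‖ < r / 2
  · obtain ⟨w, hw, hzw⟩ := hnear
    obtain ⟨ν, ψ, hc⟩ := hch w hw
    have hν := hc.norm_eq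
    have hνν : inner ℝ ν ν = (1 : ℝ) := by rw [real_inner_self_eq_norm_sq, hν]; norm_num
    have hcz : ‖(z - (k * h) • ν) - z‖ ≤ k * h := by
      rw [sub_sub_cancel_left, norm_neg, norm_smul, hν, mul_one,
        Real.norm_of_nonneg (by positivity)]
    refine ⟨z - (k * h) • ν, hcz, fun x hx hxz y hy t ht ht1 => ?_⟩
    have hball : ∀ p : Space d, ‖p - z‖ < r / 2 → p ∈ Metric.ball w r := by
      intro p hp
      rw [mem_ball_iff_norm, ← sub_add_sub_cancel p z w]
      linarith [norm_add_le (p - z) (z - w)]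
    refine hc.segment_mem (hball x ?_) hx ht (hball _ (hpt _ x y hcz hxz hy t ht.le ht1)) ?_
    · nlinarith
    · set b := (y - (z - (k * h) • ν)) - (x - z) with hbdef
      have hbn : ‖b‖ ≤ 2 * h := by linarith [norm_sub_le (y - (z - (k * h) • ν)) (x - z)]
      have e : y - x = b - (k * h) • ν := by rw [hbdef]; module
      have h1 : inner ℝ ν (y - x) = inner ℝ ν b - k * h := by
        rw [e, inner_sub_right, inner_smul_right, hνν, mul_one]
      have h2 : y - x - (inner ℝ ν (y - x) : ℝ) • ν = b - (inner ℝ ν b : ℝ) • ν := by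
        rw [h1, e]; module
      have h3 : inner ℝ ν b ≤ 2 * h := by
        have := real_inner_le_norm ν b
        rw [hν, one_mul] at this; linarith
      rw [h2, h1]
      have h4 := norm_sub_inner_smul_le hν b
      have h5 : L * ‖b - (inner ℝ ν b : ℝ) • ν‖ ≤ L * (2 * h) :=
        mul_le_mul_of_nonneg_left (h4.trans hbn) hL0
      nlinarith
  · push Not at hnear
    have hsub : Metric.ball z (r / 2) ⊆ Ω := by
      have hzΩ : z ∈ Ω := by
        by_contra hz'
        have := hnear z (by rw [hΩ.frontier_eq]; exact ⟨hz, hz'⟩)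
        simp at this; linarith
      refine (convex_ball z (r / 2)).isPreconnected.subset_left_of_subset_union hΩ
        isClosed_closure.isOpen_compl (disjoint_compl_right_iff_subset.2 subset_closure) ?_
        ⟨z, Metric.mem_ball_self (by positivity), hzΩ⟩
      intro q hq
      by_contra hq'
      simp only [mem_union, mem_compl_iff, not_or, not_not] at hq'
      have := hnear q (by rw [hΩ.frontier_eq]; exact ⟨hq'.2, hq'.1⟩)
      rw [mem_ball_iff_norm'] at hq
      linarith
    refine ⟨z, by simp; positivity, fun x hx hxz y hy t ht ht1 => hsub ?_⟩
    rw [mem_ball_iff_norm]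
    exact hpt z x y (by simp; positivity) hxz hy t ht.le ht1

/-- The union of the half-open segments from the points of the ball to the points of `s`. -/
def patch (s : Set (Space d)) (c : Space d) (h : ℝ) : Set (Space d) :=
  {p | ∃ x ∈ s, ∃ y ∈ Metric.ball c h, ∃ t : ℝ, 0 < t ∧ t ≤ 1 ∧ p = x + t • (y - x)}

section patch

variable {s : Set (Space d)} {c : Space d} {h : ℝ}

/-- With `x` and `t > 0` fixed, a small move of `p` is matched by a move of `y` within the open
ball, larger by the factor `1 / t`. Excluding `t = 0` is essential for this, and also keeps the
patch off the boundary of `Ω`, where points of `s` may lie. -/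
lemma isOpen_patch : IsOpen (patch s c h) := by
  rw [isOpen_iff_mem_nhds]
  rintro p ⟨x, hx, y, hy, t, ht, ht1, rfl⟩
  have hcont : ContinuousAt (fun p : Space d => x + t⁻¹ • (p - x)) (x + t • (y - x)) := by fun_prop
  have hyy : x + t⁻¹ • (x + t • (y - x) - x) = y := by
    rw [add_sub_cancel_left, smul_smul, inv_mul_cancel₀ ht.ne', one_smul, add_sub_cancel]
  filter_upwards [hcont.preimage_mem_nhds (t := Metric.ball c h)
    (by rw [hyy]; exact Metric.isOpen_ball.mem_nhds hy)] with q hq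
  refine ⟨x, hx, _, hq, t, ht, ht1, ?_⟩
  rw [add_sub_cancel_left, smul_smul, mul_inv_cancel₀ ht.ne', one_smul, add_sub_cancel]

lemma convex_patch (hs : Convex ℝ s) : Convex ℝ (patch s c h) := by
  rintro _ ⟨x, hx, y, hy, t, ht, ht1, rfl⟩ _ ⟨x', hx', y', hy', t', ht', ht1', rfl⟩ a b ha hb hab
  set T := a * t + b * t' with hT
  have hT0 : 0 < T := by
    rcases ha.eq_or_lt with rfl | ha'
    · have : b = 1 := by linarith
      rw [hT, this]; linarith
    · have := mul_pos ha' ht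
      have := mul_nonneg hb ht'.le
      linarith
  have hT1 : T ≤ 1 := by nlinarith
  have hy2 : (a * t / T) • y + (b * t' / T) • y' ∈ Metric.ball c h :=
    (convex_ball c h) hy hy' (by positivity) (by positivity) (by field_simp; linarith)
  have hyT : T • ((a * t / T) • y + (b * t' / T) • y') = (a * t) • y + (b * t') • y' := by
    rw [smul_add, smul_smul, smul_smul, mul_div_cancel₀ _ hT0.ne', mul_div_cancel₀ _ hT0.ne']
  -- The combination has weight `1 - T` on `s`. If `T = 1` the normalised weights are undefined, but
  -- then `a (1 - t) = b (1 - t') = 0` and any point of `s` will do.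
  rcases hT1.eq_or_lt with h1 | h1
  · refine ⟨x, hx, _, hy2, T, hT0, hT1, ?_⟩
    have e : ∀ w : Space d, x + T • (w - x) = (1 - T) • x + T • w := fun w => by module
    rw [e, hyT, h1, sub_self, zero_smul, zero_add]
    have h2 : a * (1 - t) + b * (1 - t') = 0 := by linarith
    have h5 := mul_nonneg ha (sub_nonneg.2 ht1)
    have h6 := mul_nonneg hb (sub_nonneg.2 ht1')
    have h3 : a * (1 - t) = 0 := by linarith
    have h4 : b * (1 - t') = 0 := by linarith
    calc _ = (a * (1 - t)) • x + (b * (1 - t')) • x' + ((a * t) • y + (b * t') • y') := by module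
      _ = _ := by rw [h3, h4]; simp
  · have h1' : 0 < 1 - T := by linarith
    have e1 : 1 - T = a * (1 - t) + b * (1 - t') := by rw [hT]; linarith
    refine ⟨(a * (1 - t) / (1 - T)) • x + (b * (1 - t') / (1 - T)) • x', hs hx hx'
      (div_nonneg (mul_nonneg ha (by linarith)) h1'.le)
      (div_nonneg (mul_nonneg hb (by linarith)) h1'.le)
      (by rw [← add_div, ← e1, div_self h1'.ne']), _, hy2, T, hT0, hT1, ?_⟩
    have e : ∀ v w : Space d, v + T • (w - v) = (1 - T) • v + T • w := fun v w => by module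
    have hxT : (1 - T) • ((a * (1 - t) / (1 - T)) • x + (b * (1 - t') / (1 - T)) • x') =
        (a * (1 - t)) • x + (b * (1 - t')) • x' := by
      rw [smul_add, smul_smul, smul_smul, mul_div_cancel₀ _ h1'.ne', mul_div_cancel₀ _ h1'.ne']
    rw [e, hyT, hxT]
    module

lemma ball_subset_patch (hs : s.Nonempty) : Metric.ball c h ⊆ patch s c h := fun y hy => by
  obtain ⟨x, hx⟩ := hs
  exact ⟨x, hx, y, hy, 1, one_pos, le_rfl, by simp⟩

/-- The segment from `c` to an interior point `x` can be prolonged slightly beyond `x` inside `s`;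
then `x` lies on the half-open segment from the prolonged endpoint to `c`. -/
lemma interior_subset_patch (hh : 0 < h) : interior s ⊆ patch s c h := by
  intro x hx
  have hcont : ContinuousAt (fun τ : ℝ => x - τ • (c - x)) 0 := by fun_prop
  have hnhds : (fun τ : ℝ => x - τ • (c - x)) ⁻¹' s ∈ 𝓝 (0 : ℝ) :=
    hcont.preimage_mem_nhds (by simpa using mem_interior_iff_mem_nhds.1 hx)
  obtain ⟨ε, hε, hsub⟩ := Metric.mem_nhds_iff.1 hnhds
  have hmem : x - (ε / 2) • (c - x) ∈ s := hsub (by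
    rw [Metric.mem_ball, Real.dist_eq, sub_zero, abs_of_pos (by positivity)]; linarith)
  set τ := ε / 2 with hτ
  have hτ0 : 0 < τ := by positivity
  refine ⟨_, hmem, c, Metric.mem_ball_self hh, τ / (1 + τ), by positivity, ?_, ?_⟩
  · rw [div_le_one (by positivity)]; linarith
  · have e : c - (x - τ • (c - x)) = (1 + τ) • (c - x) := by module
    rw [e, smul_smul, div_mul_cancel₀ _ (by positivity)]; abel

lemma patch_subset {Ω : Set (Space d)} {z : Space d} (hsΩ : s ⊆ closure Ω)
    (hsz : ∀ x ∈ s, ‖x - z‖ ≤ h) (hsee : SeesBall Ω z c h) : patch s c h ⊆ Ω := by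
  rintro _ ⟨x, hx, y, hy, t, ht, ht1, rfl⟩
  exact hsee x (hsΩ hx) (hsz x hx) y (mem_ball_iff_norm.1 hy).le t ht ht1

lemma norm_sub_le_of_mem_patch {z : Space d} {k : ℝ} (hk : 1 ≤ k) (hh : 0 < h)
    (hsz : ∀ x ∈ s, ‖x - z‖ ≤ h) (hcz : ‖c - z‖ ≤ k * h) {p : Space d} (hp : p ∈ patch s c h) :
    ‖p - z‖ ≤ (k + 1) * h := by
  obtain ⟨x, hx, y, hy, t, ht, ht1, rfl⟩ := hp
  have hy' := (mem_ball_iff_norm.1 hy).le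
  have e : x + t • (y - x) - z = (1 - t) • (x - z) + t • ((y - c) + (c - z)) := by module
  have h1 : ‖(y - c) + (c - z)‖ ≤ (k + 1) * h := by
    linarith [norm_add_le (y - c) (c - z)]
  have h2 : ‖x - z‖ ≤ (k + 1) * h := by nlinarith [hsz x hx]
  rw [e]
  calc _ ≤ ‖(1 - t) • (x - z)‖ + ‖t • ((y - c) + (c - z))‖ := norm_add_le _ _
    _ = (1 - t) * ‖x - z‖ + t * ‖(y - c) + (c - z)‖ := by
        rw [norm_smul, norm_smul, Real.norm_of_nonneg (by linarith), Real.norm_of_nonneg ht.le]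
    _ ≤ (1 - t) * ((k + 1) * h) + t * ((k + 1) * h) :=
        add_le_add (mul_le_mul_of_nonneg_left h2 (by linarith))
          (mul_le_mul_of_nonneg_left h1 ht.le)
    _ = _ := by ring

end patch

/-! ### Polynomials and the inverse inequality -/

/-- The function on `ℝ^d` defined by a polynomial. -/
def polyFun (p : MvPolynomial (Fin d) ℝ) (x : Space d) : ℝ := MvPolynomial.eval (fun i => x i) p

lemma contDiff_polyFun (p : MvPolynomial (Fin d) ℝ) : ContDiff ℝ ∞ (polyFun p) := by
  unfold polyFun
  induction p using MvPolynomial.induction_on with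
  | C a => simpa using contDiff_const
  | add p q hp hq => simpa using hp.add hq
  | mul_X p i hp =>
    simp only [map_mul, MvPolynomial.eval_X]
    exact hp.mul (by fun_prop)

lemma polyFun_add (p q : MvPolynomial (Fin d) ℝ) : polyFun (p + q) = polyFun p + polyFun q := by
  funext x; simp [polyFun]

lemma polyFun_sub (p q : MvPolynomial (Fin d) ℝ) : polyFun (p - q) = polyFun p - polyFun q := by
  funext x; simp [polyFun]

lemma polyFun_smul (c : ℝ) (p : MvPolynomial (Fin d) ℝ) : polyFun (c • p) = c • polyFun p := by
  funext x; simp [polyFun, MvPolynomial.smul_eval]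

lemma polyFun_C (c : ℝ) : polyFun (MvPolynomial.C c : MvPolynomial (Fin d) ℝ) = fun _ => c := by
  funext x; simp [polyFun]

lemma differentiable_polyFun (p : MvPolynomial (Fin d) ℝ) : Differentiable ℝ (polyFun p) :=
  (contDiff_polyFun p).differentiable (by simp)

lemma eq_zero_of_polyFun_eq_zero {p : MvPolynomial (Fin d) ℝ} {ε : ℝ} (hε : 0 < ε)
    (h : ∀ x ∈ Metric.ball (0 : Space d) ε, polyFun p x = 0) : p = 0 := by
  have hc : ContinuousAt (fun v : Fin d → ℝ => (WithLp.toLp 2 v : Space d)) 0 :=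
    (PiLp.continuous_toLp 2 _).continuousAt
  have hn : (fun v : Fin d → ℝ => (WithLp.toLp 2 v : Space d)) ⁻¹' Metric.ball 0 ε ∈
      𝓝 (0 : Fin d → ℝ) := hc.preimage_mem_nhds (by simpa using Metric.ball_mem_nhds _ hε)
  obtain ⟨δ, hδ, hsub⟩ := Metric.mem_nhds_iff.1 hn
  refine MvPolynomial.funext_set (fun _ : Fin d => Metric.ball (0 : ℝ) δ)
    (fun _ => infinite_of_mem_nhds 0 (Metric.ball_mem_nhds _ hδ)) ?_
  intro v hv
  rw [← ball_pi _ hδ] at hv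
  have := h _ (hsub hv)
  simpa [polyFun] using this

lemma totalDegree_aeval_le {f : Fin d → MvPolynomial (Fin d) ℝ} (hf : ∀ i, (f i).totalDegree ≤ 1)
    (p : MvPolynomial (Fin d) ℝ) : (MvPolynomial.aeval f p).totalDegree ≤ p.totalDegree := by
  rw [MvPolynomial.aeval_def, MvPolynomial.eval₂_eq]
  refine MvPolynomial.totalDegree_finsetSum_le fun m hm => ?_
  refine (MvPolynomial.totalDegree_mul _ _).trans ?_
  rw [MvPolynomial.algebraMap_eq, MvPolynomial.totalDegree_C, zero_add]
  refine (MvPolynomial.totalDegree_finsetProd _ _).trans ?_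
  calc ∑ i ∈ m.support, (f i ^ m i).totalDegree ≤ ∑ i ∈ m.support, m i :=
        Finset.sum_le_sum fun i _ => (MvPolynomial.totalDegree_pow _ _).trans (by
          simpa using Nat.mul_le_mul_left (m i) (hf i))
    _ ≤ p.totalDegree := MvPolynomial.le_totalDegree hm

lemma exists_polyFun_comp_affine (p : MvPolynomial (Fin d) ℝ) (x : Space d) (h : ℝ) :
    ∃ q : MvPolynomial (Fin d) ℝ, q.totalDegree ≤ p.totalDegree ∧
      ∀ y, polyFun q y = polyFun p (x + h • y) := by
  refine ⟨MvPolynomial.aeval (fun i => MvPolynomial.C (x i) + MvPolynomial.C h * MvPolynomial.X i) p,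
    totalDegree_aeval_le (fun i => ?_) p, fun y => ?_⟩
  · refine (MvPolynomial.totalDegree_add _ _).trans (max_le (by simp) ?_)
    refine (MvPolynomial.totalDegree_mul _ _).trans (by simp)
  · unfold polyFun
    rw [MvPolynomial.aeval_def, MvPolynomial.eval_eval₂]
    simp only [MvPolynomial.eval, MvPolynomial.algebraMap_eq]
    congr 1
    · ext a; simp
    · funext i; simp

/-- The map `B ∘ A⁻¹` on the finite-dimensional range of `A` is automatically bounded. This form
avoids choosing a norm on `V`. -/
lemma exists_norm_le_of_injective {V F G : Type*} [AddCommGroup V] [Module ℝ V]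
    [FiniteDimensional ℝ V] [NormedAddCommGroup F] [NormedSpace ℝ F] [NormedAddCommGroup G]
    [NormedSpace ℝ G] (A : V →ₗ[ℝ] F) (hA : Function.Injective A) (B : V →ₗ[ℝ] G) :
    ∃ C : ℝ, 0 ≤ C ∧ ∀ v, ‖B v‖ ≤ C * ‖A v‖ := by
  let e := LinearEquiv.ofInjective A hA
  have : FiniteDimensional ℝ (LinearMap.range A) := e.finiteDimensional
  let L : LinearMap.range A →L[ℝ] G := (B ∘ₗ e.symm.toLinearMap).toContinuousLinearMap
  refine ⟨‖L‖, L.opNorm_nonneg, fun v => ?_⟩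
  have h := L.le_opNorm (e v)
  have h1 : L (e v) = B v := by simp [L]
  rw [h1] at h
  exact h

/-- Equivalence of norms on the polynomials of degree at most `r`. -/
lemma exists_fderiv_polyFun_le (d r : ℕ) {σ : ℝ} (hσ : 0 < σ) :
    ∃ C : ℝ, 0 ≤ C ∧ ∀ p : MvPolynomial (Fin d) ℝ, p.totalDegree ≤ r →
      ∀ y ∈ Metric.closedBall (0 : Space d) 1, ‖fderiv ℝ (polyFun p) y‖ₑ ≤
        ENNReal.ofReal C * eLpNorm (polyFun p) 2 (volume.restrict (Metric.closedBall 0 σ)) := by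
  set K : Set (Space d) := Metric.closedBall 0 1
  have : CompactSpace K := isCompact_iff_compactSpace.1 (isCompact_closedBall _ _)
  set B : Set (Space d) := Metric.closedBall 0 σ
  have : IsFiniteMeasure (volume.restrict B) :=
    ⟨by simpa using (isCompact_closedBall (0 : Space d) σ).measure_lt_top⟩
  have hmem : ∀ p : MvPolynomial (Fin d) ℝ, MemLp (polyFun p) 2 (volume.restrict B) := fun p => by
    obtain ⟨M, hM⟩ := (isCompact_closedBall (0 : Space d) σ).exists_bound_of_continuousOn
      (contDiff_polyFun p).continuous.continuousOn
    exact MemLp.of_bound (contDiff_polyFun p).continuous.aestronglyMeasurable M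
      ((ae_restrict_mem measurableSet_closedBall).mono hM)
  let V := MvPolynomial.restrictTotalDegree (Fin d) ℝ r
  let A : V →ₗ[ℝ] Lp ℝ 2 (volume.restrict B) :=
    { toFun := fun p => (hmem p).toLp _
      map_add' := fun p q => by
        rw [← MemLp.toLp_add]; congr 1; exact polyFun_add _ _
      map_smul' := fun c p => by
        rw [RingHom.id_apply, ← MemLp.toLp_const_smul]; congr 1; exact polyFun_smul _ _ }
  let D : V →ₗ[ℝ] C(K, Space d →L[ℝ] ℝ) :=
    { toFun := fun p => ⟨fun x => fderiv ℝ (polyFun p) x,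
        ((contDiff_polyFun p.1).continuous_fderiv (by simp)).comp continuous_subtype_val⟩
      map_add' := fun p q => by
        ext1 x
        simp only [ContinuousMap.coe_mk, ContinuousMap.add_apply, Submodule.coe_add, polyFun_add]
        exact fderiv_add (differentiable_polyFun _ _) (differentiable_polyFun _ _)
      map_smul' := fun c p => by
        ext1 x
        simp only [ContinuousMap.coe_mk, ContinuousMap.smul_apply, Submodule.coe_smul,
          polyFun_smul, RingHom.id_apply]
        exact fderiv_const_smul (differentiable_polyFun _ _) c }
  -- A polynomial that vanishes almost everywhere on a ball vanishes there by continuity, hence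
  -- identically.
  have hA : Function.Injective A := by
    rw [injective_iff_map_eq_zero]
    rintro ⟨p, hp⟩ h0
    have h1 : polyFun p =ᵐ[volume.restrict B] 0 := by
      have h2 : (hmem p).toLp _ = 0 := h0
      have h3 := MemLp.coeFn_toLp (hmem p)
      rw [h2] at h3
      exact h3.symm.trans (Lp.coeFn_zero _ _ _)
    have h4 : polyFun p =ᵐ[volume.restrict (Metric.ball (0 : Space d) σ)] 0 :=
      ae_restrict_of_ae_restrict_of_subset Metric.ball_subset_closedBall h1
    have h5 : EqOn (polyFun p) 0 (Metric.ball (0 : Space d) σ) :=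
      Measure.eqOn_open_of_ae_eq h4 Metric.isOpen_ball (contDiff_polyFun p).continuous.continuousOn
        continuousOn_const
    have := eq_zero_of_polyFun_eq_zero hσ h5
    simpa using this
  obtain ⟨C, hC, h⟩ := exists_norm_le_of_injective (G := C(K, Space d →L[ℝ] ℝ)) A hA D
  refine ⟨C, hC, fun p hp y hy => ?_⟩
  have h1 := h ⟨p, (MvPolynomial.mem_restrictTotalDegree _ _ _).2 hp⟩
  have h2 := (ContinuousMap.norm_coe_le_norm (D ⟨p, _⟩) ⟨y, hy⟩).trans h1
  have h3 : ‖A ⟨p, (MvPolynomial.mem_restrictTotalDegree _ _ _).2 hp⟩‖ =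
      (eLpNorm (polyFun p) 2 (volume.restrict B)).toReal := Lp.norm_toLp _ (hmem p)
  rw [h3] at h2
  rw [← ofReal_norm, ← ENNReal.ofReal_toReal (hmem p).2.ne, ← ENNReal.ofReal_mul hC]
  exact ENNReal.ofReal_le_ofReal h2

lemma eLpNorm_two_sq {X F : Type*} [MeasurableSpace X] [NormedAddCommGroup F] {μ : Measure X}
    (u : X → F) : eLpNorm u 2 μ ^ 2 = ∫⁻ x, ‖u x‖ₑ ^ 2 ∂μ := by
  rw [eLpNorm_eq_lintegral_rpow_enorm_toReal (by norm_num) (by norm_num), ← ENNReal.rpow_two,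
    ← ENNReal.rpow_mul]
  simp

/-- The inverse inequality on sets of size `h`. -/
theorem exists_inverse_inequality (d r : ℕ) {σ : ℝ} (hσ : 0 < σ) :
    ∃ C : ENNReal, C ≠ ⊤ ∧ ∀ p : MvPolynomial (Fin d) ℝ, p.totalDegree ≤ r → ∀ (x : Space d)
      (h : ℝ), 0 < h → ∀ s : Set (Space d), MeasurableSet s → Metric.closedBall x (σ * h) ⊆ s →
        s ⊆ Metric.closedBall x h →
        ∫⁻ y in s, ‖fderiv ℝ (polyFun p) y‖ₑ ^ 2 ≤
          C * ENNReal.ofReal (h⁻¹ ^ 2) * ∫⁻ y in s, ‖polyFun p y‖ₑ ^ 2 := by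
  obtain ⟨C, hC, hle⟩ := exists_fderiv_polyFun_le d r hσ
  refine ⟨ENNReal.ofReal (C ^ 2) * volume (Metric.closedBall (0 : Space d) 1),
    ENNReal.mul_ne_top ENNReal.ofReal_ne_top (isCompact_closedBall _ _).measure_lt_top.ne, ?_⟩
  intro p hp x h hh s hs hsub hsub'
  -- Rescaling to unit size keeps the degree, so one constant serves all sets. The factor `h^(-d)`
  -- from the change of variables in the norm of `q` cancels against the volume of `s`, leaving the
  -- `h^(-2)` from the derivative.
  obtain ⟨q, hq, hqe⟩ := exists_polyFun_comp_affine p x h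
  have hqf : polyFun q = fun y => polyFun p (x + h • y) := funext hqe
  set I := ∫⁻ y in s, ‖polyFun p y‖ₑ ^ 2
  have hI : eLpNorm (polyFun q) 2 (volume.restrict (Metric.closedBall 0 σ)) ^ 2 ≤
      ENNReal.ofReal ((h ^ d)⁻¹) * I := by
    rw [eLpNorm_two_sq]
    calc ∫⁻ y in Metric.closedBall 0 σ, ‖polyFun q y‖ₑ ^ 2
        = ∫⁻ y, (Metric.closedBall (0 : Space d) σ).indicator (fun y => ‖polyFun q y‖ₑ ^ 2) y :=
          (lintegral_indicator measurableSet_closedBall _).symm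
      _ ≤ ∫⁻ y, s.indicator (fun y => ‖polyFun p y‖ₑ ^ 2) (x + h • y) := by
          refine lintegral_mono fun y => ?_
          by_cases hy : y ∈ Metric.closedBall (0 : Space d) σ
          · have hm : x + h • y ∈ s := hsub (by
              rw [mem_closedBall_zero_iff] at hy
              rw [mem_closedBall_iff_norm, add_sub_cancel_left, norm_smul,
                Real.norm_of_nonneg hh.le, mul_comm]
              gcongr)
            rw [indicator_of_mem hy, indicator_of_mem hm, hqe]
          · rw [indicator_of_notMem hy]; exact zero_le
      _ = _ := by
          rw [lintegral_comp_add_smul _ _ hh, lintegral_indicator hs]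
          exact ((contDiff_polyFun p).continuous.enorm.measurable.pow_const 2).indicator hs
  have hpt : ∀ y ∈ s, ‖fderiv ℝ (polyFun p) y‖ₑ ^ 2 ≤
      ENNReal.ofReal (h⁻¹ ^ 2) * (ENNReal.ofReal (C ^ 2) * (ENNReal.ofReal ((h ^ d)⁻¹) * I)) := by
    intro y hy
    set w : Space d := h⁻¹ • (y - x) with hw
    have hwy : x + h • w = y := by
      rw [hw, smul_smul, mul_inv_cancel₀ hh.ne', one_smul, add_sub_cancel]
    have hw1 : w ∈ Metric.closedBall (0 : Space d) 1 := by
      have := mem_closedBall_iff_norm.1 (hsub' hy)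
      rw [mem_closedBall_zero_iff, hw, norm_smul, norm_inv, Real.norm_of_nonneg hh.le]
      rw [inv_mul_le_iff₀ hh]; linarith
    have hd : fderiv ℝ (polyFun q) w = h • fderiv ℝ (polyFun p) y := by
      have h1 : HasFDerivAt (fun w : Space d => x + h • w) (h • ContinuousLinearMap.id ℝ (Space d)) w :=
        ((hasFDerivAt_id w).const_smul h).const_add x
      have h2 := (differentiable_polyFun p (x + h • w)).hasFDerivAt.comp w h1
      rw [hqf]
      rw [ContinuousLinearMap.comp_smul, ContinuousLinearMap.comp_id, hwy] at h2
      exact h2.fderiv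
    have h3 : fderiv ℝ (polyFun p) y = h⁻¹ • fderiv ℝ (polyFun q) w := by
      rw [hd, smul_smul, inv_mul_cancel₀ hh.ne', one_smul]
    have h4 := hle q (hq.trans hp) w hw1
    rw [h3, enorm_smul, mul_pow, Real.enorm_eq_ofReal (by positivity),
      ← ENNReal.ofReal_pow (by positivity)]
    gcongr
    calc ‖fderiv ℝ (polyFun q) w‖ₑ ^ 2 ≤ (ENNReal.ofReal C *
          eLpNorm (polyFun q) 2 (volume.restrict (Metric.closedBall 0 σ))) ^ 2 := by gcongr
      _ ≤ _ := by
          rw [mul_pow, ← ENNReal.ofReal_pow hC]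
          gcongr
  have hvol : volume s ≤ ENNReal.ofReal (h ^ d) * volume (Metric.closedBall (0 : Space d) 1) := by
    refine (measure_mono hsub').trans (le_of_eq ?_)
    rw [Measure.addHaar_closedBall _ _ hh.le, finrank_euclideanSpace, Fintype.card_fin,
      Measure.addHaar_closedBall volume (0 : Space d) zero_le_one]
    simp
  calc ∫⁻ y in s, ‖fderiv ℝ (polyFun p) y‖ₑ ^ 2
      ≤ ∫⁻ y in s, ENNReal.ofReal (h⁻¹ ^ 2) *
          (ENNReal.ofReal (C ^ 2) * (ENNReal.ofReal ((h ^ d)⁻¹) * I)) := setLIntegral_mono' hs hpt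
    _ = ENNReal.ofReal (h⁻¹ ^ 2) *
          (ENNReal.ofReal (C ^ 2) * (ENNReal.ofReal ((h ^ d)⁻¹) * I)) * volume s :=
        setLIntegral_const _ _
    _ ≤ ENNReal.ofReal (h⁻¹ ^ 2) * (ENNReal.ofReal (C ^ 2) * (ENNReal.ofReal ((h ^ d)⁻¹) * I)) *
          (ENNReal.ofReal (h ^ d) * volume (Metric.closedBall (0 : Space d) 1)) := by gcongr
    _ = (ENNReal.ofReal ((h ^ d)⁻¹) * ENNReal.ofReal (h ^ d)) * (ENNReal.ofReal (C ^ 2) *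
          volume (Metric.closedBall (0 : Space d) 1) * ENNReal.ofReal (h⁻¹ ^ 2) * I) := by ring
    _ = _ := by
        rw [← ENNReal.ofReal_mul (by positivity), inv_mul_cancel₀ (by positivity)]; simp

/-! ### Geometry of triangulations -/

lemma norm_gradient (u : Space d → ℝ) (x : Space d) : ‖gradient u x‖ = ‖fderiv ℝ u x‖ :=
  LinearIsometryEquiv.norm_map _ _

lemma enorm_gradient (u : Space d → ℝ) (x : Space d) : ‖gradient u x‖ₑ = ‖fderiv ℝ u x‖ₑ := by
  rw [← ofReal_norm, ← ofReal_norm, norm_gradient]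

namespace Triangulation

variable {Ω : Set (Space d)} (T : Triangulation Ω)

/-- The closed simplex spanned by a vertex set. -/
abbrev hull (s : Finset (Space d)) : Set (Space d) := convexHull ℝ (s : Set (Space d))

lemma finite_cells : T.cells.Finite := T.finite.subset fun _ hs => hs.1

/-- The finite set of the elements. -/
def cellFinset : Finset (Finset (Space d)) := T.finite_cells.toFinset

lemma mem_cellFinset {s : Finset (Space d)} : s ∈ T.cellFinset ↔ s ∈ T.cells :=
  T.finite_cells.mem_toFinset

lemma closure_eq : closure Ω = ⋃ s ∈ T.cellFinset, hull s := by
  rw [← T.space_eq]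
  apply subset_antisymm
  · intro x hx
    obtain ⟨s, hs, hxs⟩ := Geometry.SimplicialComplex.mem_space_iff.1 hx
    obtain ⟨t, ht, hst, hcard⟩ := T.pure s hs
    exact mem_biUnion (T.mem_cellFinset.2 ⟨ht, hcard⟩)
      (convexHull_mono (Finset.coe_subset.2 hst) hxs)
  · exact iUnion₂_subset fun s hs =>
      Geometry.SimplicialComplex.convexHull_subset_space (T.mem_cellFinset.1 hs).1

lemma hull_subset {s : Finset (Space d)} (hs : s ∈ T.cells) : hull s ⊆ closure Ω := by
  rw [T.closure_eq]
  exact subset_biUnion_of_mem (u := fun s : Finset (Space d) => hull s) (T.mem_cellFinset.2 hs)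

lemma isCompact_hull (s : Finset (Space d)) : IsCompact (hull s) :=
  s.finite_toSet.isCompact_convexHull ℝ

lemma isClosed_hull (s : Finset (Space d)) : IsClosed (hull s) := (isCompact_hull s).isClosed

/-- Two distinct cells meet inside the hull of their common vertices. These are fewer than `d + 1`
affinely independent points, so they span a proper affine subspace. -/
lemma volume_hull_inter {s t : Finset (Space d)} (hs : s ∈ T.cells) (ht : t ∈ T.cells)
    (hst : s ≠ t) : volume (hull s ∩ hull t) = 0 := by
  classical
  refine measure_mono_null (T.complex.inter_subset_convexHull hs.1 ht.1) ?_
  refine measure_mono_null (convexHull_subset_affineSpan _) (Measure.addHaar_affineSubspace _ _ ?_)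
  intro htop
  have hind : AffineIndependent ℝ ((↑) : ((s : Set (Space d)) ∩ t : Set (Space d)) → Space d) :=
    (T.complex.indep hs.1).mono (s := (s : Set (Space d)) ∩ t) (t := (s : Set (Space d)))
      inter_subset_left
  have hfin : ((s : Set (Space d)) ∩ t).Finite := s.finite_toSet.subset inter_subset_left
  have : Fintype ((s : Set (Space d)) ∩ t : Set (Space d)) := hfin.fintype
  have h1 := hind.affineSpan_eq_top_iff_card_eq_finrank_add_one.1 (by rwa [Subtype.range_coe])
  rw [finrank_euclideanSpace, Fintype.card_fin] at h1
  have h2 : (s ∩ t).card = d + 1 := by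
    rw [← h1, ← Set.toFinset_card]
    congr 1; ext x; simp
  have h3 : s ∩ t = s := Finset.eq_of_subset_of_card_le Finset.inter_subset_left (by rw [h2, hs.2])
  have h4 : s ∩ t = t := Finset.eq_of_subset_of_card_le Finset.inter_subset_right (by rw [h2, ht.2])
  exact hst (h3.symm.trans h4)

lemma disjoint_interior_hull {s t : Finset (Space d)} (hs : s ∈ T.cells) (ht : t ∈ T.cells)
    (hst : s ≠ t) : Disjoint (interior (hull s)) (interior (hull t)) := by
  rw [Set.disjoint_iff_inter_eq_empty]
  refine (isOpen_interior.inter isOpen_interior).eq_empty_of_measure_zero (μ := volume) ?_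
  exact measure_mono_null (inter_subset_inter interior_subset interior_subset)
    (T.volume_hull_inter hs ht hst)

lemma interior_hull_ae_eq (s : Finset (Space d)) : interior (hull s) =ᵐ[volume] hull s :=
  interior_ae_eq_of_null_frontier ((convex_convexHull ℝ _).addHaar_frontier volume)

lemma iUnion_interior_ae_eq (hΩ : volume (frontier Ω) = 0) :
    (⋃ s ∈ T.cellFinset, interior (hull s)) =ᵐ[volume] Ω := by
  have h1 : (⋃ s ∈ T.cellFinset, interior (hull s)) =ᵐ[volume] closure Ω := by
    rw [T.closure_eq]
    exact Filter.EventuallyEq.countable_bUnion T.cellFinset.countable_toSet fun s _ => interior_hull_ae_eq s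
  exact h1.trans (closure_ae_eq_of_null_frontier hΩ)

lemma lintegral_eq_sum (hΩ : volume (frontier Ω) = 0) (F : Space d → ENNReal) :
    ∫⁻ x in Ω, F x = ∑ s ∈ T.cellFinset, ∫⁻ x in interior (hull s), F x := by
  rw [← setLIntegral_congr (T.iUnion_interior_ae_eq hΩ), lintegral_biUnion_finset]
  · intro s hs t ht hst
    exact T.disjoint_interior_hull (T.mem_cellFinset.1 hs) (T.mem_cellFinset.1 ht) hst
  · exact fun s _ => isOpen_interior.measurableSet

lemma ae_exists_mem_interior (hΩ : volume (frontier Ω) = 0) :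
    ∀ᵐ x ∂(volume.restrict Ω), ∃ s ∈ T.cells, x ∈ interior (hull s) := by
  rw [← Measure.restrict_congr_set (T.iUnion_interior_ae_eq hΩ)]
  filter_upwards [ae_restrict_mem (Finset.measurableSet_biUnion _
    fun s _ => isOpen_interior.measurableSet)] with x hx
  simp only [mem_iUnion, exists_prop] at hx
  obtain ⟨s, hs, hxs⟩ := hx
  exact ⟨s, T.mem_cellFinset.1 hs, hxs⟩

lemma diam_hull_le {s : Finset (Space d)} (hs : s ∈ T.cells) : Metric.diam (hull s) ≤ T.meshSize :=
  le_csSup (T.finite_cells.image _).bddAbove (mem_image_of_mem _ hs)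

lemma norm_sub_le {s : Finset (Space d)} (hs : s ∈ T.cells) {x y : Space d} (hx : x ∈ hull s)
    (hy : y ∈ hull s) : ‖x - y‖ ≤ T.meshSize := by
  rw [← dist_eq_norm]
  exact (Metric.dist_le_diam_of_mem (isCompact_hull s).isBounded hx hy).trans (T.diam_hull_le hs)

lemma meshSize_pos (hd : 1 ≤ d) {s : Finset (Space d)} (hs : s ∈ T.cells) : 0 < T.meshSize := by
  obtain ⟨x, hx, y, hy, hxy⟩ := Finset.one_lt_card.1 (show 1 < s.card by rw [hs.2]; omega)
  exact (norm_pos_iff.2 (sub_ne_zero.2 hxy)).trans_le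
    (T.norm_sub_le hs (subset_convexHull ℝ _ hx) (subset_convexHull ℝ _ hy))

/-- A point of each element about which the element contains a ball of radius `σ h`. -/
lemma QuasiUniform.exists_centers {T : Triangulation Ω} (hd : 1 ≤ d) {σ : ℝ} (hσ : 0 < σ)
    (hT : T.QuasiUniform σ) :
    ∃ c : Finset (Space d) → Space d, ∀ s ∈ T.cells,
      Metric.closedBall (c s) (σ * T.meshSize) ⊆ hull s ∧
        hull s ⊆ Metric.closedBall (c s) T.meshSize := by
  choose! c hc using hT
  refine ⟨c, fun s hs => ⟨hc s hs, fun x hx => ?_⟩⟩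
  have hpos := T.meshSize_pos hd hs
  have hcs : c s ∈ hull s := hc s hs (Metric.mem_closedBall_self (by positivity))
  rw [mem_closedBall_iff_norm]
  exact T.norm_sub_le hs hx hcs

lemma volume_closedBall_eq (x : Space d) {r : ℝ} (hr : 0 ≤ r) :
    volume (Metric.closedBall x r) = ENNReal.ofReal (r ^ d) * volume (Metric.ball (0 : Space d) 1) := by
  rw [Measure.addHaar_closedBall _ _ hr, finrank_euclideanSpace, Fintype.card_fin]

lemma volume_unitBall_ne_zero : volume (Metric.ball (0 : Space d) 1) ≠ 0 :=
  (Metric.measure_ball_pos volume _ one_pos).ne'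

lemma volume_unitBall_ne_top : volume (Metric.ball (0 : Space d) 1) ≠ ⊤ :=
  Metric.isBounded_ball.measure_lt_top.ne

/-- Balls of radius comparable to `h` about the elements overlap boundedly often. -/
lemma sum_indicator_ball_le {c : Finset (Space d) → Space d} {σ R h : ℝ} (hσ : 0 < σ) (hR : 0 ≤ R)
    (hh : 0 < h) (hc : ∀ s ∈ T.cells, Metric.closedBall (c s) (σ * h) ⊆ hull s) (x : Space d) :
    ∑ s ∈ T.cellFinset, (Metric.closedBall (c s) (R * h)).indicator (1 : Space d → ENNReal) x ≤
      ENNReal.ofReal (((R + σ) / σ) ^ d) := by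
  classical
  set S := T.cellFinset.filter fun s => x ∈ Metric.closedBall (c s) (R * h) with hS
  have h1 : ∑ s ∈ T.cellFinset, (Metric.closedBall (c s) (R * h)).indicator
      (1 : Space d → ENNReal) x = (S.card : ENNReal) := by
    rw [hS, Finset.card_filter]
    push_cast
    refine Finset.sum_congr rfl fun s _ => ?_
    by_cases hx : x ∈ Metric.closedBall (c s) (R * h) <;> simp [hx]
  set B := volume (Metric.ball (0 : Space d) 1)
  have hball : ∀ s ∈ S, volume (Metric.ball (c s) (σ * h)) = ENNReal.ofReal ((σ * h) ^ d) * B := by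
    intro s _
    rw [Measure.addHaar_ball_of_pos _ _ (by positivity), finrank_euclideanSpace, Fintype.card_fin]
  -- A packing argument: the balls of radius `σ h` inside distinct cells are disjoint, and those
  -- counted all lie in the ball of radius `(R + σ) h` about `x`.
  have hdisj : (S : Set (Finset (Space d))).PairwiseDisjoint
      fun s => Metric.ball (c s) (σ * h) := by
    intro s hs t ht hst
    have hs' := T.mem_cellFinset.1 (Finset.mem_filter.1 hs).1
    have ht' := T.mem_cellFinset.1 (Finset.mem_filter.1 ht).1
    exact (T.disjoint_interior_hull hs' ht' hst).mono
      (interior_maximal (Metric.ball_subset_closedBall.trans (hc s hs')) Metric.isOpen_ball)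
      (interior_maximal (Metric.ball_subset_closedBall.trans (hc t ht')) Metric.isOpen_ball)
  have hsum : (S.card : ENNReal) * (ENNReal.ofReal ((σ * h) ^ d) * B) ≤
      ENNReal.ofReal (((R + σ) * h) ^ d) * B := by
    calc (S.card : ENNReal) * (ENNReal.ofReal ((σ * h) ^ d) * B)
        = ∑ s ∈ S, volume (Metric.ball (c s) (σ * h)) := by
          rw [Finset.sum_congr rfl hball, Finset.sum_const, nsmul_eq_mul]
      _ = volume (⋃ s ∈ S, Metric.ball (c s) (σ * h)) :=
          (measure_biUnion_finset hdisj fun s _ => measurableSet_ball).symm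
      _ ≤ volume (Metric.closedBall x ((R + σ) * h)) := by
          refine measure_mono (iUnion₂_subset fun s hs y hy => ?_)
          have hx := (Finset.mem_filter.1 hs).2
          rw [Metric.mem_closedBall] at *
          rw [Metric.mem_ball] at hy
          rw [dist_comm x] at hx
          linarith [dist_triangle y (c s) x]
      _ = _ := volume_closedBall_eq x (by positivity)
  rw [h1]
  have hB0 : B ≠ 0 := volume_unitBall_ne_zero
  have hB1 : B ≠ ⊤ := volume_unitBall_ne_top
  rw [← mul_assoc, ENNReal.mul_le_mul_iff_left hB0 hB1] at hsum
  have hp : 0 < (σ * h) ^ d := by positivity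
  rw [← ENNReal.le_div_iff_mul_le (Or.inl (by simpa using hp)) (Or.inl ENNReal.ofReal_ne_top),
    ← ENNReal.ofReal_div_of_pos hp, ← div_pow, mul_div_mul_right _ _ hh.ne'] at hsum
  exact hsum

lemma sum_lintegral_ball_le {c : Finset (Space d) → Space d} {σ R h : ℝ} (hσ : 0 < σ) (hR : 0 ≤ R)
    (hh : 0 < h) (hc : ∀ s ∈ T.cells, Metric.closedBall (c s) (σ * h) ⊆ hull s)
    {F : Space d → ENNReal} (hF : AEMeasurable F (volume.restrict Ω)) :
    ∑ s ∈ T.cellFinset, ∫⁻ x in Metric.closedBall (c s) (R * h) ∩ Ω, F x ≤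
      ENNReal.ofReal (((R + σ) / σ) ^ d) * ∫⁻ x in Ω, F x := by
  have e : ∀ s, ∫⁻ x in Metric.closedBall (c s) (R * h) ∩ Ω, F x =
      ∫⁻ x in Ω, (Metric.closedBall (c s) (R * h)).indicator (1 : Space d → ENNReal) x * F x := by
    intro s
    rw [← Measure.restrict_restrict measurableSet_closedBall,
      ← lintegral_indicator measurableSet_closedBall]
    congr 1; funext x
    by_cases hx : x ∈ Metric.closedBall (c s) (R * h) <;> simp [hx]
  simp_rw [e]
  have hm : ∀ s ∈ T.cellFinset, AEMeasurable (fun x =>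
      (Metric.closedBall (c s) (R * h)).indicator (1 : Space d → ENNReal) x * F x)
      (volume.restrict Ω) := fun s _ =>
    (measurable_one.indicator measurableSet_closedBall).aemeasurable.mul hF
  rw [← lintegral_finsetSum' _ hm, ← lintegral_const_mul' _ _ ENNReal.ofReal_ne_top]
  refine lintegral_mono fun x => ?_
  simp only [← Finset.sum_mul]
  gcongr
  exact T.sum_indicator_ball_le hσ hR hh hc x

/-! ### Finite element functions -/

variable {T} {r : ℕ} {v w : Space d → ℝ}

lemma W.exists_poly (hv : v ∈ T.W r) {s : Finset (Space d)} (hs : s ∈ T.cells) :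
    ∃ p : MvPolynomial (Fin d) ℝ, p.totalDegree ≤ r ∧ EqOn v (polyFun p) (hull s) := hv.2 s hs

lemma W.sub_mem (hv : v ∈ T.W r) (hw : w ∈ T.W r) : (fun x => v x - w x) ∈ T.W r := by
  refine ⟨hv.1.sub hw.1, fun s hs => ?_⟩
  obtain ⟨p, hp, hvp⟩ := hv.2 s hs
  obtain ⟨q, hq, hwq⟩ := hw.2 s hs
  exact ⟨p - q, (MvPolynomial.totalDegree_sub _ _).trans (max_le hp hq), fun x hx => by
    simp [hvp x hx, hwq x hx]⟩

lemma W.zero_mem : (fun _ => 0) ∈ T.W r :=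
  ⟨continuousOn_const, fun _ _ => ⟨0, by simp, fun x _ => by simp⟩⟩

lemma W₀.zero_mem : (fun _ => 0) ∈ T.W₀ r := ⟨W.zero_mem, fun _ _ => rfl⟩

lemma W.memLp (hΩ : IsOpen Ω) (hb : Bornology.IsBounded Ω) (hv : v ∈ T.W r) (p : ENNReal) :
    MemLp v p (volume.restrict Ω) := by
  have hK : IsCompact (closure Ω) := hb.isCompact_closure
  obtain ⟨M, hM⟩ := hK.exists_bound_of_continuousOn hv.1
  have : IsFiniteMeasure (volume.restrict Ω) := ⟨by simpa using hb.measure_lt_top⟩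
  exact MemLp.of_bound ((hv.1.mono subset_closure).aestronglyMeasurable hΩ.measurableSet) M
    ((ae_restrict_mem hΩ.measurableSet).mono fun x hx => hM x (subset_closure hx))

lemma eventuallyEq_of_eqOn {s : Set (Space d)} {x : Space d} {p : Space d → ℝ}
    (h : EqOn v p s) (hx : x ∈ interior s) : v =ᶠ[𝓝 x] p :=
  (eventually_mem_nhds_iff.2 (mem_interior_iff_mem_nhds.1 hx)).mono fun _ hy =>
    h (mem_of_mem_nhds hy)

lemma W.ae_differentiableAt (hΩ : volume (frontier Ω) = 0) (hv : v ∈ T.W r) :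
    ∀ᵐ x ∂(volume.restrict Ω), DifferentiableAt ℝ v x := by
  filter_upwards [T.ae_exists_mem_interior hΩ] with x hx
  obtain ⟨s, hs, hxs⟩ := hx
  obtain ⟨p, -, hp⟩ := W.exists_poly hv hs
  exact ((differentiable_polyFun p) x).congr_of_eventuallyEq (eventuallyEq_of_eqOn hp hxs)

lemma W.exists_norm_gradient_le (hv : v ∈ T.W r) :
    ∃ M : ℝ, ∀ s ∈ T.cells, ∀ x ∈ interior (hull s), ‖gradient v x‖ ≤ M := by
  have h1 : ∀ s ∈ T.cells, ∃ M : ℝ, ∀ x ∈ interior (hull s), ‖gradient v x‖ ≤ M := by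
    intro s hs
    obtain ⟨p, -, hp⟩ := W.exists_poly hv hs
    obtain ⟨M, hM⟩ := (isCompact_hull s).exists_bound_of_continuousOn
      ((contDiff_polyFun p).continuous_fderiv (by simp)).continuousOn
    refine ⟨M, fun x hx => ?_⟩
    rw [norm_gradient, (eventuallyEq_of_eqOn hp hx).fderiv_eq]
    exact hM x (interior_subset hx)
  choose! M hM using h1
  obtain ⟨B, hB⟩ := (T.finite_cells.image M).bddAbove
  exact ⟨B, fun s hs x hx => (hM s hs x hx).trans (hB (mem_image_of_mem M hs))⟩

lemma measurable_gradient (u : Space d → ℝ) : Measurable (gradient u) :=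
  (InnerProductSpace.toDual ℝ (Space d)).symm.continuous.measurable.comp (measurable_fderiv ℝ u)

lemma W.memLp_gradient (hΩ : volume (frontier Ω) = 0) (hb : Bornology.IsBounded Ω)
    (hv : v ∈ T.W r) (p : ENNReal) : MemLp (gradient v) p (volume.restrict Ω) := by
  have : IsFiniteMeasure (volume.restrict Ω) := ⟨by simpa using hb.measure_lt_top⟩
  obtain ⟨M, hM⟩ := W.exists_norm_gradient_le hv
  refine MemLp.of_bound (measurable_gradient v).aestronglyMeasurable M ?_
  filter_upwards [T.ae_exists_mem_interior hΩ] with x hx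
  obtain ⟨s, hs, hxs⟩ := hx
  exact hM s hs x hxs

/-! ### Interpolation by piecewise affine functions -/

lemma exists_affine_interpolant {s : Finset (Space d)} (hs : s ∈ T.cells) (m : Space d → ℝ) :
    ∃ A : Space d →ᵃ[ℝ] ℝ, ∀ z ∈ s, A z = m z := by
  have hind := T.complex.indep hs.1
  have htop : affineSpan ℝ (range ((↑) : s → Space d)) = ⊤ :=
    hind.affineSpan_eq_top_iff_card_eq_finrank_add_one.2 (by simp [hs.2])
  let b : AffineBasis s ℝ (Space d) := ⟨(↑), hind, htop⟩
  let L : (s → ℝ) →ₗ[ℝ] ℝ := ∑ i : s, m i • LinearMap.proj i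
  refine ⟨L.toAffineMap.comp b.coords, fun z hz => ?_⟩
  have h : ∀ i : s, b.coord i z = if i = ⟨z, hz⟩ then 1 else 0 := fun i =>
    b.coord_apply i ⟨z, hz⟩
  simp [L, h]

lemma exists_poly_of_affine (A : Space d →ᵃ[ℝ] ℝ) :
    ∃ p : MvPolynomial (Fin d) ℝ, p.totalDegree ≤ 1 ∧ ∀ x, polyFun p x = A x := by
  refine ⟨MvPolynomial.C (A 0) + ∑ i, MvPolynomial.C (A.linear (EuclideanSpace.single i 1)) *
    MvPolynomial.X i, ?_, fun x => ?_⟩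
  · refine (MvPolynomial.totalDegree_add _ _).trans (max_le (by simp) ?_)
    refine MvPolynomial.totalDegree_finsetSum_le fun i _ => ?_
    exact (MvPolynomial.totalDegree_mul _ _).trans (by simp)
  · have h1 : A x = A.linear x + A 0 := congrFun (AffineMap.decomp A) x
    have h2 : x = ∑ i, x i • (EuclideanSpace.single i (1 : ℝ) : Space d) := by
      ext j; simp [Pi.single_apply]
    rw [h1]
    conv_rhs => rw [h2, map_sum]
    simp [polyFun, mul_comm, add_comm]

/-- The affine interpolants on two cells agree at the common vertices, hence on the hull of these,
which contains the intersection of the cells. Being consistent on finitely many closed sets, they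
glue to a continuous function. -/
theorem exists_interpolant (hr : 1 ≤ r) (m : Space d → ℝ) :
    ∃ v ∈ T.W r, ∀ s ∈ T.cells, ∃ A : Space d →ᵃ[ℝ] ℝ, (∀ z ∈ s, A z = m z) ∧
      ∀ x ∈ hull s, v x = A x := by
  classical
  have hex : ∀ s ∈ T.cells, ∃ A : Space d →ᵃ[ℝ] ℝ, ∀ z ∈ s, A z = m z := fun s hs =>
    exists_affine_interpolant hs m
  choose! A hA using hex
  have hcons : ∀ s ∈ T.cells, ∀ t ∈ T.cells, ∀ x ∈ hull s, x ∈ hull t → A s x = A t x := by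
    intro s hs t ht x hxs hxt
    have hx := T.complex.inter_subset_convexHull hs.1 ht.1 ⟨hxs, hxt⟩
    have hconv : Convex ℝ {x | (A s - A t) x = 0} := by
      have := (convex_singleton (𝕜 := ℝ) (0 : ℝ)).affine_preimage (A s - A t)
      exact this
    have hmin := convexHull_min (s := (s : Set (Space d)) ∩ t) (t := {x | (A s - A t) x = 0})
      (fun z hz => by
        change (A s - A t) z = 0
        rw [AffineMap.coe_sub, Pi.sub_apply, hA s hs z hz.1, hA t ht z hz.2, sub_self]) hconv hx
    have h0 : (A s - A t) x = 0 := hmin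
    rw [AffineMap.coe_sub, Pi.sub_apply] at h0
    linarith
  set v : Space d → ℝ := fun x =>
    if h : ∃ s ∈ T.cells, x ∈ hull s then A h.choose x else 0 with hv
  have hvA : ∀ s ∈ T.cells, ∀ x ∈ hull s, v x = A s x := by
    intro s hs x hx
    have h : ∃ s ∈ T.cells, x ∈ hull s := ⟨s, hs, hx⟩
    simp only [hv, dif_pos h]
    exact hcons _ h.choose_spec.1 s hs x h.choose_spec.2 hx
  refine ⟨v, ⟨?_, fun s hs => ?_⟩, fun s hs => ⟨A s, hA s hs, hvA s hs⟩⟩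
  · rw [T.closure_eq]
    have hlf : LocallyFinite fun s : T.cellFinset => hull (s : Finset (Space d)) :=
      locallyFinite_of_finite _
    have := hlf.continuousOn_iUnion (g := v) (fun s => isClosed_hull _) fun s => by
      have hs := T.mem_cellFinset.1 s.2
      exact (AffineMap.continuous_of_finiteDimensional (A s)).continuousOn.congr
        fun x hx => hvA _ hs x hx
    rwa [iUnion_subtype] at this
  · obtain ⟨p, hp, hpA⟩ := exists_poly_of_affine (A s)
    exact ⟨p, hp.trans hr, fun x hx => (hvA s hs x hx).trans (hpA x).symm⟩

end Triangulation

/-! ### Stability of the projection in `H¹` -/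

lemma enorm_add_sq_le {F : Type*} [NormedAddCommGroup F] (a b : F) :
    ‖a + b‖ₑ ^ 2 ≤ 2 * ‖a‖ₑ ^ 2 + 2 * ‖b‖ₑ ^ 2 := by
  have h : ‖a + b‖ ^ 2 ≤ 2 * ‖a‖ ^ 2 + 2 * ‖b‖ ^ 2 := by
    nlinarith [norm_add_le a b, norm_nonneg (a + b), sq_nonneg (‖a‖ - ‖b‖)]
  have h2 := ENNReal.ofReal_le_ofReal h
  rwa [ENNReal.ofReal_add (by positivity) (by positivity), ENNReal.ofReal_mul (by norm_num),
    ENNReal.ofReal_mul (by norm_num), ENNReal.ofReal_pow (norm_nonneg _),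
    ENNReal.ofReal_pow (norm_nonneg _), ENNReal.ofReal_pow (norm_nonneg _), ofReal_norm,
    ofReal_norm, ofReal_norm, ENNReal.ofReal_ofNat] at h2

lemma lintegral_enorm_sq_eq {X : Type*} [MeasurableSpace X] {μ : Measure X} {u : X → ℝ}
    (hu : MemLp u 2 μ) : ∫⁻ x, ‖u x‖ₑ ^ 2 ∂μ = ENNReal.ofReal (∫ x, u x ^ 2 ∂μ) := by
  rw [ofReal_integral_eq_lintegral_ofReal hu.integrable_sq
    (Eventually.of_forall fun x => sq_nonneg _)]
  congr 1; funext x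
  rw [← ofReal_norm, ← ENNReal.ofReal_pow (norm_nonneg _), Real.norm_eq_abs, sq_abs]

/-- `u - v` is orthogonal to `v - w`. This supplies both the best approximation property and, for `w
= 0`, the contraction property. `V` is a bare set, so membership of the difference is a hypothesis.
-/
lemma IsL2Projection.pythagoras {Ω : Set (Space d)} {V : Set (Space d → ℝ)} {u v w : Space d → ℝ}
    (h : IsL2Projection Ω V u v) (hvw : (fun x => v x - w x) ∈ V)
    (hu : MemLp u 2 (volume.restrict Ω)) (hv : MemLp v 2 (volume.restrict Ω))
    (hw : MemLp w 2 (volume.restrict Ω)) :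
    ∫⁻ x in Ω, ‖u x - w x‖ₑ ^ 2 =
      (∫⁻ x in Ω, ‖u x - v x‖ₑ ^ 2) + ∫⁻ x in Ω, ‖v x - w x‖ₑ ^ 2 := by
  have huv : MemLp (fun x => u x - v x) 2 (volume.restrict Ω) := hu.sub hv
  have hvw' : MemLp (fun x => v x - w x) 2 (volume.restrict Ω) := hv.sub hw
  have huw : MemLp (fun x => u x - w x) 2 (volume.restrict Ω) := hu.sub hw
  have h1 := h.2 _ hvw
  have h2 : ∫ x in Ω, (u x - v x) * (v x - w x) = 0 := by
    have e : ∀ x, (u x - v x) * (v x - w x) = u x * (v x - w x) - v x * (v x - w x) := fun x => by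
      ring
    simp_rw [e]
    have i1 : Integrable (fun x => u x * (v x - w x)) (volume.restrict Ω) := hu.integrable_mul hvw'
    have i2 : Integrable (fun x => v x * (v x - w x)) (volume.restrict Ω) := hv.integrable_mul hvw'
    rw [integral_sub i1 i2, h1, sub_self]
  rw [lintegral_enorm_sq_eq huv, lintegral_enorm_sq_eq hvw', lintegral_enorm_sq_eq huw,
    ← ENNReal.ofReal_add (integral_nonneg fun x => sq_nonneg _)
      (integral_nonneg fun x => sq_nonneg _)]
  congr 1
  have e : ∀ x, (u x - w x) ^ 2 =
      ((u x - v x) ^ 2 + (v x - w x) ^ 2) + 2 * ((u x - v x) * (v x - w x)) := fun x => by ring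
  simp_rw [e]
  have i3 : Integrable (fun x => (u x - v x) * (v x - w x)) (volume.restrict Ω) :=
    huv.integrable_mul hvw'
  have i4 : Integrable (fun x => (u x - v x) ^ 2 + (v x - w x) ^ 2) (volume.restrict Ω) :=
    huv.integrable_sq.add hvw'.integrable_sq
  rw [integral_add i4 (i3.const_mul 2), integral_const_mul, h2, mul_zero, add_zero,
    integral_add huv.integrable_sq hvw'.integrable_sq]

namespace Triangulation

variable {Ω : Set (Space d)} {T : Triangulation Ω} {r : ℕ}

/-- The inverse inequality applied to the polynomial minus a constant: the gradient does not see
`m`, and the freedom to choose `m` on each cell is what later gains a factor `h`. -/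
lemma exists_lintegral_gradient_le (d r : ℕ) {σ : ℝ} (hσ : 0 < σ) :
    ∃ C : ENNReal, C ≠ ⊤ ∧ ∀ {Ω : Set (Space d)} {T : Triangulation Ω}, 1 ≤ d →
      ∀ c : Finset (Space d) → Space d, (∀ s ∈ T.cells,
        Metric.closedBall (c s) (σ * T.meshSize) ⊆ hull s ∧
          hull s ⊆ Metric.closedBall (c s) T.meshSize) →
      ∀ v ∈ T.W r, ∀ s ∈ T.cells, ∀ m : ℝ,
        ∫⁻ x in interior (hull s), ‖gradient v x‖ₑ ^ 2 ≤ C * ENNReal.ofReal (T.meshSize⁻¹ ^ 2) *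
          ∫⁻ x in interior (hull s), ‖v x - m‖ₑ ^ 2 := by
  obtain ⟨C, hC, h⟩ := exists_inverse_inequality d r hσ
  refine ⟨C, hC, fun {Ω T} hd c hc v hv s hs m => ?_⟩
  obtain ⟨p, hp, hvp⟩ := W.exists_poly hv hs
  have hdeg : (p - MvPolynomial.C m).totalDegree ≤ r :=
    (MvPolynomial.totalDegree_sub _ _).trans (max_le hp (by simp))
  have key := h (p - MvPolynomial.C m) hdeg (c s) T.meshSize (T.meshSize_pos hd hs) (hull s)
    (isClosed_hull s).measurableSet (hc s hs).1 (hc s hs).2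
  have hf : polyFun (p - MvPolynomial.C m) = fun x => polyFun p x - m := by
    rw [polyFun_sub, polyFun_C]; rfl
  rw [hf, ← setLIntegral_congr (interior_hull_ae_eq s),
    ← setLIntegral_congr (interior_hull_ae_eq s)] at key
  have e1 : ∫⁻ x in interior (hull s), ‖gradient v x‖ₑ ^ 2 =
      ∫⁻ x in interior (hull s), ‖fderiv ℝ (fun x => polyFun p x - m) x‖ₑ ^ 2 := by
    refine setLIntegral_congr_fun isOpen_interior.measurableSet fun x hx => ?_
    rw [enorm_gradient, (eventuallyEq_of_eqOn hvp hx).fderiv_eq, fderiv_sub_const]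
  have e2 : ∫⁻ x in interior (hull s), ‖v x - m‖ₑ ^ 2 =
      ∫⁻ x in interior (hull s), ‖polyFun p x - m‖ₑ ^ 2 := by
    refine setLIntegral_congr_fun isOpen_interior.measurableSet fun x hx => ?_
    rw [hvp (interior_subset hx)]
  rw [e1, e2]
  exact key

/-- Piecewise affine interpolation needs `r ≥ 1`; this settles `r = 0` in the stability theorem. -/
lemma gradient_eq_zero_of_degree_zero {v : Space d → ℝ} (hv : v ∈ T.W 0) {s : Finset (Space d)}
    (hs : s ∈ T.cells) {x : Space d} (hx : x ∈ interior (hull s)) : gradient v x = 0 := by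
  obtain ⟨p, hp, hvp⟩ := W.exists_poly hv hs
  rw [MvPolynomial.totalDegree_eq_zero_iff_eq_C.1 (Nat.le_zero.1 hp), polyFun_C] at hvp
  rw [← norm_eq_zero, norm_gradient, (eventuallyEq_of_eqOn hvp hx).fderiv_eq]
  simp

/-- The nodal values of the quasi-interpolant are the means over the balls of radius `h` about the
points `b z`. -/
lemma lintegral_sub_nodal_le (hΩ : IsOpen Ω) {k : ℝ} (hk : 1 ≤ k)
    {c : Finset (Space d) → Space d} (hd : 1 ≤ d)
    (hc : ∀ s ∈ T.cells, hull s ⊆ Metric.closedBall (c s) T.meshSize)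
    {b : Space d → Space d} (hb : ∀ z ∈ closure Ω, ‖b z - z‖ ≤ k * T.meshSize ∧
      SeesBall Ω z (b z) T.meshSize)
    {u : Space d → ℝ} {G : Space d → Space d} (hu : MemLp u 2 (volume.restrict Ω))
    (hG : IsWeakGradient Ω u G) {s : Finset (Space d)} (hs : s ∈ T.cells) {z : Space d}
    (hz : z ∈ s) :
    ∫⁻ x in interior (hull s), ‖u x - ⨍ y in Metric.ball (b z) T.meshSize, u y‖ₑ ^ 2 ≤
      ENNReal.ofReal ((2 * (k + 1)) ^ 2 * 2 ^ d * (k + 1) ^ d) * ENNReal.ofReal (T.meshSize ^ 2) *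
        ∫⁻ x in Metric.closedBall (c s) ((k + 2) * T.meshSize) ∩ Ω, ‖G x‖ₑ ^ 2 := by
  set h := T.meshSize
  have hh : 0 < h := T.meshSize_pos hd hs
  have hzs : z ∈ hull s := subset_convexHull ℝ _ hz
  have hzΩ : z ∈ closure Ω := T.hull_subset hs hzs
  have hsz : ∀ x ∈ hull s, ‖x - z‖ ≤ h := fun x hx => T.norm_sub_le hs hx hzs
  obtain ⟨hbz, hsee⟩ := hb z hzΩ
  -- A convex open subset of `Ω` that contains the interior of the cell and the averaging ball, with
  -- diameter and volume comparable to `h` and `h^d`.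
  set D := patch (hull s) (b z) h
  have hDz : ∀ p ∈ D, ‖p - z‖ ≤ (k + 1) * h := fun p hp =>
    norm_sub_le_of_mem_patch hk hh hsz hbz hp
  have hDΩ : D ⊆ Ω := patch_subset (T.hull_subset hs) hsz hsee
  have hDR : ∀ x ∈ D, ∀ y ∈ D, ‖y - x‖ ≤ 2 * (k + 1) * h := by
    intro x hx y hy
    rw [← sub_sub_sub_cancel_right y x z]
    linarith [_root_.norm_sub_le (y - z) (x - z), hDz x hx, hDz y hy]
  have hDc : D ⊆ Metric.closedBall (c s) ((k + 2) * h) ∩ Ω := by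
    refine subset_inter (fun p hp => ?_) hDΩ
    rw [mem_closedBall_iff_norm, ← sub_add_sub_cancel p z (c s)]
    have := mem_closedBall_iff_norm.1 (hc s hs hzs)
    linarith [norm_add_le (p - z) (z - c s), hDz p hp]
  set B := volume (Metric.ball (0 : Space d) 1)
  have hA : volume (Metric.ball (b z) h) = ENNReal.ofReal (h ^ d) * B := by
    rw [Measure.addHaar_ball_of_pos _ _ hh, finrank_euclideanSpace, Fintype.card_fin]
  have hA0 : volume (Metric.ball (b z) h) ≠ 0 := (Metric.measure_ball_pos volume _ hh).ne'
  have hA1 : volume (Metric.ball (b z) h) ≠ ⊤ := Metric.isBounded_ball.measure_lt_top.ne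
  have hvD : volume D ≤ ENNReal.ofReal ((k + 1) ^ d) * volume (Metric.ball (b z) h) := by
    calc volume D ≤ volume (Metric.closedBall z ((k + 1) * h)) :=
          measure_mono fun p hp => mem_closedBall_iff_norm.2 (hDz p hp)
      _ = ENNReal.ofReal (((k + 1) * h) ^ d) * B := volume_closedBall_eq z (by positivity)
      _ = _ := by rw [hA, mul_pow, ENNReal.ofReal_mul (by positivity), mul_assoc]
  have key := lintegral_sub_average_le (S := interior (hull s)) hΩ.measurableSet
    (isOpen_patch (s := hull s) (c := b z) (h := h)) hDΩ
    (convex_patch (convex_convexHull ℝ _)) hu hG hDR (interior_subset_patch hh)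
    (ball_subset_patch ⟨z, hzs⟩) hA0 hA1
  set I := ∫⁻ x in Metric.closedBall (c s) ((k + 2) * h) ∩ Ω, ‖G x‖ₑ ^ 2
  refine key.trans ?_
  calc (volume (Metric.ball (b z) h))⁻¹ * (ENNReal.ofReal ((2 * (k + 1) * h) ^ 2) *
        (2 ^ d * volume D * ∫⁻ x in D, ‖G x‖ₑ ^ 2))
      ≤ (volume (Metric.ball (b z) h))⁻¹ * (ENNReal.ofReal ((2 * (k + 1) * h) ^ 2) *
        (2 ^ d * (ENNReal.ofReal ((k + 1) ^ d) * volume (Metric.ball (b z) h)) * I)) := by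
        gcongr
        exact lintegral_mono_set hDc
    _ = ((volume (Metric.ball (b z) h))⁻¹ * volume (Metric.ball (b z) h)) *
        (ENNReal.ofReal ((2 * (k + 1) * h) ^ 2) * 2 ^ d * ENNReal.ofReal ((k + 1) ^ d) * I) := by
        ring
    _ = _ := by
        rw [ENNReal.inv_mul_cancel hA0 hA1, one_mul, mul_pow, ENNReal.ofReal_mul (by positivity),
          ENNReal.ofReal_mul (by positivity), ENNReal.ofReal_mul (by positivity),
          ENNReal.ofReal_pow (by norm_num : (0 : ℝ) ≤ 2) d, ENNReal.ofReal_ofNat]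
        ring

/-- The error of the quasi-interpolant and, for one vertex of an element, of the nodal value. -/
lemma exists_quasiInterpolant (hΩ : IsOpen Ω) (hΩ0 : volume (frontier Ω) = 0) (hr : 1 ≤ r)
    {k σ : ℝ} (hk : 1 ≤ k) (hσ : 0 < σ) (hd : 1 ≤ d) {c : Finset (Space d) → Space d}
    (hc : ∀ s ∈ T.cells, Metric.closedBall (c s) (σ * T.meshSize) ⊆ hull s ∧
      hull s ⊆ Metric.closedBall (c s) T.meshSize)
    {b : Space d → Space d} (hb : ∀ z ∈ closure Ω, ‖b z - z‖ ≤ k * T.meshSize ∧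
      SeesBall Ω z (b z) T.meshSize)
    {u : Space d → ℝ} {G : Space d → Space d} (hu : MemLp u 2 (volume.restrict Ω))
    (hG : IsWeakGradient Ω u G) :
    (∃ v ∈ T.W r, ∫⁻ x in Ω, ‖u x - v x‖ₑ ^ 2 ≤ (d + 1 : ENNReal) *
      (ENNReal.ofReal ((2 * (k + 1)) ^ 2 * 2 ^ d * (k + 1) ^ d) *
        ENNReal.ofReal (((k + 2 + σ) / σ) ^ d)) *
        ENNReal.ofReal (T.meshSize ^ 2) * ∫⁻ x in Ω, ‖G x‖ₑ ^ 2) ∧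
    ∃ m : Finset (Space d) → ℝ, ∑ s ∈ T.cellFinset,
      ∫⁻ x in interior (hull s), ‖u x - m s‖ₑ ^ 2 ≤
        ENNReal.ofReal ((2 * (k + 1)) ^ 2 * 2 ^ d * (k + 1) ^ d) *
        ENNReal.ofReal (((k + 2 + σ) / σ) ^ d) *
        ENNReal.ofReal (T.meshSize ^ 2) * ∫⁻ x in Ω, ‖G x‖ₑ ^ 2 := by
  classical
  by_cases hne : T.cellFinset.Nonempty
  swap
  · have he : T.cellFinset = ∅ := Finset.not_nonempty_iff_eq_empty.1 hne
    refine ⟨⟨_, W.zero_mem, ?_⟩, fun _ => 0, ?_⟩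
    · rw [T.lintegral_eq_sum hΩ0, he]; simp
    · rw [he]; simp
  obtain ⟨s₀, hs₀⟩ := hne
  have hh : 0 < T.meshSize := T.meshSize_pos hd (T.mem_cellFinset.1 hs₀)
  set m : Space d → ℝ := fun z => ⨍ y in Metric.ball (b z) T.meshSize, u y
  set C₁ := ENNReal.ofReal ((2 * (k + 1)) ^ 2 * 2 ^ d * (k + 1) ^ d)
  set J : Finset (Space d) → ENNReal := fun s =>
    ∫⁻ x in Metric.closedBall (c s) ((k + 2) * T.meshSize) ∩ Ω, ‖G x‖ₑ ^ 2
  have hnode : ∀ s ∈ T.cells, ∀ z ∈ s, ∫⁻ x in interior (hull s), ‖u x - m z‖ₑ ^ 2 ≤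
      C₁ * ENNReal.ofReal (T.meshSize ^ 2) * J s := fun s hs z hz =>
    lintegral_sub_nodal_le hΩ hk hd (fun s hs => (hc s hs).2) hb hu hG hs hz
  have hJ : ∑ s ∈ T.cellFinset, J s ≤
      ENNReal.ofReal (((k + 2 + σ) / σ) ^ d) * ∫⁻ x in Ω, ‖G x‖ₑ ^ 2 :=
    T.sum_lintegral_ball_le hσ (by linarith) hh (fun s hs => (hc s hs).1)
      (hG.1.1.enorm.pow_const 2)
  constructor
  · obtain ⟨v, hvW, hv⟩ := exists_interpolant (T := T) hr m
    refine ⟨v, hvW, ?_⟩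
    have hcell : ∀ s ∈ T.cellFinset, ∫⁻ x in interior (hull s), ‖u x - v x‖ₑ ^ 2 ≤
        (d + 1 : ENNReal) * (C₁ * ENNReal.ofReal (T.meshSize ^ 2) * J s) := by
      intro s hs
      have hs' := T.mem_cellFinset.1 hs
      obtain ⟨A, hAm, hA⟩ := hv s hs'
      -- For fixed `x`, the convex function `w ↦ |u x - A w|` on the cell is dominated by its value
      -- at some vertex; summing over all vertices makes the bound independent of which one.
      have hpt : ∀ x ∈ interior (hull s), ‖u x - v x‖ₑ ^ 2 ≤ ∑ z ∈ s, ‖u x - m z‖ₑ ^ 2 := by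
        intro x hx
        have hconv : ConvexOn ℝ univ fun w : Space d => ‖u x - A w‖ := by
          have h1 : ConvexOn ℝ univ fun t : ℝ => ‖u x - t‖ := by
            have := (convexOn_univ_norm (E := ℝ)).comp_affineMap
              (AffineMap.const ℝ ℝ (u x) - AffineMap.id ℝ ℝ)
            simpa [Function.comp_def] using this
          simpa [Function.comp_def] using h1.comp_affineMap A
        obtain ⟨z, hz, hle⟩ := hconv.exists_ge_of_mem_convexHull (subset_univ (s : Set (Space d)))
          (interior_subset hx)
        rw [hA x (interior_subset hx)]
        have hz' : z ∈ s := hz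
        calc ‖u x - A x‖ₑ ^ 2 ≤ ‖u x - m z‖ₑ ^ 2 := by
              rw [← hAm z hz', ← ofReal_norm, ← ofReal_norm]
              gcongr
          _ ≤ _ := Finset.single_le_sum (f := fun z => ‖u x - m z‖ₑ ^ 2) (fun _ _ => zero_le) hz'
      calc ∫⁻ x in interior (hull s), ‖u x - v x‖ₑ ^ 2
          ≤ ∫⁻ x in interior (hull s), ∑ z ∈ s, ‖u x - m z‖ₑ ^ 2 :=
            setLIntegral_mono' isOpen_interior.measurableSet hpt
        _ = ∑ z ∈ s, ∫⁻ x in interior (hull s), ‖u x - m z‖ₑ ^ 2 := by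
            refine lintegral_finsetSum' _ fun z _ => ?_
            have hsub : volume.restrict (interior (hull s)) ≤ volume.restrict (closure Ω) :=
              Measure.restrict_mono (interior_subset.trans (T.hull_subset hs')) le_rfl
            rw [Measure.restrict_congr_set (closure_ae_eq_of_null_frontier hΩ0)] at hsub
            exact (((hu.1.mono_measure hsub).sub aestronglyMeasurable_const).enorm).pow_const 2
        _ ≤ ∑ z ∈ s, C₁ * ENNReal.ofReal (T.meshSize ^ 2) * J s :=
            Finset.sum_le_sum fun z hz => hnode s hs' z hz
        _ = _ := by rw [Finset.sum_const, hs'.2, nsmul_eq_mul]; push_cast; rfl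
    rw [T.lintegral_eq_sum hΩ0]
    calc _ ≤ ∑ s ∈ T.cellFinset, (d + 1 : ENNReal) *
          (C₁ * ENNReal.ofReal (T.meshSize ^ 2) * J s) := Finset.sum_le_sum hcell
      _ = (d + 1 : ENNReal) * (C₁ * ENNReal.ofReal (T.meshSize ^ 2) *
          ∑ s ∈ T.cellFinset, J s) := by rw [← Finset.mul_sum, ← Finset.mul_sum]
      _ ≤ (d + 1 : ENNReal) * (C₁ * ENNReal.ofReal (T.meshSize ^ 2) *
          (ENNReal.ofReal (((k + 2 + σ) / σ) ^ d) * ∫⁻ x in Ω, ‖G x‖ₑ ^ 2)) := by gcongr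
      _ = _ := by ring
  · have hex : ∀ s ∈ T.cells, ∃ z, z ∈ s := fun s hs =>
      Geometry.SimplicialComplex.nonempty_of_mem_faces hs.1
    choose! z hz using hex
    refine ⟨fun s => m (z s), ?_⟩
    calc _ ≤ ∑ s ∈ T.cellFinset, C₁ * ENNReal.ofReal (T.meshSize ^ 2) * J s :=
          Finset.sum_le_sum fun s hs =>
            hnode s (T.mem_cellFinset.1 hs) _ (hz s (T.mem_cellFinset.1 hs))
      _ = C₁ * ENNReal.ofReal (T.meshSize ^ 2) * ∑ s ∈ T.cellFinset, J s := by
          rw [← Finset.mul_sum]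
      _ ≤ C₁ * ENNReal.ofReal (T.meshSize ^ 2) *
          (ENNReal.ofReal (((k + 2 + σ) / σ) ^ d) * ∫⁻ x in Ω, ‖G x‖ₑ ^ 2) := by gcongr
      _ = _ := by ring

/-- The `L²` projection to the finite element space is stable in `H¹`, on quasi-uniform
triangulations. -/
theorem exists_projection_stable (hd : 1 ≤ d) (hΩ : IsOpen Ω) (hb : Bornology.IsBounded Ω)
    (hL : HasLipschitzBoundary Ω) (r : ℕ) {σ : ℝ} (hσ : 0 < σ) :
    ∃ C : ENNReal, C ≠ ⊤ ∧ ∀ T : Triangulation Ω, T.QuasiUniform σ → ∀ (u v : Space d → ℝ)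
      (G : Space d → Space d), MemLp u 2 (volume.restrict Ω) → IsWeakGradient Ω u G →
        IsL2Projection Ω (T.W r) u v →
          ∫⁻ x in Ω, ‖gradient v x‖ₑ ^ 2 ≤
            C * ((∫⁻ x in Ω, ‖u x‖ₑ ^ 2) + ∫⁻ x in Ω, ‖G x‖ₑ ^ 2) := by
  have hΩ0 := volume_frontier_eq_zero hΩ hb hL
  obtain ⟨h₀, hh₀, k, hk, hsee⟩ := exists_seesBall hΩ hb hL
  obtain ⟨C₀, hC₀, hinv⟩ := exists_lintegral_gradient_le d r hσ
  set C₂ := ENNReal.ofReal ((2 * (k + 1)) ^ 2 * 2 ^ d * (k + 1) ^ d) *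
        ENNReal.ofReal (((k + 2 + σ) / σ) ^ d)
  have hC₂ : C₂ ≠ ⊤ := ENNReal.mul_ne_top ENNReal.ofReal_ne_top ENNReal.ofReal_ne_top
  -- The first summand is for coarse meshes, `h > h₀`, where the inverse inequality alone suffices.
  -- The second is for `h ≤ h₀`, where the cone property supplies the averaging balls.
  refine ⟨C₀ * ENNReal.ofReal (h₀⁻¹ ^ 2) + C₀ * (2 * ((d + 1) * C₂) + 2 * C₂), ?_, ?_⟩
  · finiteness
  intro T hT u v G hu hG hv
  obtain ⟨c, hc⟩ := hT.exists_centers hd hσ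
  have hvL : MemLp v 2 (volume.restrict Ω) := W.memLp hΩ hb hv.1 2
  by_cases hne : T.cellFinset.Nonempty
  swap
  · have he : T.cellFinset = ∅ := Finset.not_nonempty_iff_eq_empty.1 hne
    rw [T.lintegral_eq_sum hΩ0, he]; simp
  obtain ⟨s₀, hs₀⟩ := hne
  set h := T.meshSize
  have hh : 0 < h := T.meshSize_pos hd (T.mem_cellFinset.1 hs₀)
  have hpyth : ∀ w ∈ T.W r, ∫⁻ x in Ω, ‖u x - w x‖ₑ ^ 2 =
      (∫⁻ x in Ω, ‖u x - v x‖ₑ ^ 2) + ∫⁻ x in Ω, ‖v x - w x‖ₑ ^ 2 := fun w hw =>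
    hv.pythagoras (W.sub_mem hv.1 hw) hu hvL (W.memLp hΩ hb hw 2)
  set IU := ∫⁻ x in Ω, ‖u x‖ₑ ^ 2
  set IG := ∫⁻ x in Ω, ‖G x‖ₑ ^ 2
  rcases Nat.eq_zero_or_pos r with rfl | hr
  · rw [T.lintegral_eq_sum hΩ0, Finset.sum_eq_zero]
    · exact zero_le
    · intro s hs
      rw [setLIntegral_congr_fun (g := fun _ => 0) isOpen_interior.measurableSet fun x hx => ?_]
      · simp
      · simp [gradient_eq_zero_of_degree_zero hv.1 (T.mem_cellFinset.1 hs) hx]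
  rcases le_or_gt h h₀ with hle | hgt
  · have hb' : ∀ z ∈ closure Ω, ∃ b, ‖b - z‖ ≤ k * h ∧ SeesBall Ω z b h := fun z hz =>
      hsee z hz h hh hle
    choose! b hb'' using hb'
    obtain ⟨⟨w, hw, hwle⟩, m, hm⟩ := exists_quasiInterpolant hΩ hΩ0 hr hk hσ hd hc hb'' hu hG
    -- Best approximation: the projection is at least as close to `u` as the quasi-interpolant `w`.
    have h1 : ∫⁻ x in Ω, ‖u x - v x‖ₑ ^ 2 ≤ (d + 1) * C₂ * ENNReal.ofReal (h ^ 2) * IG := by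
      refine le_trans ?_ hwle
      rw [hpyth w hw]
      exact le_self_add
    have hcell : ∀ s ∈ T.cellFinset, ∫⁻ x in interior (hull s), ‖gradient v x‖ₑ ^ 2 ≤
        C₀ * ENNReal.ofReal (h⁻¹ ^ 2) * (2 * (∫⁻ x in interior (hull s), ‖u x - v x‖ₑ ^ 2) +
          2 * ∫⁻ x in interior (hull s), ‖u x - m s‖ₑ ^ 2) := by
      intro s hs
      have hs' := T.mem_cellFinset.1 hs
      refine (hinv hd c hc v hv.1 s hs' (m s)).trans ?_
      gcongr
      have hsub : volume.restrict (interior (hull s)) ≤ volume.restrict (closure Ω) :=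
        Measure.restrict_mono (interior_subset.trans (T.hull_subset hs')) le_rfl
      rw [Measure.restrict_congr_set (closure_ae_eq_of_null_frontier hΩ0)] at hsub
      rw [← lintegral_const_mul' _ _ (by norm_num), ← lintegral_const_mul' _ _ (by norm_num),
        ← lintegral_add_left']
      · refine lintegral_mono fun x => ?_
        -- The splitting `v - m = -(u - v) + (u - m)`. Each part is of order `h` in `L²`, which
        -- cancels the `h⁻¹` of the inverse inequality.
        have := enorm_add_sq_le (-(u x - v x)) (u x - m s)
        rw [enorm_neg] at this
        convert this using 2
        congr 1; ring
      · exact ((((hu.sub hvL).1.mono_measure hsub).enorm).pow_const 2).const_mul 2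
    calc ∫⁻ x in Ω, ‖gradient v x‖ₑ ^ 2
        = ∑ s ∈ T.cellFinset, ∫⁻ x in interior (hull s), ‖gradient v x‖ₑ ^ 2 :=
          T.lintegral_eq_sum hΩ0 _
      _ ≤ ∑ s ∈ T.cellFinset, C₀ * ENNReal.ofReal (h⁻¹ ^ 2) *
          (2 * (∫⁻ x in interior (hull s), ‖u x - v x‖ₑ ^ 2) +
          2 * ∫⁻ x in interior (hull s), ‖u x - m s‖ₑ ^ 2) := Finset.sum_le_sum hcell
      _ = C₀ * ENNReal.ofReal (h⁻¹ ^ 2) * (2 * (∫⁻ x in Ω, ‖u x - v x‖ₑ ^ 2) +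
          2 * ∑ s ∈ T.cellFinset, ∫⁻ x in interior (hull s), ‖u x - m s‖ₑ ^ 2) := by
          rw [← Finset.mul_sum, Finset.sum_add_distrib, ← Finset.mul_sum, ← Finset.mul_sum,
            T.lintegral_eq_sum hΩ0 fun x => ‖u x - v x‖ₑ ^ 2]
      _ ≤ C₀ * ENNReal.ofReal (h⁻¹ ^ 2) * (2 * ((d + 1) * C₂ * ENNReal.ofReal (h ^ 2) * IG) +
          2 * (C₂ * ENNReal.ofReal (h ^ 2) * IG)) := by gcongr
      _ = (ENNReal.ofReal (h⁻¹ ^ 2) * ENNReal.ofReal (h ^ 2)) *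
          (C₀ * (2 * ((d + 1) * C₂) + 2 * C₂) * IG) := by ring
      _ = C₀ * (2 * ((d + 1) * C₂) + 2 * C₂) * IG := by
          rw [← ENNReal.ofReal_mul (by positivity), ← mul_pow, inv_mul_cancel₀ hh.ne']; simp
      _ ≤ _ := mul_le_mul' le_add_self le_add_self
  · have h1 : ∫⁻ x in Ω, ‖v x‖ₑ ^ 2 ≤ IU := by
      have := hpyth _ W.zero_mem
      simp only [sub_zero] at this
      rw [show IU = _ from this]
      exact le_add_self
    calc ∫⁻ x in Ω, ‖gradient v x‖ₑ ^ 2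
        = ∑ s ∈ T.cellFinset, ∫⁻ x in interior (hull s), ‖gradient v x‖ₑ ^ 2 :=
          T.lintegral_eq_sum hΩ0 _
      _ ≤ ∑ s ∈ T.cellFinset, C₀ * ENNReal.ofReal (h⁻¹ ^ 2) *
          ∫⁻ x in interior (hull s), ‖v x‖ₑ ^ 2 := by
          refine Finset.sum_le_sum fun s hs => ?_
          simpa using hinv hd c hc v hv.1 s (T.mem_cellFinset.1 hs) 0
      _ = C₀ * ENNReal.ofReal (h⁻¹ ^ 2) * ∫⁻ x in Ω, ‖v x‖ₑ ^ 2 := by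
          rw [← Finset.mul_sum, ← T.lintegral_eq_sum hΩ0]
      _ ≤ C₀ * ENNReal.ofReal (h₀⁻¹ ^ 2) * IU := by
          gcongr
      _ ≤ _ := mul_le_mul' le_self_add le_self_add

end Triangulation

/-! ### The Sobolev inequality for finite element functions -/

/-- One-dimensional Hausdorff measure is Lebesgue measure and grows at most by the factor `L` on
each piece. Disjointifying `S` along the cover keeps the total constant equal to `L`, however many
pieces there are. -/
lemma volume_image_le_of_cover {f : ℝ → ℝ} {L : NNReal} {ι : Type*} (F : Finset ι) (A : ι → Set ℝ)
    (hA : ∀ i ∈ F, MeasurableSet (A i)) (hL : ∀ i ∈ F, LipschitzOnWith L f (A i)) :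
    ∀ S : Set ℝ, S ⊆ ⋃ i ∈ F, A i → volume (f '' S) ≤ L * volume S := by
  classical
  induction F using Finset.induction_on with
  | empty =>
    intro S hS
    have : S = ∅ := by simpa using hS
    simp [this]
  | insert i F hi ih =>
    intro S hS
    have h1 : volume (f '' (S ∩ A i)) ≤ L * volume (S ∩ A i) := by
      have := ((hL i (Finset.mem_insert_self i F)).mono (inter_subset_right (s := S))
        ).hausdorffMeasure_image_le (d := 1) zero_le_one
      rwa [hausdorffMeasure_real, ENNReal.rpow_one] at this
    have h2 : volume (f '' (S \ A i)) ≤ L * volume (S \ A i) := by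
      refine ih (fun j hj => hA j (Finset.mem_insert_of_mem hj))
        (fun j hj => hL j (Finset.mem_insert_of_mem hj)) _ fun x hx => ?_
      have := hS hx.1
      simp only [Finset.mem_insert, iUnion_iUnion_eq_or_left, mem_union] at this
      exact this.resolve_left hx.2
    calc volume (f '' S) = volume (f '' (S ∩ A i) ∪ f '' (S \ A i)) := by
          rw [← image_union, inter_union_sdiff]
      _ ≤ volume (f '' (S ∩ A i)) + volume (f '' (S \ A i)) := measure_union_le _ _
      _ ≤ L * volume (S ∩ A i) + L * volume (S \ A i) := add_le_add h1 h2
      _ = L * volume S := by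
          rw [← mul_add, measure_inter_add_sdiff S (hA i (Finset.mem_insert_self i F))]

/-- By the intermediate value theorem the image of `[0, 1]` contains the interval between `f 0` and
`f 1`, and its measure is at most `L`. The pieces need not be intervals. -/
lemma abs_sub_le_of_cover {f : ℝ → ℝ} (hf : Continuous f) {L : NNReal} {ι : Type*} (F : Finset ι)
    (A : ι → Set ℝ) (hA : ∀ i ∈ F, MeasurableSet (A i)) (hL : ∀ i ∈ F, LipschitzOnWith L f (A i))
    (hcov : Icc (0 : ℝ) 1 ⊆ ⋃ i ∈ F, A i) : |f 1 - f 0| ≤ L := by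
  have h1 := volume_image_le_of_cover F A hA hL _ hcov
  have h2 : uIcc (f 0) (f 1) ⊆ f '' Icc 0 1 := by
    have := intermediate_value_uIcc (a := (0 : ℝ)) (b := 1) hf.continuousOn
    rwa [uIcc_of_le (zero_le_one' ℝ)] at this
  have h3 := (measure_mono (μ := volume) h2).trans h1
  rw [Real.volume_interval, Real.volume_Icc] at h3
  simp only [sub_zero, ENNReal.ofReal_one, mul_one] at h3
  rw [← ENNReal.ofReal_coe_nnreal] at h3
  exact (ENNReal.ofReal_le_ofReal_iff L.2).1 h3

/-! ### Derivatives of mollified Lipschitz functions -/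

section mollify

/-- The estimate is averaged over the shifts `z`; the term `A (y - x)` survives unchanged because
the kernel has mass one. -/
lemma abs_mollify_sub_le {g : Space d → ℝ} (hg : Continuous g) (A : Space d →L[ℝ] ℝ) {n : ℕ} {ε : ℝ}
    {x y : Space d} (h : ∀ z, ‖z‖ < (mollifier d n).rOut →
      |g (y - z) - g (x - z) - A (y - x)| ≤ ε * ‖y - x‖) :
    |mollify n g y - mollify n g x - A (y - x)| ≤ ε * ‖y - x‖ := by
  set ψ := (mollifier d n).normed (volume : Measure (Space d)) with hψ
  have hψc : Continuous ψ := ContDiffBump.continuous_normed _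
  have hψs : HasCompactSupport ψ := ContDiffBump.hasCompactSupport_normed _
  have hint : ∀ w : Space d, Integrable fun z => ψ z * g (w - z) := fun w =>
    (hψc.mul (hg.comp (by fun_prop))).integrable_of_hasCompactSupport hψs.mul_right
  have hint0 : Integrable ψ := ContDiffBump.integrable_normed _
  have h1 : mollify n g y - mollify n g x - A (y - x) =
      ∫ z, ψ z * (g (y - z) - g (x - z) - A (y - x)) := by
    have e : ∀ z, ψ z * (g (y - z) - g (x - z) - A (y - x)) =
        ψ z * g (y - z) - ψ z * g (x - z) - ψ z * A (y - x) := fun z => by ring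
    have i1 : Integrable fun z => ψ z * g (y - z) - ψ z * g (x - z) := (hint y).sub (hint x)
    simp_rw [e]
    rw [integral_sub i1 (hint0.mul_const _), integral_sub (hint y) (hint x), integral_mul_const,
      ContDiffBump.integral_normed, one_mul, mollify_apply, mollify_apply]
  rw [h1, ← Real.norm_eq_abs]
  calc ‖∫ z, ψ z * (g (y - z) - g (x - z) - A (y - x))‖
      ≤ ∫ z, ψ z * (ε * ‖y - x‖) := by
        refine norm_integral_le_of_norm_le (hint0.mul_const _) (Eventually.of_forall fun z => ?_)
        rw [norm_mul, Real.norm_of_nonneg (ContDiffBump.nonneg_normed _ _), Real.norm_eq_abs]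
        by_cases hz : ‖z‖ < (mollifier d n).rOut
        · exact mul_le_mul_of_nonneg_left (h z hz) (ContDiffBump.nonneg_normed _ _)
        · have : ψ z = 0 := by
            rw [← Function.notMem_support, hψ, ContDiffBump.support_normed_eq]
            simpa using hz
          change ψ z * _ ≤ ψ z * _
          rw [this, zero_mul, zero_mul]
    _ = ε * ‖y - x‖ := by rw [integral_mul_const, ContDiffBump.integral_normed, one_mul]

lemma norm_fderiv_mollify_sub_le {g : Space d → ℝ} (hg : Continuous g) (A : Space d →L[ℝ] ℝ)
    {n : ℕ} {ε : ℝ} (hε : 0 ≤ ε) {x : Space d} (h : ∀ᶠ y in 𝓝 x, ∀ z,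
      ‖z‖ < (mollifier d n).rOut → |g (y - z) - g (x - z) - A (y - x)| ≤ ε * ‖y - x‖) :
    ‖fderiv ℝ (mollify n g) x - A‖ ≤ ε := by
  have hd : HasFDerivAt (mollify n g) (fderiv ℝ (mollify n g) x) x :=
    ((contDiff_mollify n hg.locallyIntegrable).differentiable one_ne_zero x).hasFDerivAt
  refine (hd.sub A.hasFDerivAt).le_of_lip' hε ?_
  filter_upwards [h] with y hy
  have := abs_mollify_sub_le hg A hy
  rw [Real.norm_eq_abs]
  convert this using 2
  simp only [map_sub, Pi.sub_apply]; ring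

/-- Mollification compares `g` at the shifted points `y - z` and `x - z`, neither of which is `x`.
This is why strict differentiability is required rather than differentiability. -/
lemma tendsto_fderiv_mollify {g : Space d → ℝ} (hg : Continuous g) {A : Space d →L[ℝ] ℝ}
    {x : Space d} (hA : HasStrictFDerivAt g A x) :
    Tendsto (fun n => fderiv ℝ (mollify n g) x) atTop (𝓝 A) := by
  rw [Metric.tendsto_atTop']
  intro ε hε
  have hε2 : (0 : ℝ) < ε / 2 := by positivity
  have h1 : ∀ᶠ p : Space d × Space d in 𝓝 (x, x),
      ‖g p.1 - g p.2 - A (p.1 - p.2)‖ ≤ ε / 2 * ‖p.1 - p.2‖ := hA.isLittleO.def hε2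
  obtain ⟨ρ, hρ, hball⟩ := Metric.eventually_nhds_iff_ball.1 h1
  obtain ⟨N, hN⟩ := eventually_atTop.1 (tendsto_mollifier_rOut (d := d).eventually_lt_const
    (show (0 : ℝ) < ρ / 2 by positivity))
  refine ⟨N, fun n hn => ?_⟩
  rw [dist_eq_norm]
  refine lt_of_le_of_lt (norm_fderiv_mollify_sub_le hg A hε2.le ?_) (half_lt_self hε)
  filter_upwards [Metric.ball_mem_nhds x (show (0 : ℝ) < ρ / 2 by positivity)] with y hy z hz
  have hz' := hz.trans (hN n hn.le)
  have hmem : (y - z, x - z) ∈ Metric.ball (x, x) ρ := by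
    rw [mem_ball_iff_norm] at hy
    rw [Metric.mem_ball, Prod.dist_eq, max_lt_iff, dist_eq_norm, dist_eq_norm]
    constructor
    · have : y - z - x = (y - x) - z := by abel
      rw [this]
      linarith [norm_sub_le (y - x) z]
    · rw [sub_sub_cancel_left, norm_neg]; linarith
  have := hball _ hmem
  simpa using this

lemma norm_fderiv_mollify_le {g : Space d → ℝ} {L : NNReal} (hg : LipschitzWith L g) (n : ℕ)
    (x : Space d) : ‖fderiv ℝ (mollify n g) x‖ ≤ L := by
  have := norm_fderiv_mollify_sub_le hg.continuous 0 (n := n) (x := x) L.2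
    (Eventually.of_forall fun y z _ => by
      have := hg.dist_le_mul (y - z) (x - z)
      simpa [Real.dist_eq, dist_eq_norm] using this)
  simpa using this

lemma support_mollify_subset {g : Space d → ℝ} {R : ℝ} (hg : Function.support g ⊆ Metric.closedBall 0 R)
    (n : ℕ) : Function.support (mollify n g) ⊆ Metric.closedBall 0 (R + 1) := by
  intro x hx
  by_contra hx'
  apply hx
  rw [mollify_apply]
  refine integral_eq_zero_of_ae (Eventually.of_forall fun z => ?_)
  simp only [Pi.zero_apply, mul_eq_zero]
  by_contra! h
  have h1 : z ∈ Function.support ((mollifier d n).normed (volume : Measure (Space d))) := h.1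
  rw [ContDiffBump.support_normed_eq, mem_ball_zero_iff] at h1
  have h2 := mem_closedBall_zero_iff.1 (hg h.2)
  have h3 : (mollifier d n).rOut ≤ 1 := by
    change 1 / ((n : ℝ) + 1) ≤ 1
    rw [div_le_one (by positivity)]; linarith [n.cast_nonneg (α := ℝ)]
  apply hx'
  rw [mem_closedBall_zero_iff]
  calc ‖x‖ = ‖(x - z) + z‖ := by rw [sub_add_cancel]
    _ ≤ _ := norm_add_le _ _
    _ ≤ R + 1 := by linarith

end mollify

/-- The Sobolev inequality for compactly supported Lipschitz functions which are strictly
differentiable almost everywhere. -/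
theorem exists_sobolev_lipschitz (d : ℕ) {p q : NNReal} (hp : 1 ≤ p) (hpd : p < d)
    (hpq : (p : ℝ)⁻¹ - (d : ℝ)⁻¹ ≤ (q : ℝ)⁻¹) (R : ℝ) :
    ∃ C : NNReal, ∀ (g : Space d → ℝ) (L : NNReal), LipschitzWith L g →
      Function.support g ⊆ Metric.closedBall 0 R →
      (∀ᵐ x, HasStrictFDerivAt g (fderiv ℝ g x) x) →
      eLpNorm g q volume ≤ C * eLpNorm (fderiv ℝ g) p volume := by
  refine ⟨eLpNormLESNormFDerivOfLeConst ℝ (volume : Measure (Space d))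
    (Metric.closedBall 0 (R + 1)) p q, fun g L hg hsupp hstrict => ?_⟩
  set C := eLpNormLESNormFDerivOfLeConst ℝ (volume : Measure (Space d))
    (Metric.closedBall 0 (R + 1)) p q
  set S : Set (Space d) := Metric.closedBall 0 (R + 1)
  have hp0 : (p : ENNReal) ≠ 0 := by
    have : p ≠ 0 := (zero_lt_one.trans_le hp).ne'
    exact_mod_cast this
  have hp0' : (0 : ℝ) < p := by exact_mod_cast zero_lt_one.trans_le hp
  have hsm : ∀ n, ContDiff ℝ 1 (mollify n g) := fun n => contDiff_mollify n hg.continuous.locallyIntegrable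
  have hgns : ∀ n, eLpNorm (mollify n g) q volume ≤ C * eLpNorm (fderiv ℝ (mollify n g)) p volume :=
    fun n => eLpNorm_le_eLpNorm_fderiv_of_le volume (hsm n) (support_mollify_subset hsupp n) hp
      (by simpa using hpd) (by simpa using hpq) Metric.isBounded_closedBall
  -- Dominated convergence: the Lipschitz constant bounds all the derivatives, and their supports
  -- lie in one ball. On the left-hand side of the Sobolev inequality Fatou's lemma is enough.
  have hlim : Tendsto (fun n => eLpNorm (fderiv ℝ (mollify n g)) p volume) atTop
      (𝓝 (eLpNorm (fderiv ℝ g) p volume)) := by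
    simp_rw [eLpNorm_eq_lintegral_rpow_enorm_toReal hp0 ENNReal.coe_ne_top]
    refine (ENNReal.continuous_rpow_const.tendsto _).comp ?_
    refine tendsto_lintegral_of_dominated_convergence
      (S.indicator fun _ => (L : ENNReal) ^ (p : ENNReal).toReal) ?_ ?_ ?_ ?_
    · exact fun n => (((hsm n).continuous_fderiv one_ne_zero).enorm.measurable).pow_const _
    · refine fun n => Eventually.of_forall fun x => ?_
      by_cases hx : x ∈ S
      · rw [indicator_of_mem hx]
        refine ENNReal.rpow_le_rpow ?_ (by simp)
        rw [← ofReal_norm, ← ENNReal.ofReal_coe_nnreal]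
        exact ENNReal.ofReal_le_ofReal (norm_fderiv_mollify_le hg n x)
      · have : fderiv ℝ (mollify n g) x = 0 := by
          have h0 : mollify n g =ᶠ[𝓝 x] fun _ => 0 := by
            filter_upwards [Metric.isClosed_closedBall.isOpen_compl.mem_nhds hx] with y hy
            by_contra hne
            exact hy (support_mollify_subset hsupp n hne)
          rw [h0.fderiv_eq]; simp
        have h0 : ‖fderiv ℝ (mollify n g) x‖ₑ = 0 := by
          rw [← ofReal_norm, this, norm_zero, ENNReal.ofReal_zero]
        simp only [h0]
        rw [ENNReal.zero_rpow_of_pos (by exact_mod_cast hp0')]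
        exact bot_le
    · rw [lintegral_indicator measurableSet_closedBall, setLIntegral_const]
      exact ENNReal.mul_ne_top (ENNReal.rpow_ne_top_of_nonneg (by simp) ENNReal.coe_ne_top)
        Metric.isBounded_closedBall.measure_lt_top.ne
    · filter_upwards [hstrict] with x hx
      exact ((ENNReal.continuous_rpow_const.comp continuous_enorm).tendsto _).comp
        (tendsto_fderiv_mollify hg.continuous hx)
  calc eLpNorm g q volume ≤ liminf (fun n => eLpNorm (mollify n g) q volume) atTop :=
        Lp.eLpNorm_lim_le_liminf_eLpNorm (fun n => (hsm n).continuous.aestronglyMeasurable) g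
          (Eventually.of_forall fun x => ContDiffBump.convolution_tendsto_right_of_continuous
            tendsto_mollifier_rOut hg.continuous x)
    _ ≤ liminf (fun n => C * eLpNorm (fderiv ℝ (mollify n g)) p volume) atTop :=
        liminf_le_liminf (Eventually.of_forall hgns)
    _ = C * eLpNorm (fderiv ℝ g) p volume :=
        (ENNReal.Tendsto.const_mul hlim (Or.inr ENNReal.coe_ne_top)).liminf_eq

namespace Triangulation

variable {Ω : Set (Space d)} {T : Triangulation Ω} {r : ℕ} {v : Space d → ℝ}

lemma W₀.indicator_eqOn (hΩ : IsOpen Ω) (hv : v ∈ T.W₀ r) :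
    EqOn (Ω.indicator v) v (closure Ω) := by
  intro x hx
  by_cases hxΩ : x ∈ Ω
  · simp [hxΩ]
  · rw [indicator_of_notMem hxΩ, hv.2 x (by rw [hΩ.frontier_eq]; exact ⟨hx, hxΩ⟩)]

lemma W₀.continuous_indicator (hv : v ∈ T.W₀ r) : Continuous (Ω.indicator v) :=
  _root_.continuous_indicator hv.2 hv.1.1

/-- On each cell the function is a polynomial, hence Lipschitz. `Ω` need not be convex, so a segment
may leave it; the preimages of the cells and of the complement of `Ω`, where the extension vanishes,
are finitely many closed sets covering `[0, 1]`. -/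
lemma W₀.exists_lipschitzWith (hΩ : IsOpen Ω) (hv : v ∈ T.W₀ r) :
    ∃ L : NNReal, LipschitzWith L (Ω.indicator v) := by
  classical
  have hcell : ∀ s ∈ T.cells, ∃ L : NNReal, LipschitzOnWith L (Ω.indicator v) (hull s) := by
    intro s hs
    obtain ⟨p, -, hp⟩ := W.exists_poly hv.1 hs
    obtain ⟨M, hM⟩ := (isCompact_hull s).exists_bound_of_continuousOn
      ((contDiff_polyFun p).continuous_fderiv (by simp)).continuousOn
    refine ⟨M.toNNReal, ?_⟩
    have h1 : LipschitzOnWith M.toNNReal (polyFun p) (hull s) :=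
      Convex.lipschitzOnWith_of_nnnorm_fderiv_le (fun x _ => differentiable_polyFun p x)
        (fun x hx => by
          rw [← NNReal.coe_le_coe, coe_nnnorm]
          exact (hM x hx).trans (Real.le_coe_toNNReal M)) (convex_convexHull ℝ _)
    intro x hx y hy
    rw [W₀.indicator_eqOn hΩ hv (T.hull_subset hs hx), W₀.indicator_eqOn hΩ hv (T.hull_subset hs hy),
      hp hx, hp hy]
    exact h1 hx hy
  choose! M hM using hcell
  set L := T.cellFinset.sup M
  refine ⟨L, LipschitzWith.of_dist_le_mul fun y x => ?_⟩
  rw [Real.dist_eq]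
  set γ : ℝ → Space d := fun t => x + t • (y - x)
  have hγ : Continuous γ := by fun_prop
  have hγL : LipschitzWith ‖y - x‖₊ γ := LipschitzWith.of_dist_le_mul fun s t => by
    rw [dist_add_left, dist_eq_norm, ← sub_smul, norm_smul, Real.dist_eq, Real.norm_eq_abs,
      mul_comm, coe_nnnorm]
  let A : Option (Finset (Space d)) → Set ℝ := fun o => o.elim (γ ⁻¹' Ωᶜ) fun s => γ ⁻¹' hull s
  have key := abs_sub_le_of_cover (f := fun t => Ω.indicator v (γ t))
    ((W₀.continuous_indicator hv).comp hγ) (L := L * ‖y - x‖₊)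
    (insert none (T.cellFinset.image some)) A ?_ ?_ ?_
  · have h0 : γ 0 = x := by simp [γ]
    have h1 : γ 1 = y := by simp [γ]
    rw [h0, h1] at key
    simpa [dist_eq_norm] using key
  · intro o _
    cases o with
    | none => exact (hΩ.isClosed_compl.preimage hγ).measurableSet
    | some s => exact ((isClosed_hull s).preimage hγ).measurableSet
  · intro o ho
    cases o with
    | none =>
      intro s hs t ht
      have e1 : Ω.indicator v (γ s) = 0 := indicator_of_notMem hs _
      have e2 : Ω.indicator v (γ t) = 0 := indicator_of_notMem ht _
      simp [e1, e2]
    | some s =>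
      have hs : s ∈ T.cellFinset := by simpa using ho
      have h1 : LipschitzOnWith L (Ω.indicator v) (hull s) :=
        (hM s (T.mem_cellFinset.1 hs)).weaken (Finset.le_sup hs)
      exact h1.comp (hγL.lipschitzOnWith) fun t ht => ht
  · intro t _
    simp only [mem_iUnion, exists_prop]
    by_cases ht : γ t ∈ Ω
    · have := subset_closure ht
      rw [T.closure_eq] at this
      simp only [mem_iUnion, exists_prop] at this
      obtain ⟨s, hs, hts⟩ := this
      exact ⟨some s, by simp [hs], hts⟩
    · exact ⟨none, by simp, ht⟩

/-- Off the null boundary, almost every point has a neighbourhood on which the extension is a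
polynomial or zero, so it is `C¹` there. -/
lemma W₀.ae_hasStrictFDerivAt (hΩ : IsOpen Ω) (hΩ0 : volume (frontier Ω) = 0)
    (hv : v ∈ T.W₀ r) :
    ∀ᵐ x, HasStrictFDerivAt (Ω.indicator v) (fderiv ℝ (Ω.indicator v) x) x := by
  have h1 : ∀ᵐ x : Space d, x ∉ frontier Ω := by
    rw [ae_iff]; simpa using hΩ0
  have h2 := (ae_restrict_iff' hΩ.measurableSet).1 (T.ae_exists_mem_interior hΩ0)
  filter_upwards [h1, h2] with x hx1 hx2
  suffices hC : ContDiffAt ℝ 1 (Ω.indicator v) x from hC.hasStrictFDerivAt one_ne_zero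
  by_cases hx : x ∈ Ω
  · obtain ⟨s, hs, hxs⟩ := hx2 hx
    obtain ⟨p, -, hp⟩ := W.exists_poly hv.1 hs
    have heq : EqOn (Ω.indicator v) (polyFun p) (hull s) := fun y hy =>
      (W₀.indicator_eqOn hΩ hv (T.hull_subset hs hy)).trans (hp hy)
    exact ((contDiff_polyFun p).contDiffAt.of_le (by simp)).congr_of_eventuallyEq
      (eventuallyEq_of_eqOn heq hxs)
  · have hxc : x ∉ closure Ω := fun hc => hx1 (by rw [hΩ.frontier_eq]; exact ⟨hc, hx⟩)
    have : Ω.indicator v =ᶠ[𝓝 x] fun _ => 0 := by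
      filter_upwards [isClosed_closure.isOpen_compl.mem_nhds hxc] with y hy
      exact indicator_of_notMem (fun h => hy (subset_closure h)) _
    exact contDiffAt_const.congr_of_eventuallyEq this

lemma W₀.eLpNorm_fderiv_indicator (hΩ : IsOpen Ω) (hΩ0 : volume (frontier Ω) = 0) (p : ENNReal) :
    eLpNorm (fderiv ℝ (Ω.indicator v)) p volume = eLpNorm (gradient v) p (volume.restrict Ω) := by
  have h1 : ∀ᵐ x : Space d, x ∉ frontier Ω := by
    rw [ae_iff]; simpa using hΩ0
  rw [← eLpNorm_indicator_eq_eLpNorm_restrict hΩ.measurableSet]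
  refine eLpNorm_congr_norm_ae ?_
  filter_upwards [h1] with x hx1
  by_cases hx : x ∈ Ω
  · have : Ω.indicator v =ᶠ[𝓝 x] v := by
      filter_upwards [hΩ.mem_nhds hx] with y hy
      exact indicator_of_mem hy _
    rw [indicator_of_mem hx, norm_gradient, this.fderiv_eq]
  · have hxc : x ∉ closure Ω := fun hc => hx1 (by rw [hΩ.frontier_eq]; exact ⟨hc, hx⟩)
    have : Ω.indicator v =ᶠ[𝓝 x] fun _ => 0 := by
      filter_upwards [isClosed_closure.isOpen_compl.mem_nhds hxc] with y hy
      exact indicator_of_notMem (fun h => hy (subset_closure h)) _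
    rw [indicator_of_notMem hx, this.fderiv_eq]
    simp

theorem exists_sobolev_W₀ (hΩ : IsOpen Ω) (hb : Bornology.IsBounded Ω)
    (hΩ0 : volume (frontier Ω) = 0) {p q : NNReal} (hp : 1 ≤ p) (hpd : p < d)
    (hpq : (p : ℝ)⁻¹ - (d : ℝ)⁻¹ ≤ (q : ℝ)⁻¹) :
    ∃ C : NNReal, ∀ (T : Triangulation Ω) (r : ℕ), ∀ v ∈ T.W₀ r,
      eLpNorm v q (volume.restrict Ω) ≤ C * eLpNorm (gradient v) p (volume.restrict Ω) := by
  obtain ⟨R, hR⟩ := hb.subset_closedBall 0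
  obtain ⟨C, hC⟩ := exists_sobolev_lipschitz d hp hpd hpq R
  refine ⟨C, fun T r v hv => ?_⟩
  obtain ⟨L, hL⟩ := W₀.exists_lipschitzWith hΩ hv
  have := hC _ L hL (Set.support_indicator_subset.trans hR) (W₀.ae_hasStrictFDerivAt hΩ hΩ0 hv)
  rwa [W₀.eLpNorm_fderiv_indicator hΩ hΩ0,
    eLpNorm_indicator_eq_eLpNorm_restrict hΩ.measurableSet] at this

end Triangulation

/-! ### Nodal representation of the finite element functions -/

/-- Polynomials of degree at most `r` form a finite-dimensional space, so the intersection of the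
kernels of the evaluations on `A` is already attained by finitely many of them. -/
lemma exists_finset_determining (d r : ℕ) (A : Set (Space d)) :
    ∃ S : Finset (Space d), (∀ x ∈ S, x ∈ A) ∧ ∀ p : MvPolynomial (Fin d) ℝ, p.totalDegree ≤ r →
      (∀ x ∈ S, polyFun p x = 0) → ∀ x ∈ A, polyFun p x = 0 := by
  classical
  let ev : Space d → (MvPolynomial.restrictTotalDegree (Fin d) ℝ r →ₗ[ℝ] ℝ) := fun x =>
    { toFun := fun p => polyFun p.1 x
      map_add' := fun p q => by simp [polyFun_add]
      map_smul' := fun c p => by simp [polyFun_smul] }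
  obtain ⟨S, hS⟩ := Finset.exists_inf_le fun x : A => LinearMap.ker (ev x)
  refine ⟨S.map ⟨Subtype.val, Subtype.val_injective⟩, ?_, fun p hp h x hx => ?_⟩
  · intro x hx
    obtain ⟨y, -, rfl⟩ := Finset.mem_map.1 hx
    exact y.2
  · have hp' : p ∈ MvPolynomial.restrictTotalDegree (Fin d) ℝ r :=
      (MvPolynomial.mem_restrictTotalDegree _ _ _).2 hp
    have h1 : (⟨p, hp'⟩ : MvPolynomial.restrictTotalDegree (Fin d) ℝ r) ∈
        S.inf fun x : A => LinearMap.ker (ev x) := by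
      rw [Submodule.mem_finsetInf]
      exact fun y hy => h y (Finset.mem_map.2 ⟨y, hy, rfl⟩)
    exact hS ⟨x, hx⟩ h1

namespace Triangulation

variable {Ω : Set (Space d)} {T : Triangulation Ω} {r : ℕ} {v w : Space d → ℝ}

lemma W.congr (hv : v ∈ T.W r) (h : EqOn w v (closure Ω)) : w ∈ T.W r :=
  ⟨hv.1.congr h, fun s hs => by
    obtain ⟨p, hp, hpv⟩ := hv.2 s hs
    exact ⟨p, hp, fun x hx => (h (T.hull_subset hs hx)).trans (hpv x hx)⟩⟩

lemma W₀.congr (hv : v ∈ T.W₀ r) (h : EqOn w v (closure Ω)) : w ∈ T.W₀ r :=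
  ⟨W.congr hv.1 h, fun x hx => (h (frontier_subset_closure hx)).trans (hv.2 x hx)⟩

lemma W.add_mem (hv : v ∈ T.W r) (hw : w ∈ T.W r) : (fun x => v x + w x) ∈ T.W r := by
  have := W.sub_mem hv (W.sub_mem W.zero_mem hw)
  simpa using this

lemma W.smul_mem (c : ℝ) (hv : v ∈ T.W r) : (fun x => c * v x) ∈ T.W r :=
  ⟨continuousOn_const.mul hv.1, fun s hs => by
    obtain ⟨p, hp, hpv⟩ := hv.2 s hs
    refine ⟨c • p, (MvPolynomial.totalDegree_smul_le c p).trans hp, fun x hx => ?_⟩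
    simp only [hpv x hx, MvPolynomial.smul_eval]⟩

variable (T r) in
/-- The finite element functions that vanish on the boundary, extended by zero. -/
def zeroExtended : Submodule ℝ (Space d → ℝ) where
  carrier := {v | v ∈ T.W₀ r ∧ ∀ x ∉ closure Ω, v x = 0}
  add_mem' := fun ha hb => ⟨⟨W.add_mem ha.1.1 hb.1.1, fun x hx => by
    simp [ha.1.2 x hx, hb.1.2 x hx]⟩, fun x hx => by simp [ha.2 x hx, hb.2 x hx]⟩
  zero_mem' := ⟨W₀.zero_mem, fun _ _ => rfl⟩
  smul_mem' := fun c _ ha => ⟨⟨W.smul_mem c ha.1.1, fun x hx => by simp [ha.1.2 x hx]⟩,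
    fun x hx => by simp [ha.2 x hx]⟩

variable (T r) in
-- Restriction to a finite set determining the polynomial on each cell is injective on `zeroExtended
-- T r`; a linear left inverse applied to the unit vectors gives the functions `e y`. The extension
-- by zero is needed for injectivity, since membership in `W₀` says nothing about values off the
-- closure of `Ω`.
theorem exists_nodes : ∃ (S : Finset (Space d)) (e : Space d → Space d → ℝ),
    (∀ y ∈ S, y ∈ closure Ω) ∧ (∀ y ∈ S, e y ∈ T.W₀ r) ∧
      ∀ v ∈ T.W₀ r, ∀ x ∈ closure Ω, v x = ∑ y ∈ S, v y * e y x := by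
  classical
  choose N hNsub hN using fun s : Finset (Space d) => exists_finset_determining d r (hull s)
  set S := T.cellFinset.biUnion N with hS
  have hsub : ∀ y ∈ S, y ∈ closure Ω := fun y hy => by
    obtain ⟨s, hs, hys⟩ := Finset.mem_biUnion.1 hy
    exact T.hull_subset (T.mem_cellFinset.1 hs) (hNsub s y hys)
  let R : zeroExtended T r →ₗ[ℝ] (S → ℝ) :=
    { toFun := fun v y => v.1 y
      map_add' := fun _ _ => rfl
      map_smul' := fun _ _ => rfl }
  have hR : LinearMap.ker R = ⊥ := by
    rw [LinearMap.ker_eq_bot']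
    intro v hv
    ext x
    by_cases hx : x ∈ closure Ω
    · rw [T.closure_eq] at hx
      simp only [mem_iUnion] at hx
      obtain ⟨s, hs, hxs⟩ := hx
      obtain ⟨p, hp, hpv⟩ := W.exists_poly v.2.1.1 (T.mem_cellFinset.1 hs)
      rw [hpv hxs]
      refine hN s p hp (fun y hy => ?_) x hxs
      rw [← hpv (hNsub s y hy)]
      exact congrFun hv ⟨y, Finset.mem_biUnion.2 ⟨s, hs, hy⟩⟩
    · exact v.2.2 x hx
  obtain ⟨g, hg⟩ := R.exists_leftInverse_of_injective hR
  refine ⟨S, fun y => if h : y ∈ S then (g (Pi.single ⟨y, h⟩ 1)).1 else 0, hsub,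
    fun y hy => ?_, fun v hv x hx => ?_⟩
  · simp only [dif_pos hy]
    exact (g (Pi.single ⟨y, hy⟩ 1)).2.1
  · have hv' : (closure Ω).indicator v ∈ zeroExtended T r :=
      ⟨W₀.congr hv fun x hx => indicator_of_mem hx _, fun x hx => indicator_of_notMem hx _⟩
    have h1 : g (R ⟨_, hv'⟩) = ⟨_, hv'⟩ := LinearMap.congr_fun hg _
    have h2 : R ⟨_, hv'⟩ = ∑ y : S, v y • Pi.single y (1 : ℝ) := by
      ext z
      simp only [Finset.sum_apply, Pi.smul_apply, Pi.single_apply, smul_eq_mul, mul_ite, mul_one,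
        mul_zero, Finset.sum_ite_eq, Finset.mem_univ, if_true]
      exact indicator_of_mem (hsub _ z.2) _
    rw [h2, map_sum] at h1
    have h3 := congrFun (congrArg Subtype.val h1) x
    simp only [indicator_of_mem hx] at h3
    rw [← h3, ← Finset.sum_coe_sort S]
    simp only [map_smul, Submodule.coe_sum, Submodule.coe_smul, Finset.sum_apply, Pi.smul_apply,
      smul_eq_mul, Subtype.coe_eta, Finset.coe_mem, dite_true]

end Triangulation

/-! ### The time derivative of the energy -/

section time

variable {Ω : Set (Space d)} {T : Triangulation Ω} {r : ℕ} {u : ℝ → Space d → ℝ}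

lemma setIntegral_sum_mul_sum (S : Finset (Space d)) {e : Space d → Space d → ℝ}
    (hint : ∀ y ∈ S, ∀ z ∈ S, IntegrableOn (fun x => e y x * e z x) Ω) (b c : Space d → ℝ) :
    ∫ x in Ω, (∑ y ∈ S, b y * e y x) * (∑ z ∈ S, c z * e z x) =
      ∑ y ∈ S, ∑ z ∈ S, b y * c z * ∫ x in Ω, e y x * e z x := by
  have : ∀ x, (∑ y ∈ S, b y * e y x) * (∑ z ∈ S, c z * e z x) =
      ∑ y ∈ S, ∑ z ∈ S, b y * c z * (e y x * e z x) := fun x => by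
    rw [Finset.sum_mul_sum]
    exact Finset.sum_congr rfl fun y _ => Finset.sum_congr rfl fun z _ => by ring
  simp_rw [this]
  rw [integral_finsetSum _ fun y hy => integrable_finsetSum _ fun z hz =>
    (hint y hy z hz).const_mul _]
  refine Finset.sum_congr rfl fun y hy => ?_
  rw [integral_finsetSum _ fun z hz => (hint y hy z hz).const_mul _]
  exact Finset.sum_congr rfl fun z _ => integral_const_mul _ _

/-- The solution is assumed differentiable in time only pointwise in space. In the nodal
representation the energy is a quadratic form in finitely many scalar functions, so no
differentiation under the integral sign is needed. -/
theorem energy_regularity (hΩ : IsOpen Ω) (hb : Bornology.IsBounded Ω)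
    (hmem : ∀ t, 0 ≤ t → u t ∈ T.W₀ r)
    (hcont : ∀ x ∈ closure Ω, ContinuousWithinAt (fun s => u s x) (Ici 0) 0)
    (hdiff : ∀ t, 0 < t → ∀ x ∈ closure Ω, DifferentiableAt ℝ (fun s => u s x) t) :
    ContinuousWithinAt (fun t => ∫ x in Ω, u t x ^ 2) (Ici 0) 0 ∧ ∀ t, 0 < t →
      HasDerivAt (fun t => ∫ x in Ω, u t x ^ 2)
        (2 * ∫ x in Ω, deriv (fun s => u s x) t * u t x) t := by
  obtain ⟨S, e, hS, he, hrep⟩ := T.exists_nodes r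
  have hint : ∀ y ∈ S, ∀ z ∈ S, IntegrableOn (fun x => e y x * e z x) Ω := fun y hy z hz =>
    (Triangulation.W.memLp hΩ hb (he y hy).1 2).integrable_mul
      (Triangulation.W.memLp hΩ hb (he z hz).1 2)
  set M : Space d → Space d → ℝ := fun y z => ∫ x in Ω, e y x * e z x with hM
  have hsymm : ∀ y z, M y z = M z y := fun y z => by simp only [hM, mul_comm]
  have hrep' : ∀ t, 0 ≤ t → ∫ x in Ω, u t x ^ 2 =
      ∑ y ∈ S, ∑ z ∈ S, u t y * u t z * M y z := fun t ht => by
    rw [← setIntegral_sum_mul_sum S hint]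
    refine setIntegral_congr_fun hΩ.measurableSet fun x hx => ?_
    simp only [sq, ← hrep _ (hmem t ht) x (subset_closure hx)]
  refine ⟨?_, fun t ht => ?_⟩
  · have h1 : ContinuousWithinAt (fun t => ∑ y ∈ S, ∑ z ∈ S, u t y * u t z * M y z) (Ici 0) 0 :=
      tendsto_finsetSum _ fun y hy => tendsto_finsetSum _ fun z hz =>
        ((hcont y (hS y hy)).mul (hcont z (hS z hz))).mul continuousWithinAt_const
    exact h1.congr (fun t ht => hrep' t ht) (hrep' 0 le_rfl)
  · have hd : ∀ y ∈ S, HasDerivAt (fun s => u s y) (deriv (fun s => u s y) t) t := fun y hy =>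
      (hdiff t ht y (hS y hy)).hasDerivAt
    have h1 : HasDerivAt (fun t => ∑ y ∈ S, ∑ z ∈ S, u t y * u t z * M y z)
        (∑ y ∈ S, ∑ z ∈ S, (deriv (fun s => u s y) t * u t z + u t y * deriv (fun s => u s z) t) *
          M y z) t :=
      HasDerivAt.fun_sum fun y hy => HasDerivAt.fun_sum fun z hz =>
        ((hd y hy).mul (hd z hz)).mul_const _
    have h2 : ∫ x in Ω, deriv (fun s => u s x) t * u t x =
        ∑ y ∈ S, ∑ z ∈ S, deriv (fun s => u s y) t * u t z * M y z := by
      rw [← setIntegral_sum_mul_sum S hint]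
      refine setIntegral_congr_fun hΩ.measurableSet fun x hx => ?_
      have h3 : (fun s => u s x) =ᶠ[𝓝 t] fun s => ∑ y ∈ S, u s y * e y x := by
        filter_upwards [lt_mem_nhds ht] with s hs
        exact hrep _ (hmem s (le_of_lt hs)) x (subset_closure hx)
      have h4 : HasDerivAt (fun s => ∑ y ∈ S, u s y * e y x)
          (∑ y ∈ S, deriv (fun s => u s y) t * e y x) t :=
        HasDerivAt.fun_sum fun y hy => (hd y hy).mul_const _
      simp only [h3.deriv_eq, h4.deriv, ← hrep _ (hmem t ht.le) x (subset_closure hx)]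
    have h5 : (∑ y ∈ S, ∑ z ∈ S, (deriv (fun s => u s y) t * u t z +
        u t y * deriv (fun s => u s z) t) * M y z) =
          2 * ∫ x in Ω, deriv (fun s => u s x) t * u t x := by
      rw [h2, two_mul]
      simp only [add_mul, Finset.sum_add_distrib]
      congr 1
      rw [Finset.sum_comm]
      exact Finset.sum_congr rfl fun y _ => Finset.sum_congr rfl fun z _ => by
        rw [hsymm z y]; ring
    rw [← h5]
    refine h1.congr_of_eventuallyEq ?_
    filter_upwards [lt_mem_nhds ht] with s hs
    exact hrep' s (le_of_lt hs)

end time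

/-! ### The energy inequality -/

/-- With `X = |A + B|`, writing `(A + B)·A = X² - (A + B)·B` and using `K ≤ 1 / a₀` leaves half of
`K(X) X²`, up to a multiple of `|B|²`. The coercivity of `K` and `|A|^β ≤ 2 (X^β + |B|^β)` then give
the claim after multiplication by `δ^a`. -/
lemma GenPoly.exists_flux_bound (P : GenPoly) (E : Type*) [NormedAddCommGroup E]
    [InnerProductSpace ℝ E] :
    ∃ c C : ℝ, 0 < c ∧ 0 < C ∧ ∀ δ, 0 < δ → δ ≤ 1 → ∀ A B : E,
      c * δ ^ P.a * ‖A‖ ^ P.β - C * δ ^ 2 - C * ‖B‖ ^ 2 ≤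
        inner ℝ (P.K ‖A + B‖ • (A + B)) A := by
  obtain ⟨D, hD, hK⟩ := P.exists_rpow_le_K
  have ha0 := P.coeff_zero_pos
  refine ⟨1 / (4 * D), 1 / D + 1 / (2 * P.coeff 0), by positivity, by positivity,
    fun δ hδ hδ1 A B => ?_⟩
  set k := P.K ‖A + B‖ with hk
  set X := ‖A + B‖ with hX
  have hX0 : 0 ≤ X := norm_nonneg _
  have hk0 : 0 ≤ k := P.K_nonneg hX0
  have hk1 : k ≤ 1 / P.coeff 0 := P.K_le hX0
  have h1 : inner ℝ (k • (A + B)) A = k * (X ^ 2 - inner ℝ (A + B) B) := by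
    rw [real_inner_smul_left, hX, ← real_inner_self_eq_norm_sq, ← inner_sub_right,
      add_sub_cancel_right]
  have h2 : inner ℝ (A + B) B ≤ X ^ 2 / 2 + ‖B‖ ^ 2 / 2 := by
    have := real_inner_le_norm (A + B) B
    nlinarith [sq_nonneg (X - ‖B‖)]
  have h3 : k * X ^ 2 / 2 - 1 / (2 * P.coeff 0) * ‖B‖ ^ 2 ≤ inner ℝ (k • (A + B)) A := by
    rw [h1]
    have e : 1 / (2 * P.coeff 0) = 1 / P.coeff 0 / 2 := by field_simp
    have := mul_le_mul_of_nonneg_right hk1 (sq_nonneg ‖B‖)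
    have := mul_le_mul_of_nonneg_left h2 hk0
    rw [e]; nlinarith
  have h4 : ‖A‖ ^ P.β ≤ 2 * (X ^ P.β + ‖B‖ ^ P.β) := by
    have hA : ‖A‖ ≤ X + ‖B‖ := by
      have := norm_sub_le (A + B) B
      rwa [add_sub_cancel_right] at this
    have h5 : (X + ‖B‖) ^ P.β ≤ 2 ^ (P.β - 1) * (X ^ P.β + ‖B‖ ^ P.β) := by
      exact_mod_cast NNReal.rpow_add_le_mul_rpow_add_rpow ‖A + B‖₊ ‖B‖₊ P.one_lt_β.le
    have h6 : (2 : ℝ) ^ (P.β - 1) ≤ 2 := by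
      calc (2 : ℝ) ^ (P.β - 1) ≤ 2 ^ (1 : ℝ) :=
            Real.rpow_le_rpow_of_exponent_le one_le_two (by linarith [P.β_lt_two])
        _ = 2 := Real.rpow_one 2
    exact (Real.rpow_le_rpow (norm_nonneg A) hA P.β_pos.le).trans
      (h5.trans (mul_le_mul_of_nonneg_right h6 (by positivity)))
  have h7 := hK δ hδ hδ1 X hX0
  have h8 := P.rpow_β_le hδ (norm_nonneg B)
  have e1 : δ ^ P.a * δ ^ P.β = δ ^ 2 := by
    rw [← Real.rpow_add hδ, GenPoly.β, add_sub_cancel, Real.rpow_two]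
  have e2 : δ ^ P.a * δ ^ (-P.a) = 1 := by
    rw [← Real.rpow_add hδ, add_neg_cancel, Real.rpow_zero]
  -- The factor `δ^a` cancels both losses `δ^(-a)` and turns `δ^β` into `δ²`.
  have h9 : δ ^ P.a * ‖A‖ ^ P.β ≤ 4 * δ ^ 2 + 2 * D * (k * X ^ 2) + 2 * ‖B‖ ^ 2 := by
    calc δ ^ P.a * ‖A‖ ^ P.β
        ≤ δ ^ P.a * (2 * ((δ ^ P.β + D * δ ^ (-P.a) * (k * X ^ 2)) +
            (δ ^ P.β + δ ^ (-P.a) * ‖B‖ ^ 2))) :=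
          mul_le_mul_of_nonneg_left (h4.trans (by linarith)) (by positivity)
      _ = 4 * (δ ^ P.a * δ ^ P.β) + 2 * D * (k * X ^ 2) * (δ ^ P.a * δ ^ (-P.a)) +
            2 * ‖B‖ ^ 2 * (δ ^ P.a * δ ^ (-P.a)) := by ring
      _ = _ := by rw [e1, e2]; ring
  have h10 : 1 / (4 * D) * (δ ^ P.a * ‖A‖ ^ P.β) ≤
      1 / D * δ ^ 2 + k * X ^ 2 / 2 + 1 / D * ‖B‖ ^ 2 := by
    calc 1 / (4 * D) * (δ ^ P.a * ‖A‖ ^ P.β)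
        ≤ 1 / (4 * D) * (4 * δ ^ 2 + 2 * D * (k * X ^ 2) + 2 * ‖B‖ ^ 2) :=
          mul_le_mul_of_nonneg_left h9 (by positivity)
      _ = 1 / D * δ ^ 2 + k * X ^ 2 / 2 + 1 / D * ‖B‖ ^ 2 / 2 := by field_simp; ring
      _ ≤ _ := by
          have : 0 ≤ 1 / D * ‖B‖ ^ 2 := by positivity
          linarith
  have h11 : 0 ≤ 1 / (2 * P.coeff 0) * δ ^ 2 := by positivity
  linarith

variable {Ω : Set (Space d)}

lemma l2Norm_nonneg {F : Type*} [NormedAddCommGroup F] (u : Space d → F) : 0 ≤ l2Norm Ω u :=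
  ENNReal.toReal_nonneg

lemma l2Norm_sq_eq_toReal {F : Type*} [NormedAddCommGroup F] (u : Space d → F) :
    l2Norm Ω u ^ 2 = (∫⁻ x in Ω, ‖u x‖ₑ ^ 2).toReal := by
  rw [l2Norm, ← ENNReal.toReal_pow, eLpNorm_two_sq]

lemma l2Norm_sq {F : Type*} [NormedAddCommGroup F] {u : Space d → F}
    (hu : MemLp u 2 (volume.restrict Ω)) : l2Norm Ω u ^ 2 = ∫ x in Ω, ‖u x‖ ^ 2 := by
  rw [l2Norm_sq_eq_toReal, integral_eq_lintegral_of_nonneg_ae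
    (Eventually.of_forall fun x => sq_nonneg _) (hu.1.norm.pow 2)]
  congr 1
  refine lintegral_congr fun x => ?_
  rw [ENNReal.ofReal_pow (norm_nonneg _), ofReal_norm]

lemma setIntegral_mul_le_l2Norm {u v : Space d → ℝ} (hu : MemLp u 2 (volume.restrict Ω))
    (hv : MemLp v 2 (volume.restrict Ω)) : ∫ x in Ω, u x * v x ≤ l2Norm Ω u * l2Norm Ω v := by
  have h1 : inner ℝ (hv.toLp v) (hu.toLp u) = ∫ x in Ω, u x * v x := by
    rw [L2.inner_def]
    refine integral_congr_ae ?_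
    filter_upwards [hu.coeFn_toLp, hv.coeFn_toLp] with x h1 h2
    simp [h1, h2]
  rw [← h1, mul_comm]
  refine (real_inner_le_norm _ _).trans_eq ?_
  rw [Lp.norm_toLp, Lp.norm_toLp, l2Norm, l2Norm]

namespace Triangulation

variable {T : Triangulation Ω} {r : ℕ}

/-- The degree condition `a ≤ 4 / (d + 2)` is exactly `1/β - 1/d ≤ 1/2`, the condition for the
embedding of `W^{1,β}` with zero boundary values into `L²`; `β < 2 ≤ d` keeps the exponent
subcritical. -/
lemma exists_l2Norm_rpow_le (hd : 2 ≤ d) (hΩ : IsOpen Ω) (hb : Bornology.IsBounded Ω)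
    (hΩ0 : volume (frontier Ω) = 0) (P : GenPoly) (hP : P.DegreeCondition d) :
    ∃ C : ℝ, 0 < C ∧ ∀ (T : Triangulation Ω) (r : ℕ), ∀ v ∈ T.W₀ r,
      l2Norm Ω v ^ P.β ≤ C * ∫ x in Ω, ‖gradient v x‖ ^ P.β := by
  have hβ1 := P.one_lt_β
  have hd' : (2 : ℝ) ≤ d := by exact_mod_cast hd
  set p : NNReal := ⟨P.β, P.β_pos.le⟩ with hp
  have hpβ : (p : ℝ) = P.β := rfl
  have hpq : (p : ℝ)⁻¹ - (d : ℝ)⁻¹ ≤ ((2 : NNReal) : ℝ)⁻¹ := by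
    have h1 : P.a * (d + 2) ≤ 4 := (le_div_iff₀ (by positivity)).1 hP
    have h2 : 2 * (d : ℝ) ≤ P.β * (d + 2) := by rw [GenPoly.β]; linarith
    have hβ0 := P.β_pos
    have : (P.β)⁻¹ ≤ (d + 2) / (2 * d) := by
      rw [inv_le_comm₀ hβ0 (by positivity), inv_div, div_le_iff₀ (by positivity)]
      exact h2
    have e : ((d : ℝ) + 2) / (2 * d) = 2⁻¹ + (d : ℝ)⁻¹ := by field_simp
    rw [hpβ]; push_cast; linarith
  obtain ⟨C, hC⟩ := exists_sobolev_W₀ (p := p) (q := 2) hΩ hb hΩ0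
    (by rw [← NNReal.coe_le_coe, hpβ]; exact_mod_cast hβ1.le)
    (by rw [← NNReal.coe_lt_coe, hpβ]; push_cast; linarith [P.β_lt_two]) hpq
  refine ⟨(C + 1) ^ P.β, by positivity, fun T r v hv => ?_⟩
  have hA := W.memLp_gradient hΩ0 hb hv.1 (p : ENNReal)
  have h1 := hC T r v hv
  have hp0 : (p : ENNReal) ≠ 0 := by
    rw [ENNReal.coe_ne_zero, ← NNReal.coe_ne_zero, hpβ]; exact P.β_pos.ne'
  rw [hA.eLpNorm_eq_integral_rpow_norm hp0 ENNReal.coe_ne_top, ENNReal.coe_toReal, hpβ] at h1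
  set I := ∫ x in Ω, ‖gradient v x‖ ^ P.β with hI
  have hI0 : 0 ≤ I := integral_nonneg fun x => by positivity
  have h2 : l2Norm Ω v ≤ (C + 1) * I ^ P.β⁻¹ := by
    have := ENNReal.toReal_mono (by finiteness) h1
    rw [ENNReal.toReal_mul, ENNReal.coe_toReal, ENNReal.toReal_ofReal (by positivity)] at this
    refine (this : l2Norm Ω v ≤ _).trans ?_
    gcongr
    linarith
  calc l2Norm Ω v ^ P.β ≤ ((C + 1) * I ^ P.β⁻¹) ^ P.β :=
        Real.rpow_le_rpow (l2Norm_nonneg v) h2 P.β_pos.le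
    _ = (C + 1) ^ P.β * I := by
        rw [Real.mul_rpow (by positivity) (by positivity), Real.rpow_inv_rpow hI0 P.β_pos.ne']

end Triangulation

open Triangulation in
-- The pointwise flux bound with `A = ∇v` and `B = ∇(u - v)`, integrated over `Ω`, followed by the
-- Sobolev inequality. The volume of `Ω` enters through the constant term `C δ²`.
lemma exists_setIntegral_flux_ge (hd : 2 ≤ d) (hΩ : IsOpen Ω) (hb : Bornology.IsBounded Ω)
    (hΩ0 : volume (frontier Ω) = 0) (P : GenPoly) (hP : P.DegreeCondition d) :
    ∃ c C : ℝ, 0 < c ∧ 0 < C ∧ ∀ (T : Triangulation Ω) (r : ℕ) (u v : Space d → ℝ), v ∈ T.W₀ r →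
      (fun x => u x - v x) ∈ T.W r → ∀ δ, 0 < δ → δ ≤ 1 →
        c * δ ^ P.a * l2Norm Ω v ^ P.β - C * δ ^ 2 -
            C * l2Norm Ω (gradient fun x => u x - v x) ^ 2 ≤
          ∫ x in Ω, inner ℝ (P.K ‖gradient u x‖ • gradient u x) (gradient v x) := by
  obtain ⟨c, C, hc, hC, hflux⟩ := P.exists_flux_bound (Space d)
  obtain ⟨D, hD, hsob⟩ := exists_l2Norm_rpow_le hd hΩ hb hΩ0 P hP
  have hfin : IsFiniteMeasure (volume.restrict Ω) := ⟨by simpa using hb.measure_lt_top⟩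
  set m := (volume.restrict Ω).real univ with hm
  have hm0 : 0 ≤ m := measureReal_nonneg
  refine ⟨c / D, C * (m + 1), by positivity, by positivity, fun T r u v hv hw δ hδ hδ1 => ?_⟩
  set A := gradient v with hA
  set B := gradient fun x => u x - v x with hB
  have hAL := fun p => W.memLp_gradient hΩ0 hb hv.1 p
  have hBL := fun p => W.memLp_gradient hΩ0 hb hw p
  have hu : ∀ᵐ x ∂(volume.restrict Ω), gradient u x = A x + B x := by
    filter_upwards [W.ae_differentiableAt hΩ0 hv.1, W.ae_differentiableAt hΩ0 hw] with x h1 h2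
    have e : u = v + fun x => u x - v x := by funext x; simp
    conv_lhs => rw [e]
    simp only [hA, hB, gradient]
    rw [fderiv_add h1 h2, map_add]
  have hKm : Measurable fun x => P.K ‖gradient u x‖ := P.measurable_K_norm (measurable_gradient u)
  have i1 : Integrable (fun x => inner ℝ (P.K ‖gradient u x‖ • gradient u x) (A x))
      (volume.restrict Ω) := by
    have hbd : Integrable (fun x => 1 / P.coeff 0 * (‖A x + B x‖ * ‖A x‖)) (volume.restrict Ω) :=
      ((((hAL 2).add (hBL 2)).norm.integrable_mul (hAL 2).norm).const_mul _)
    refine hbd.mono' ((hKm.smul (measurable_gradient u)).inner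
      (measurable_gradient v)).aestronglyMeasurable ?_
    filter_upwards [hu] with x hx
    refine (norm_inner_le_norm _ _).trans ?_
    rw [norm_smul, hx, Real.norm_of_nonneg (P.K_nonneg (norm_nonneg _)), mul_assoc]
    exact mul_le_mul_of_nonneg_right (P.K_le (norm_nonneg _)) (by positivity)
  have iA : Integrable (fun x => ‖A x‖ ^ P.β) (volume.restrict Ω) := by
    have h := (hAL (ENNReal.ofReal P.β)).integrable_norm_rpow
      (by simpa using P.β_pos) ENNReal.ofReal_ne_top
    rwa [ENNReal.toReal_ofReal P.β_pos.le] at h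
  have iB : Integrable (fun x => ‖B x‖ ^ 2) (volume.restrict Ω) := (hBL 2).norm.integrable_sq
  have i2 : Integrable (fun x => c * δ ^ P.a * ‖A x‖ ^ P.β - C * δ ^ 2) (volume.restrict Ω) :=
    (iA.const_mul _).sub (integrable_const _)
  have h1 : ∫ x in Ω, (c * δ ^ P.a * ‖A x‖ ^ P.β - C * δ ^ 2 - C * ‖B x‖ ^ 2) ≤
      ∫ x in Ω, inner ℝ (P.K ‖gradient u x‖ • gradient u x) (A x) := by
    refine integral_mono_ae (i2.sub (iB.const_mul _)) i1 ?_
    filter_upwards [hu] with x hx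
    rw [hx]
    exact hflux δ hδ hδ1 (A x) (B x)
  rw [integral_sub i2 (iB.const_mul _), integral_sub (iA.const_mul _) (integrable_const _),
    integral_const, integral_const_mul, integral_const_mul, ← l2Norm_sq (hBL 2), smul_eq_mul,
    ← hm] at h1
  refine le_trans ?_ h1
  have h2 : c / D * δ ^ P.a * l2Norm Ω v ^ P.β ≤ c * δ ^ P.a * ∫ x in Ω, ‖A x‖ ^ P.β := by
    calc c / D * δ ^ P.a * l2Norm Ω v ^ P.β
        ≤ c / D * δ ^ P.a * (D * ∫ x in Ω, ‖A x‖ ^ P.β) :=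
          mul_le_mul_of_nonneg_left (hsob T r v hv) (by positivity)
      _ = _ := by field_simp
  have h3 : 0 ≤ C * δ ^ 2 := by positivity
  have h4 : 0 ≤ C * m * l2Norm Ω B ^ 2 := by positivity
  nlinarith

lemma exists_l2Norm_gradient_proj_le (hd : 2 ≤ d) (hΩ : IsOpen Ω) (hb : Bornology.IsBounded Ω)
    (hL : HasLipschitzBoundary Ω) (r : ℕ) {σ : ℝ} (hσ : 0 < σ) :
    ∃ C : ℝ, 0 ≤ C ∧ ∀ T : Triangulation Ω, T.QuasiUniform σ → ∀ u v : Space d → ℝ,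
      MemH1 Ω u → IsL2Projection Ω (T.W r) u v →
        l2Norm Ω (gradient v) ^ 2 ≤ C * h1Norm Ω u ^ 2 := by
  obtain ⟨C, hC, hstab⟩ := Triangulation.exists_projection_stable (by lia) hΩ hb hL r hσ
  refine ⟨C.toReal, ENNReal.toReal_nonneg, fun T hT u v hu hv => ?_⟩
  have hG : IsWeakGradient Ω u (weakGradient Ω u) := Classical.epsilon_spec hu.2
  have h1 := hstab T hT u v _ hu.1 hG hv
  have f1 : ∫⁻ x in Ω, ‖u x‖ₑ ^ 2 ≠ ⊤ := by
    rw [← eLpNorm_two_sq]; exact ENNReal.pow_ne_top hu.1.2.ne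
  have f2 : ∫⁻ x in Ω, ‖weakGradient Ω u x‖ₑ ^ 2 ≠ ⊤ := by
    rw [← eLpNorm_two_sq]; exact ENNReal.pow_ne_top hG.1.2.ne
  have h2 := ENNReal.toReal_mono (ENNReal.mul_ne_top hC (ENNReal.add_ne_top.2 ⟨f1, f2⟩)) h1
  rw [ENNReal.toReal_mul, ENNReal.toReal_add f1 f2] at h2
  rw [h1Norm, Real.sq_sqrt (by positivity), l2Norm_sq_eq_toReal, l2Norm_sq_eq_toReal,
    l2Norm_sq_eq_toReal]
  exact h2

/-! ### The energy of a semidiscrete solution -/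

section solution

variable {P : GenPoly} {T : Triangulation Ω} {r : ℕ} {ρt0 : Space d → ℝ}
  {f φ ρ ρt : ℝ → Space d → ℝ}

lemma IsSemidiscreteSolution.memLp (hΩ : IsOpen Ω) (hb : Bornology.IsBounded Ω)
    (h : IsSemidiscreteSolution P T r ρt0 f φ ρ ρt) {t : ℝ} (ht : 0 ≤ t) :
    MemLp (ρt t) 2 (volume.restrict Ω) :=
  Triangulation.W.memLp hΩ hb (h.mem t ht).1 2

lemma IsSemidiscreteSolution.l2Norm_sq (hΩ : IsOpen Ω) (hb : Bornology.IsBounded Ω)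
    (h : IsSemidiscreteSolution P T r ρt0 f φ ρ ρt) {t : ℝ} (ht : 0 ≤ t) :
    l2Norm Ω (ρt t) ^ 2 = ∫ x in Ω, ρt t x ^ 2 := by
  rw [Forchheimer.l2Norm_sq (h.memLp hΩ hb ht)]
  simp only [Real.norm_eq_abs, sq_abs]

lemma IsSemidiscreteSolution.sqrt_energy (hΩ : IsOpen Ω) (hb : Bornology.IsBounded Ω)
    (h : IsSemidiscreteSolution P T r ρt0 f φ ρ ρt) {t : ℝ} (ht : 0 ≤ t) :
    √(∫ x in Ω, ρt t x ^ 2) = l2Norm Ω (ρt t) := by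
  rw [← h.l2Norm_sq hΩ hb ht, Real.sqrt_sq (l2Norm_nonneg _)]

lemma IsSemidiscreteSolution.l2Norm_init_le (hΩ : IsOpen Ω) (hb : Bornology.IsBounded Ω)
    (h : IsSemidiscreteSolution P T r ρt0 f φ ρ ρt) (h0 : MemLp ρt0 2 (volume.restrict Ω)) :
    l2Norm Ω (ρt 0) ≤ l2Norm Ω ρt0 := by
  have h1 := h.init.pythagoras (w := fun _ => 0) (by simpa using h.init.1) h0
    (h.memLp hΩ hb le_rfl) MemLp.zero
  simp only [sub_zero] at h1
  have h2 : ∫⁻ x in Ω, ‖ρt0 x‖ₑ ^ 2 ≠ ⊤ := by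
    rw [← eLpNorm_two_sq]; exact ENNReal.pow_ne_top h0.2.ne
  refine (pow_le_pow_iff_left₀ (l2Norm_nonneg _) (l2Norm_nonneg _) two_ne_zero).1 ?_
  rw [l2Norm_sq_eq_toReal, l2Norm_sq_eq_toReal]
  exact ENNReal.toReal_mono h2 (h1 ▸ le_add_self)

end solution

/-- The solution `ρ̃_h(t)` is itself an admissible test function. The flux bound supplies the
dissipation, stability of the projection replaces `∇πφ` by `‖φ‖₁`, and Cauchy–Schwarz treats the
forcing. -/
theorem exists_energyInequality (hd : 2 ≤ d) (hΩ : IsOpen Ω) (hb : Bornology.IsBounded Ω)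
    (hL : HasLipschitzBoundary Ω) (P : GenPoly) (hP : P.DegreeCondition d) (r : ℕ) {σ : ℝ}
    (hσ : 0 < σ) :
    ∃ c C : ℝ, 0 < c ∧ 0 < C ∧ ∀ T : Triangulation Ω, T.QuasiUniform σ →
      ∀ (ρt0 : Space d → ℝ) (f φ ρ ρt : ℝ → Space d → ℝ),
        (∀ t, 0 ≤ t → MemLp (f t) 2 (volume.restrict Ω)) → (∀ t, 0 ≤ t → MemH1 Ω (φ t)) →
        IsSemidiscreteSolution P T r ρt0 f φ ρ ρt →
          EnergyInequality P c C (fun t => ∫ x in Ω, ρt t x ^ 2) (fun t => l2Norm Ω (f t))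
            (fun t => h1Norm Ω (φ t)) := by
  obtain ⟨c, C, hc, hC, hflux⟩ :=
    exists_setIntegral_flux_ge hd hΩ hb (volume_frontier_eq_zero hΩ hb hL) P hP
  obtain ⟨D, hD, hstab⟩ := exists_l2Norm_gradient_proj_le hd hΩ hb hL r hσ
  refine ⟨2 * c, 2 * C * (D + 1), by positivity, by positivity,
    fun T hT ρt0 f φ ρ ρt hf hφ h t ht δ hδ hδ1 => ?_⟩
  have h1 := (energy_regularity hΩ hb h.mem h.cont_zero h.diff).2 t ht
  have h2 := h.eqn t ht _ (h.mem t ht.le)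
  have h3 := hflux T r _ _ (h.mem t ht.le) (h.proj t ht.le).1 δ hδ hδ1
  have h4 := hstab T hT _ _ (hφ t ht.le) (h.proj t ht.le)
  have h5 := setIntegral_mul_le_l2Norm (hf t ht.le) (h.memLp hΩ hb ht.le)
  have h6 : (∫ x in Ω, ρt t x ^ 2) ^ (P.β / 2) = l2Norm Ω (ρt t) ^ P.β := by
    rw [← h.l2Norm_sq hΩ hb ht.le, ← Real.rpow_two, ← Real.rpow_mul (l2Norm_nonneg _)]
    congr 1; ring
  simp only [h1.deriv, h6, h.sqrt_energy hΩ hb ht.le]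
  have h7 := mul_le_mul_of_nonneg_left h4 hC.le
  have h8 : 0 ≤ C * D * δ ^ 2 := by positivity
  have h9 : 0 ≤ C * h1Norm Ω (φ t) ^ 2 := by positivity
  nlinarith

/-! ### Upper limits -/

lemma limsupTop_le {u : ℝ → ℝ} {m : ℝ} (h : ∀ᶠ t in atTop, u t ≤ m) :
    limsupTop u ≤ ENNReal.ofReal m :=
  limsup_le_of_le (by isBoundedDefault) (h.mono fun _ ht => ENNReal.ofReal_le_ofReal ht)

lemma eventually_le_of_limsupTop_lt {u : ℝ → ℝ} {m : ℝ} (h : limsupTop u < ENNReal.ofReal m) :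
    ∀ᶠ t in atTop, u t ≤ m := by
  filter_upwards [eventually_lt_of_limsup_lt h (by isBoundedDefault)] with t ht
  exact (ENNReal.ofReal_lt_ofReal_iff'.1 ht).1.le

lemma tendsto_of_limsupTop_eq_zero {u : ℝ → ℝ} (hu : ∀ t, 0 ≤ u t) (h : limsupTop u = 0) :
    Tendsto u atTop (𝓝 0) := by
  rw [Metric.tendsto_nhds]
  intro ε hε
  have h1 : limsupTop u < ENNReal.ofReal (ε / 2) := by
    rw [h]; exact ENNReal.ofReal_pos.2 (by positivity)
  filter_upwards [eventually_le_of_limsupTop_lt h1] with t ht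
  rw [Real.dist_eq, sub_zero, abs_of_nonneg (hu t)]
  linarith

end Forchheimer
end

open Forchheimer
theorem theorem4p1 (d : ℕ) (hd : 2 ≤ d) (Ω : Set (Space d)) (hΩo : IsOpen Ω)
    (hΩb : Bornology.IsBounded Ω) (hΩL : HasLipschitzBoundary Ω)
    (P : GenPoly) (hP : P.DegreeCondition d) (r : ℕ) (σ : ℝ) (hσ : 0 < σ) :
    ∃ C : ℝ, 0 < C ∧ ∀ T : Triangulation Ω, T.QuasiUniform σ →
      ∀ (ρt0 : Space d → ℝ) (f φ ρh ρth : ℝ → Space d → ℝ),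
        MemLp ρt0 2 (volume.restrict Ω) →
        (∀ t, 0 ≤ t → MemLp (f t) 2 (volume.restrict Ω)) →
        (∀ t, 0 ≤ t → MemH1 Ω (φ t)) →
        IsSemidiscreteSolution P T r ρt0 f φ ρh ρth →
          (∀ Env : ℝ → ℝ, IsEnvelope (Ici 0) (dataSize P Ω f φ) Env → ∀ t, 0 < t →
            l2Norm Ω (ρth t) ≤ C * (1 + l2Norm Ω ρt0 + Env t ^ (1 / P.β))) ∧
          limsupTop (fun t => l2Norm Ω (ρth t) ^ 2) ≤
            ENNReal.ofReal C * (1 + limsupTop (dataSize P Ω f φ)) ^ (2 / P.β) ∧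
          (limsupTop (fun t => l2Norm Ω (f t)) = 0 →
            limsupTop (fun t => h1Norm Ω (φ t)) = 0 →
              limsupTop (fun t => l2Norm Ω (ρth t) ^ 2) = 0) := by
  obtain ⟨c, C, hc, hC, henergy⟩ := exists_energyInequality hd hΩo hΩb hΩL P hP r hσ
  obtain ⟨D, hD, hbounds⟩ := EnergyInequality.bounds P hc hC
  have hβ := P.β_pos
  have h2β : (0 : ℝ) < 2 / P.β := by positivity
  -- The factor `2^(2/β)` absorbs `2 + G ≤ 2 (1 + G)`, needed because the data eventually lie below
  -- `G + 1` but not necessarily below their upper limit `G`.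
  refine ⟨(D + 1) * 2 ^ (2 / P.β), by positivity,
    fun T hT ρt0 f φ ρ ρt h0 hf hφ h => ?_⟩
  have hone : (1 : ℝ) ≤ 2 ^ (2 / P.β) := Real.one_le_rpow one_le_two h2β.le
  have hreg := energy_regularity hΩo hΩb h.mem h.cont_zero h.diff
  obtain ⟨b1, b2, b3⟩ := hbounds _ _ _ (fun t _ => integral_nonneg fun x => sq_nonneg _)
    (fun t => l2Norm_nonneg (f t)) hreg.1 (fun t ht => (hreg.2 t ht).differentiableAt)
    (henergy T hT ρt0 f φ ρ ρt hf hφ h)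
  have hdata : ∀ t, 0 ≤ dataSize P Ω f φ t := fun t =>
    add_nonneg (Real.rpow_nonneg (l2Norm_nonneg _) _) (sq_nonneg _)
  refine ⟨fun Env hEnv t ht => ?_, ?_, fun h1 h2 => ?_⟩
  -- By monotonicity the single number `Env t` bounds the data on all of `[0, t]`.
  · have h1 := b1 t ht (Env t) fun s hs =>
      (hEnv.2.2 s hs.1).trans (hEnv.2.1 hs.1 ht.le hs.2)
    rw [h.sqrt_energy hΩo hΩb ht.le, h.sqrt_energy hΩo hΩb le_rfl] at h1
    have h2 := h.l2Norm_init_le hΩo hΩb h0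
    have h3 : 0 ≤ Env t ^ (1 / P.β) :=
      Real.rpow_nonneg ((hdata t).trans (hEnv.2.2 t ht.le)) _
    have h4 := l2Norm_nonneg (Ω := Ω) ρt0
    calc l2Norm Ω (ρt t) ≤ l2Norm Ω ρt0 + D * (1 + Env t ^ (1 / P.β)) := h1.trans (by linarith)
      _ ≤ (D + 1) * (1 + l2Norm Ω ρt0 + Env t ^ (1 / P.β)) := by nlinarith
      _ ≤ _ := mul_le_mul_of_nonneg_right (le_mul_of_one_le_right (by positivity) hone)
          (by positivity)
  -- If the data have infinite upper limit, the right-hand side is infinite.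
  · rcases eq_or_ne (limsupTop (dataSize P Ω f φ)) ⊤ with htop | htop
    · rw [htop, add_top, ENNReal.top_rpow_of_pos h2β, ENNReal.mul_top
        (ENNReal.ofReal_pos.2 (by positivity)).ne']
      exact le_top
    · set G := (limsupTop (dataSize P Ω f φ)).toReal with hG
      have hG0 : 0 ≤ G := ENNReal.toReal_nonneg
      have hGe : limsupTop (dataSize P Ω f φ) = ENNReal.ofReal G := (ENNReal.ofReal_toReal htop).symm
      have h1 : limsupTop (dataSize P Ω f φ) < ENNReal.ofReal (G + 1) := by
        rw [hGe]; exact (ENNReal.ofReal_lt_ofReal_iff (by positivity)).2 (by linarith)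
      have h2 := b2 (G + 1) (by positivity) (eventually_le_of_limsupTop_lt h1)
      have h3 : ∀ᶠ t in atTop, l2Norm Ω (ρt t) ^ 2 ≤
          (D + 1) * 2 ^ (2 / P.β) * (1 + G) ^ (2 / P.β) := by
        filter_upwards [h2, eventually_ge_atTop 0] with t ht ht0
        rw [h.l2Norm_sq hΩo hΩb ht0, mul_assoc, ← Real.mul_rpow (by norm_num) (by positivity)]
        refine ht.trans (mul_le_mul (by linarith) ?_ (by positivity) (by positivity))
        exact Real.rpow_le_rpow (by positivity) (by linarith) h2β.le
      refine (limsupTop_le h3).trans_eq ?_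
      rw [hGe, ENNReal.ofReal_mul (by positivity), ← ENNReal.ofReal_rpow_of_pos (by positivity),
        ENNReal.ofReal_add zero_le_one hG0, ENNReal.ofReal_one]
  · have h3 := b3 (tendsto_of_limsupTop_eq_zero (fun t => l2Norm_nonneg _) h1)
      (tendsto_of_limsupTop_eq_zero (fun t => Real.sqrt_nonneg _) h2)
    refine nonpos_iff_eq_zero.1 (ENNReal.le_of_forall_pos_le_add fun ε hε _ => ?_)
    rw [zero_add, ← ENNReal.ofReal_coe_nnreal]
    refine limsupTop_le ?_
    filter_upwards [h3 ε hε, eventually_ge_atTop 0] with t ht ht0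
    rwa [h.l2Norm_sq hΩo hΩb ht0]
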